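/- Let $m\ge 2$ and $q\in\mathbb C^*$. Let $V=\mathbb C^{2m}$ with the antidiagonal symplectic form $J$, $J_{i,2m+1-i}=(-1)^i$, let $G=\mathrm{PSp}_{2m}(\mathbb C)=\mathrm{Sp}(V,J)/\{\pm1\}$, let $B_\pm$ be its upper/lower triangular Borel subgroups, $U_\pm$ their unipotent radicals and $T$ the diagonal torus. Let $e_i=E_{i,i+1}+E_{2m-i,2m-i+1}$ $(1\le i\le m-1)$, $e_m=E_{m,m+1}$, $f_i=e_i^T$, $x_i(a)=\exp(ae_i)$, $y_i(a)=\exp(af_i)$ and $\dot s_i=y_i(-1)x_i(1)y_i(-1)$, and write $\dot w$ for the product of the $\dot s_i$ along a reduced expression of a Weyl group element $w$. Let $w_0$ and $w_P$ be the longest elements of $W$ and of $W_P=\langle s_2,\dots,s_m\rangle$, and let $w^P=s_1\cdots s_{m-1}s_ms_{m-1}\cdots s_1$ be the minimal length representative of $w_0W_P$. Put $$\mathcal R=(B_+\dot w_PB_-\cap B_-\dot w_0B_-)/B_-\subset G/B_-,\qquad Z_d=B_-\dot w_0\cap U_+d\dot w_PU_-\quad(d\in T^{W_P}).$$ Let $p_0,\dots,p_{2m-1}$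 be homogeneous coordinates on $\check X=\mathbb P^{2m-1}$, and let $\pi_L:Z_d\to\check X$ send $z$ to the point whose coordinates are the entries of the bottom row of $z$ read from right to left. For $0\le l\le m-1$ let $r_l=p_lp_{2m-1-l}-p_{l-1}p_{2m-l}+\dots+(-1)^lp_0p_{2m-1}$, and let $D_0=\{p_0=0\}$, $D_l=\{r_l=0\}$ $(1\le l\le m-1)$, $D_m=\{p_{2m-1}=0\}$, $D=D_0+\dots+D_m$, $\check X^\circ=\check X\setminus D$, $$W_q=\frac{p_1}{p_0}+\sum_{l=1}^{m-1}\frac{p_{l+1}p_{2m-1-l}}{r_l}+q\,\frac{p_1}{p_{2m-1}}:\ \check X^\circ\to\mathbb C .$$ Then $D$ is an anticanonical divisor of $\check X$ (its equation is a nonzero form of degree $2m$), there is exactly one $d\in T^{W_P}$ with $\alpha_1(d)=q$, and for this $d$: (1) $\pi_R:Z_d\to\mathcal R$, $z\mapsto zB_-$, is an isomorphism of varieties. (2) $\varphi=\pi_L\circ\pi_R^{-1}$ is an isomorphism of varieties $\mathcal R\to\check X^\circ$. (3) For every $\xi\in\mathcal R$ the element $z=\pi_R^{-1}(\xi)$ has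 a factorization $z=u_1d\dot w_P\bar u_2$ with $u_1\in U_+$, $\bar u_2\in U_-\cap B_+(\dot w^P)^{-1}B_+$; the number $\mathcal F_q(\xi)=\sum_i e_i^*(u_1)+\sum_i f_i^*(\bar u_2)$, where $e_i^*(u_1)$ and $f_i^*(\bar u_2)$ are the $(i,i+1)$ entry of $u_1$ and the $(i+1,i)$ entry of $\bar u_2$ in their unipotent lifts to $\mathrm{Sp}(V,J)$, does not depend on the factorization, and $\mathcal F_q=W_q\circ\varphi$. So the Landau–Ginzburg models $(\mathcal R,\mathcal F_q)$ and $(\check X^\circ,W_q)$ are isomorphic. (4) The same holds for the normalization in which $z=u_1d\dot w_P\bar u_2^{-1}$ with arbitrary $u_1\in U_+$, $\bar u_2\in U_-$: the number $\mathcal F'_q(\xi)=\sum_i e_i^*(u_1)+\sum_i f_i^*(\bar u_2)$ does not depend on the factorization, and $\mathcal F'_q=W_q\circ\psi$, where $\psi:\mathcal R\to\check X^\circ$ is the isomorphism $\varphi$ followed by $p_k\mapsto(-1)^kp_k$. -/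

import Mathlib

open scoped Matrix

noncomputable section

/-! ### Spaces with functions

Complex algebraic varieties in the classical sense: a set with its Zariski topology and, for each
open set `U`, the collection of regular functions on `U`.  All varieties below are obtained from
affine space by passing to (locally closed) subvarieties and to quotients. -/

/-- A set with a topology and a notion of regular complex-valued function on (open) subsets.
`reg U f` says that the restriction of `f` to `U` is regular; it is only used for open `U`. -/
structure FunSpace (X : Type*) where
  top : TopologicalSpace X
  reg : Set X → (X → ℂ) → Prop

namespace FunSpace

/-- Affine space with coordinates indexed by `ι`: the Zariski topology is generated by the
nonvanishing loci of polynomials, and regular functions are locally quotients of polynomials. -/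
def affine (ι : Type*) : FunSpace (ι → ℂ) where
  top := TopologicalSpace.generateFrom
    {U | ∃ a : MvPolynomial ι ℂ, U = {x | MvPolynomial.eval x a ≠ 0}}
  reg U f := ∀ x ∈ U, ∃ a b : MvPolynomial ι ℂ, MvPolynomial.eval x b ≠ 0 ∧
    ∀ y ∈ U, MvPolynomial.eval y b ≠ 0 → f y = MvPolynomial.eval y a / MvPolynomial.eval y b

/-- The structure induced on `Y` by an injection `j : Y → X` (a subvariety): subspace topology,
and a function is regular if it locally extends to a regular function on an open subset of `X`. -/
def induced {X Y : Type*} (A : FunSpace X) (j : Y → X) : FunSpace Y where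
  top := TopologicalSpace.induced j A.top
  reg U f := ∀ y ∈ U, ∃ V : Set X, A.top.IsOpen V ∧ j y ∈ V ∧ ∃ g : X → ℂ, A.reg V g ∧
    ∀ y' ∈ U, j y' ∈ V → f y' = g (j y')

/-- The quotient structure on `Y` along a surjection `π : X → Y`: quotient topology, and a function
on `U` is regular if its pullback to `π ⁻¹' U` is regular. -/
def quotient {X Y : Type*} (A : FunSpace X) (π : X → Y) : FunSpace Y where
  top := TopologicalSpace.coinduced π A.top
  reg U f := A.reg (π ⁻¹' U) (f ∘ π)

/-- Morphisms: Zariski continuous maps that pull back regular functions to regular functions. -/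
def IsMorphism {X Y : Type*} (A : FunSpace X) (B : FunSpace Y) (φ : X → Y) : Prop :=
  (∀ V : Set Y, B.top.IsOpen V → A.top.IsOpen (φ ⁻¹' V)) ∧
  ∀ V : Set Y, B.top.IsOpen V → ∀ f : Y → ℂ, B.reg V f → A.reg (φ ⁻¹' V) (f ∘ φ)

/-- Isomorphisms: morphisms with a two-sided inverse that is a morphism. -/
def IsIso {X Y : Type*} (A : FunSpace X) (B : FunSpace Y) (φ : X → Y) : Prop :=
  IsMorphism A B φ ∧ ∃ ψ : Y → X, IsMorphism B A ψ ∧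
    Function.LeftInverse ψ φ ∧ Function.RightInverse ψ φ

end FunSpace

namespace QuadricLG

variable (m : ℕ)

/-! ### The symplectic group and its Chevalley generators

Rows and columns are indexed by `Fin (2 * m)`, so the index `i` of the usual numbering `1, …, 2m` is the element with
value `i - 1`. -/

/-- The symplectic form: antidiagonal, with entry `(-1)^i` in the `i`-th row (`i = 1, …, 2m`). -/
def J : Matrix (Fin (2 * m)) (Fin (2 * m)) ℂ :=
  Matrix.of fun a b => if a.val + b.val + 1 = 2 * m then (-1) ^ (a.val + 1) else 0

/-- The symplectic group `Sp(V, J)`, `V = ℂ^{2m}`. -/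
def Sp : Subgroup (GL (Fin (2 * m)) ℂ) where
  carrier := {g | (g.val)ᵀ * J m * g.val = J m}
  one_mem' := by simp
  mul_mem' := by
    intro a b ha hb
    simp only [Set.mem_ofPred_eq, Units.val_mul, Matrix.transpose_mul] at *
    calc (b.val)ᵀ * (a.val)ᵀ * J m * (a.val * b.val)
        = (b.val)ᵀ * ((a.val)ᵀ * J m * a.val) * b.val := by simp only [Matrix.mul_assoc]
      _ = J m := by rw [ha, hb]
  inv_mem' := by
    intro a ha
    simp only [Set.mem_ofPred_eq] at *
    have h1 : a.val * a⁻¹.val = 1 := by rw [← Units.val_mul]; simp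
    have h2 : (a⁻¹.val)ᵀ * (a.val)ᵀ = 1 := by
      rw [← Matrix.transpose_mul, h1, Matrix.transpose_one]
    calc (a⁻¹.val)ᵀ * J m * a⁻¹.val
        = (a⁻¹.val)ᵀ * ((a.val)ᵀ * J m * a.val) * a⁻¹.val := by rw [ha]
      _ = ((a⁻¹.val)ᵀ * (a.val)ᵀ) * J m * (a.val * a⁻¹.val) := by simp only [Matrix.mul_assoc]
      _ = J m := by rw [h1, h2]; simp

variable {m}

/-- The underlying matrix of an element of `Sp`. -/
def mat (g : Sp m) : Matrix (Fin (2 * m)) (Fin (2 * m)) ℂ := g.val.val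

theorem mat_mul (g h : Sp m) : mat (g * h) = mat g * mat h := rfl

variable (m)

/-- The scalar matrices in `Sp`, i.e. its centre `{1, -1}`. -/
def scalars : Subgroup (Sp m) where
  carrier := {g | ∃ c : ℂ, c ≠ 0 ∧ mat g = c • (1 : Matrix _ _ ℂ)}
  one_mem' := ⟨1, one_ne_zero, by simp [mat]⟩
  mul_mem' := by
    rintro a b ⟨c, hc, ha⟩ ⟨c', hc', hb⟩
    exact ⟨c * c', mul_ne_zero hc hc', by rw [mat_mul, ha, hb]; simp [smul_smul, mul_comm]⟩
  inv_mem' := by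
    rintro a ⟨c, hc, ha⟩
    refine ⟨c⁻¹, inv_ne_zero hc, ?_⟩
    have h : mat a * mat a⁻¹ = 1 := by rw [← mat_mul]; simp [mat]
    rw [ha, Matrix.smul_mul, Matrix.one_mul] at h
    rw [← h, smul_smul, inv_mul_cancel₀ hc, one_smul]

instance scalars_normal : (scalars m).Normal where
  conj_mem := by
    rintro a ⟨c, hc, ha⟩ g
    refine ⟨c, hc, ?_⟩
    rw [mat_mul, mat_mul, ha, Matrix.mul_smul, Matrix.mul_one, Matrix.smul_mul, ← mat_mul]
    simp [mat]

/-- The group `PSp_{2m}(ℂ) = Sp(V, J) / {±1}`. -/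
abbrev PSp : Type := Sp m ⧸ scalars m

variable {m}

/-- The class in `PSp` of a symplectic matrix. -/
def cls (g : Sp m) : PSp m := QuotientGroup.mk g

variable (m)

/-- The Chevalley generator `e_i`, `1 ≤ i ≤ m`: `e_i = E_{i,i+1} + E_{2m-i,2m-i+1}` for `i < m`
and `e_m = E_{m,m+1}`. -/
def e (i : ℕ) : Matrix (Fin (2 * m)) (Fin (2 * m)) ℂ :=
  Matrix.of fun a b =>
    if b.val = a.val + 1 ∧ (a.val + 1 = i ∨ a.val + 1 + i = 2 * m) then 1 else 0

theorem e_mul_self (i : ℕ) : e m i * e m i = 0 := by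
  ext a c
  rw [Matrix.mul_apply]
  refine Finset.sum_eq_zero fun b _ => ?_
  simp only [e, Matrix.of_apply, mul_ite, mul_one, mul_zero]
  split_ifs <;> first | rfl | omega

theorem e_transpose_J (i : ℕ) : (e m i)ᵀ * J m = -(J m * e m i) := by
  ext a b
  rw [Matrix.neg_apply, Matrix.mul_apply, Matrix.mul_apply]
  have ha := a.2
  have hb := b.2
  rw [Finset.sum_eq_single (⟨2 * m - 1 - b.val, by omega⟩ : Fin (2 * m)),
    Finset.sum_eq_single (⟨2 * m - 1 - a.val, by omega⟩ : Fin (2 * m))]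
  · have hJ1 : J m ⟨2 * m - 1 - b.val, by omega⟩ b = (-1) ^ (2 * m - 1 - b.val + 1) := by
      simp only [J, Matrix.of_apply]
      exact if_pos (by omega)
    have hJ2 : J m a ⟨2 * m - 1 - a.val, by omega⟩ = (-1) ^ (a.val + 1) := by
      simp only [J, Matrix.of_apply]
      exact if_pos (by omega)
    rw [hJ1, hJ2]
    simp only [e, Matrix.of_apply, Matrix.transpose_apply]
    by_cases h : a.val + b.val = 2 * m ∧ (a.val = i ∨ a.val + i = 2 * m)
    · obtain ⟨h1, h2⟩ := h
      rw [if_pos ⟨by omega, by omega⟩, if_pos ⟨by omega, by omega⟩]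
      have : 2 * m - 1 - b.val + 1 = a.val := by omega
      rw [this]; ring
    · rw [if_neg (fun h' => h ⟨by omega, by omega⟩), if_neg (fun h' => h ⟨by omega, by omega⟩)]
      simp
  · intro c _ hc
    have : ¬ (a.val + c.val + 1 = 2 * m) := by
      intro h; apply hc; ext; simp; omega
    simp [J, this]
  · simp
  · intro c _ hc
    have : ¬ (c.val + b.val + 1 = 2 * m) := by
      intro h; apply hc; ext; simp; omega
    simp [J, this]
  · simp

theorem f_mul_self (i : ℕ) : (e m i)ᵀ * (e m i)ᵀ = 0 := by
  rw [← Matrix.transpose_mul, e_mul_self, Matrix.transpose_zero]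

theorem f_transpose_J (i : ℕ) : e m i * J m = -(J m * (e m i)ᵀ) := by
  ext a b
  rw [Matrix.neg_apply, Matrix.mul_apply, Matrix.mul_apply]
  have ha := a.2
  have hb := b.2
  rw [Finset.sum_eq_single (⟨2 * m - 1 - b.val, by omega⟩ : Fin (2 * m)),
    Finset.sum_eq_single (⟨2 * m - 1 - a.val, by omega⟩ : Fin (2 * m))]
  · have hJ1 : J m ⟨2 * m - 1 - b.val, by omega⟩ b = (-1) ^ (2 * m - 1 - b.val + 1) := by
      simp only [J, Matrix.of_apply]
      exact if_pos (by omega)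
    have hJ2 : J m a ⟨2 * m - 1 - a.val, by omega⟩ = (-1) ^ (a.val + 1) := by
      simp only [J, Matrix.of_apply]
      exact if_pos (by omega)
    rw [hJ1, hJ2]
    simp only [e, Matrix.of_apply, Matrix.transpose_apply]
    by_cases h : a.val + b.val + 2 = 2 * m ∧ (a.val + 1 = i ∨ a.val + 1 + i = 2 * m)
    · obtain ⟨h1, h2⟩ := h
      rw [if_pos ⟨by omega, by omega⟩, if_pos ⟨by omega, by omega⟩]
      have : 2 * m - 1 - b.val + 1 = a.val + 2 := by omega
      rw [this]; ring
    · rw [if_neg (fun h' => h ⟨by omega, by omega⟩), if_neg (fun h' => h ⟨by omega, by omega⟩)]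
      simp
  · intro c _ hc
    have : ¬ (a.val + c.val + 1 = 2 * m) := by
      intro h; apply hc; ext; simp; omega
    simp [J, this]
  · simp
  · intro c _ hc
    have : ¬ (c.val + b.val + 1 = 2 * m) := by
      intro h; apply hc; ext; simp; omega
    simp [J, this]
  · simp

variable {m}

/-- For `N² = 0` with `N` in the symplectic Lie algebra, `exp (a N) = 1 + a N` as an element
of `Sp`. -/
def expNil (N : Matrix (Fin (2 * m)) (Fin (2 * m)) ℂ) (h0 : N * N = 0)
    (hJ : Nᵀ * J m = -(J m * N)) (a : ℂ) : Sp m :=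
  ⟨⟨1 + a • N, 1 + (-a) • N,
    by simp [mul_add, add_mul, h0], by simp [mul_add, add_mul, h0]⟩, by
    change (1 + a • N)ᵀ * J m * (1 + a • N) = J m
    have h4 : J m * N * N = 0 := by rw [Matrix.mul_assoc, h0]; simp
    simp [add_mul, mul_add, hJ, h4]⟩

variable (m)

/-- `x_i(a) = exp (a e_i)`; since `e_i² = 0` this is `1 + a e_i`. -/
def x (i : ℕ) (a : ℂ) : Sp m := expNil (e m i) (e_mul_self m i) (e_transpose_J m i) a

/-- `y_i(a) = exp (a f_i)`, where `f_i = e_iᵀ`; since `f_i² = 0` this is `1 + a f_i`. -/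
def y (i : ℕ) (a : ℂ) : Sp m :=
  expNil (e m i)ᵀ (f_mul_self m i) (by rw [Matrix.transpose_transpose, f_transpose_J]) a

/-- The representative `ṡ_i = y_i(-1) x_i(1) y_i(-1)` of the simple reflection `s_i`. -/
def sdot (i : ℕ) : PSp m := cls (y m i (-1) * x m i 1 * y m i (-1))

/-- The product `ṡ_{i₁} ⋯ ṡ_{iᵣ}` along a word in the simple reflections. -/
def wordRep (l : List ℕ) : PSp m := (l.map (sdot m)).prod

/-- `ẇ₀`, from the reduced expression `(s_1 s_2 ⋯ s_m)^m`, of length `m²`, of the longest element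
of the Weyl group of type `C_m`. -/
def w0 : PSp m := wordRep m (List.range' 1 m) ^ m

/-- `ẇ_P`, from the reduced expression `(s_2 ⋯ s_m)^(m-1)`, of length `(m-1)²`, of the longest
element of `W_P = ⟨s_2, …, s_m⟩`, which is a Weyl group of type `C_{m-1}`. -/
def wP : PSp m := wordRep m (List.range' 2 (m - 1)) ^ (m - 1)

/-- `ẇ^P = ṡ_1 ⋯ ṡ_{m-1} ṡ_m ṡ_{m-1} ⋯ ṡ_1`, for the minimal length representative `w^P` of
the coset `w₀ W_P`. -/
def wUpP : PSp m := wordRep m (List.range' 1 m ++ (List.range' 1 (m - 1)).reverse)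

/-! ### Borel subgroups, unipotent radicals, torus -/

/-- Upper triangular matrices in `Sp`. -/
def upperSp : Subgroup (Sp m) where
  carrier := {g | (mat g).BlockTriangular id}
  one_mem' := Matrix.blockTriangular_one
  mul_mem' := by
    intro a b ha hb
    exact Matrix.BlockTriangular.mul ha hb
  inv_mem' := by
    intro a ha
    have : mat a⁻¹ = (mat a)⁻¹ := by
      simp [mat]
    change (mat a⁻¹).BlockTriangular id
    rw [this]
    have : Invertible (mat a) := (a : GL (Fin (2 * m)) ℂ).isUnit.invertible
    exact Matrix.blockTriangular_inv_of_blockTriangular ha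

/-- Lower triangular matrices in `Sp`. -/
def lowerSp : Subgroup (Sp m) where
  carrier := {g | (mat g).BlockTriangular OrderDual.toDual}
  one_mem' := Matrix.blockTriangular_one
  mul_mem' := by
    intro a b ha hb
    exact Matrix.BlockTriangular.mul ha hb
  inv_mem' := by
    intro a ha
    have : mat a⁻¹ = (mat a)⁻¹ := by
      simp [mat]
    change (mat a⁻¹).BlockTriangular OrderDual.toDual
    rw [this]
    have : Invertible (mat a) := (a : GL (Fin (2 * m)) ℂ).isUnit.invertible
    exact Matrix.blockTriangular_inv_of_blockTriangular ha

/-- `B_+ ⊆ PSp`. -/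
def Bplus : Subgroup (PSp m) := (upperSp m).map (QuotientGroup.mk' (scalars m))

/-- `B_- ⊆ PSp`. -/
def Bminus : Subgroup (PSp m) := (lowerSp m).map (QuotientGroup.mk' (scalars m))

/-- The unipotent upper triangular matrices.  The quotient map `Sp → PSp` is injective on them, so
they are identified with the subgroup `U_+` of `PSp`. -/
def Uplus : Set (Sp m) := {g | g ∈ upperSp m ∧ ∀ i, mat g i i = 1}

/-- The unipotent lower triangular matrices, identified with the subgroup `U_-` of `PSp`. -/
def Uminus : Set (Sp m) := {g | g ∈ lowerSp m ∧ ∀ i, mat g i i = 1}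

/-- The maximal torus `T ⊆ PSp` of classes of diagonal matrices. -/
def T : Set (PSp m) := {d | ∃ g : Sp m, (mat g).IsDiag ∧ cls g = d}

/-- `T^{W_P}`: the elements of `T` fixed by `s_2, …, s_m`. -/
def TWP : Set (PSp m) :=
  {d | d ∈ T m ∧ ∀ i : ℕ, 2 ≤ i → i ≤ m → sdot m i * d * (sdot m i)⁻¹ = d}

variable {m}

/-- The entry of a matrix with row and column numbers given as natural numbers, starting at `0`. -/
def entry (g : Sp m) (a b : ℕ) : ℂ :=
  if h : a < 2 * m ∧ b < 2 * m then mat g ⟨a, h.1⟩ ⟨b, h.2⟩ else 0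

/-- The simple root `α_1`, sending the class of `diag(d_1, …, d_{2m})` to `d_1 / d_2`
(extended to `PSp` by the same formula, but only used on the torus). -/
def alpha1 (d : PSp m) : ℂ :=
  Quotient.liftOn' d (fun g => entry g 0 0 / entry g 1 1) (by
    intro a b hab
    obtain ⟨c, hc, h⟩ := QuotientGroup.leftRel_apply.mp hab
    have hb : mat b = c • mat a := by
      have : b = a * (a⁻¹ * b) := by group
      rw [this, mat_mul, h, Matrix.mul_smul, Matrix.mul_one]
    have he : ∀ i j, entry b i j = c * entry a i j := by
      intro i j
      unfold entry
      split_ifs <;> simp [hb]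
    simp only [he]
    rw [mul_div_mul_left _ _ hc])

/-- `Σ e_i^*(u)`, the sum of the coefficients of `e_1, …, e_m` in the upper unipotent `u`. -/
def sumE (u : Sp m) : ℂ := ∑ i : Fin m, entry u i.val (i.val + 1)

/-- `Σ f_i^*(u)`, the sum of the coefficients of `f_1, …, f_m` in the lower unipotent `u`. -/
def sumF (u : Sp m) : ℂ := ∑ i : Fin m, entry u (i.val + 1) i.val

/-! ### The open Richardson variety and the Lie-theoretic model -/

variable (m)

/-- `Z_d = B_- ẇ₀ ∩ U_+ d ẇ_P U_-`. -/
def Z (d : PSp m) : Set (PSp m) :=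
  {z | (∃ b ∈ Bminus m, z = b * w0 m) ∧
    ∃ u₁ ∈ Uplus m, ∃ u₂ ∈ Uminus m, z = cls u₁ * d * wP m * cls u₂}

/-- The flag variety `PSp / B_-`. -/
abbrev Flag : Type := PSp m ⧸ Bminus m

/-- The open Richardson variety `R = (B_+ ẇ_P B_- ∩ B_- ẇ₀ B_-) / B_-`. -/
def R : Set (Flag m) :=
  (fun g : PSp m => (QuotientGroup.mk g : Flag m)) ''
    (DoubleCoset.doubleCoset (wP m) (Bplus m) (Bminus m) ∩
      DoubleCoset.doubleCoset (w0 m) (Bminus m) (Bminus m))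

variable {m}

/-- `IsValue d r t` says that `t` is a value of the superpotential `F_d` at `r ∈ R`: there is a
factorization `z = u₁ d ẇ_P ū₂ ∈ Z_d` with `z B_- = r`, `u₁ ∈ U_+` and
`ū₂ ∈ U_- ∩ B_+ (ẇ^P)⁻¹ B_+`, for which `t = Σ e_i^*(u₁) + Σ f_i^*(ū₂)`. -/
def IsValue (d : PSp m) (r : Flag m) (t : ℂ) : Prop :=
  ∃ u₁ ∈ Uplus m, ∃ u₂ ∈ Uminus m,
    cls u₂ ∈ DoubleCoset.doubleCoset (wUpP m)⁻¹ (Bplus m) (Bplus m) ∧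
    cls u₁ * d * wP m * cls u₂ ∈ Z m d ∧
    (QuotientGroup.mk (cls u₁ * d * wP m * cls u₂) : Flag m) = r ∧
    t = sumE u₁ + sumF u₂

/-- The same for the normalization `z = u₁ d ẇ_P ū₂⁻¹`, where `u₁ ∈ U_+` and `ū₂ ∈ U_-` are
arbitrary. -/
def IsValueInv (d : PSp m) (r : Flag m) (t : ℂ) : Prop :=
  ∃ u₁ ∈ Uplus m, ∃ u₂ ∈ Uminus m,
    cls u₁ * d * wP m * (cls u₂)⁻¹ ∈ Z m d ∧
    (QuotientGroup.mk (cls u₁ * d * wP m * (cls u₂)⁻¹) : Flag m) = r ∧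
    t = sumE u₁ + sumF u₂

/-! ### The mirror projective space -/

variable (m)

/-- The projective space `P^{2m-1} = P(V^*) = P \ PSp`, with homogeneous coordinates
`(p_0 : … : p_{2m-1})`. -/
abbrev Xch : Type := Projectivization ℂ (Fin (2 * m) → ℂ)

variable {m}

/-- The Plücker coordinates `(p_0, …, p_{2m-1})` of `g`: the bottom row of `g`, read from right to
left.  As a point of projective space this is the coset `P g`. -/
def plucker (g : Sp m) : Fin (2 * m) → ℂ :=
  fun k => entry g (2 * m - 1) (2 * m - 1 - k.val)

/-- `v` is a vector of homogeneous coordinates of the point `ξ`. -/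
def HasCoords (ξ : Xch m) (v : Fin (2 * m) → ℂ) : Prop :=
  ∃ h : v ≠ 0, ξ = Projectivization.mk ℂ v h

variable (m)

/-- The coordinate `p_k`, `0 ≤ k ≤ 2m-1`, as a polynomial. -/
def p (k : ℕ) : MvPolynomial (Fin (2 * m)) ℂ :=
  if h : k < 2 * m then MvPolynomial.X ⟨k, h⟩ else 0

/-- `r_l = p_l p_{2m-1-l} - p_{l-1} p_{2m-l} + ⋯ + (-1)^l p_0 p_{2m-1}`. -/
def r (l : ℕ) : MvPolynomial (Fin (2 * m)) ℂ :=
  ∑ k ∈ Finset.range (l + 1), (-1) ^ k * p m (l - k) * p m (2 * m - 1 - l + k)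

/-- The equation of `D_i`, `0 ≤ i ≤ m`. -/
def Deq (i : ℕ) : MvPolynomial (Fin (2 * m)) ℂ :=
  if i = 0 then p m 0 else if i = m then p m (2 * m - 1) else r m i

/-- The equation of the divisor `D = D_0 + D_1 + ⋯ + D_m`. -/
def Dsum : MvPolynomial (Fin (2 * m)) ℂ := ∏ i ∈ Finset.range (m + 1), Deq m i

/-- A homogeneous polynomial `F ≠ 0` in `2m` variables defines an anticanonical divisor of
`P^{2m-1}` iff it has degree `2m`, since the canonical class is `-2m` times the hyperplane class. -/
def IsAnticanonicalEq (F : MvPolynomial (Fin (2 * m)) ℂ) : Prop :=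
  F ≠ 0 ∧ F.IsHomogeneous (2 * m)

/-- `X̌° = P^{2m-1} ∖ (D_0 ∪ ⋯ ∪ D_m)`. -/
def Xo : Set (Xch m) :=
  {ξ | ∀ i ≤ m, ∀ v, HasCoords ξ v → MvPolynomial.eval v (Deq m i) ≠ 0}

variable {m}

/-- `W_q = p_1/p_0 + Σ_{l=1}^{m-1} p_{l+1} p_{2m-1-l} / r_l + q p_1 / p_{2m-1}` in homogeneous
coordinates `v`. -/
def Wvec (q : ℂ) (v : Fin (2 * m) → ℂ) : ℂ :=
  MvPolynomial.eval v (p m 1) / MvPolynomial.eval v (p m 0)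
    + ∑ l ∈ Finset.Icc 1 (m - 1),
        MvPolynomial.eval v (p m (l + 1)) * MvPolynomial.eval v (p m (2 * m - 1 - l))
          / MvPolynomial.eval v (r m l)
    + q * (MvPolynomial.eval v (p m 1) / MvPolynomial.eval v (p m (2 * m - 1)))

theorem eval_p_smul (k : ℕ) (c : ℂ) (v : Fin (2 * m) → ℂ) :
    MvPolynomial.eval (c • v) (p m k) = c * MvPolynomial.eval v (p m k) := by
  unfold p
  split_ifs <;> simp

theorem eval_r_smul (l : ℕ) (c : ℂ) (v : Fin (2 * m) → ℂ) :
    MvPolynomial.eval (c • v) (r m l) = c * c * MvPolynomial.eval v (r m l) := by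
  unfold r
  simp only [map_sum, map_mul, eval_p_smul, Finset.mul_sum]
  refine Finset.sum_congr rfl fun k _ => ?_
  simp only [map_pow, map_neg, map_one]
  ring

theorem Wvec_smul (q c : ℂ) (hc : c ≠ 0) (v : Fin (2 * m) → ℂ) : Wvec q (c • v) = Wvec q v := by
  unfold Wvec
  simp only [eval_p_smul, eval_r_smul]
  rw [mul_div_mul_left _ _ hc, mul_div_mul_left _ _ hc]
  congr 2
  refine Finset.sum_congr rfl fun l _ => ?_
  rw [show ∀ a b : ℂ, c * a * (c * b) = c * c * (a * b) from fun a b => by ring,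
    mul_div_mul_left _ _ (mul_ne_zero hc hc)]

/-- The rational function `W_q` on `P^{2m-1}` (with an irrelevant value where a denominator
vanishes). -/
def W (q : ℂ) (ξ : Xch m) : ℂ :=
  Projectivization.lift (fun v : {v : Fin (2 * m) → ℂ // v ≠ 0} => Wvec q v.1) (by
    intro a b c h
    have hc : c ≠ 0 := by
      rintro rfl
      exact a.2 (by rw [h, zero_smul])
    change Wvec q a.1 = Wvec q b.1
    rw [h, Wvec_smul q c hc]) ξ

/-! ### Variety structures -/

variable (m)

/-- `PSp = Sp / {±1}`, where `Sp` is a closed subvariety of the affine space of matrices. -/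
def varPSp : FunSpace (PSp m) :=
  ((FunSpace.affine (Fin (2 * m) × Fin (2 * m))).induced
    (fun (g : Sp m) ij => mat g ij.1 ij.2)).quotient cls

/-- `Z_d` as a subvariety of `PSp`. -/
def varZ (d : PSp m) : FunSpace (Z m d) := (varPSp m).induced Subtype.val

/-- `R` as a subvariety of the homogeneous space `PSp / B_-`. -/
def varR : FunSpace (R m) :=
  ((varPSp m).quotient (fun g => (QuotientGroup.mk g : Flag m))).induced Subtype.val

/-- `X̌°` as an open subvariety of `P^{2m-1} = (ℂ^{2m} ∖ 0) / ℂ^*`. -/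
def varXo : FunSpace (Xo m) :=
  (((FunSpace.affine (Fin (2 * m))).induced
    (fun v : {v : Fin (2 * m) → ℂ // v ≠ 0} => v.1)).quotient
      (fun v => (Projectivization.mk ℂ v.1 v.2 : Xch m))).induced Subtype.val

end QuadricLG

end

/-! Everything is computed with symplectic matrices, with indices starting at 0. A lower unipotent
`u₂` is a Levi part `v` times a Heisenberg element `y` that carries the bottom row of `u₂`
(`exists_levi_mul_heis`). If `c` is the lift of `d ẇ_P`, then `c v = (v⁻¹)ᵀ c` (`cLift_mul_levi`),
and `(v⁻¹)ᵀ` is upper unipotent. Hence every element of `Z_d` is the class of some `z = U c y` with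
`U ∈ U_+`. Its bottom row, read from the right, is `q⁻¹ (P_0, …, P_{2m-1})` with `P_0 = 1`, where
`P` is the bottom row of `y`.

Lying in `B_- ẇ₀` means that all entries above the antidiagonal vanish. Put `S_k = Σ_{j<k} (-1)^j
P_j P_{2m-1-j}` (`quad`). Then `S_{2m-k} = S_k`, and `S_{l+1} = ± r_l`. For the last column `A` of
`z` the vanishing conditions give `A_{2m-1-k} S_k = P_k` and `A_0 P_{2m-1} = -q` (`last_mul_quad`,
`first_mul_last`). They force every `S_k` to be nonzero, which is the condition defining the
complement of `D`, and they determine `U`. Conversely the resulting formula for `U` always works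
(`antiTri_uMat`, `uMat_mul_adj`). So `π_L` is bijective onto the complement of `D`, with rational
inverse.

For `π_R`: a flag `z B_-` determines `A` up to a scalar. The identity `S_k(A) S_k(P) = -1`
(`quad_last_mul_quad`) turns the equations above into a formula for `P` that is rational and
homogeneous of degree 0 in `A`, and this inverts `π_R` by a morphism.

For the superpotential, let `Σ` be the middle sum of `W_q`. Moving the Levi part across `c`
preserves `sumE u₁ - sumF u₂`, which is therefore `sumE U - P_1`. The superdiagonal of `U` gives
`sumE U = q P_1 / P_{2m-1} - Σ` (`sumE_eq`). With the signs `(-1)^k` this is the second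
normalization. In the first one, the double coset condition says that the strictly lower part of
`u₂` has rank one, whence `sumF u₂ = P_1 + Σ` (`sumF_of_rankOne`). Adding twice this value turns the
difference into `W_q`. -/

open scoped Matrix

noncomputable section

/-! ### Morphisms of spaces with functions -/

namespace FunSpace

/-- `F` is a morphism on the open subset `O` of the source. -/
def MorphismOn {X Y : Type*} (A : FunSpace X) (B : FunSpace Y) (O : Set X) (F : X → Y) : Prop :=
  (∀ V : Set Y, B.top.IsOpen V → A.top.IsOpen (O ∩ F ⁻¹' V)) ∧
  ∀ V : Set Y, B.top.IsOpen V → ∀ f : Y → ℂ, B.reg V f → A.reg (O ∩ F ⁻¹' V) (f ∘ F)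

theorem IsMorphism.morphismOn {X Y : Type*} {A : FunSpace X} {B : FunSpace Y} {F : X → Y}
    (h : IsMorphism A B F) : MorphismOn A B Set.univ F := by
  constructor
  · intro V hV
    simpa using h.1 V hV
  · intro V hV f hf
    simpa using h.2 V hV f hf

theorem MorphismOn.comp {X Y Z : Type*} {A : FunSpace X} {B : FunSpace Y} {C : FunSpace Z}
    {O : Set X} {F : X → Y} {G : Y → Z} (hG : IsMorphism B C G) (hF : MorphismOn A B O F) :
    MorphismOn A C O (G ∘ F) :=
  ⟨fun V hV => hF.1 _ (hG.1 V hV), fun V hV f hf => hF.2 _ (hG.1 V hV) _ (hG.2 V hV f hf)⟩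

theorem IsMorphism.comp {X Y Z : Type*} {A : FunSpace X} {B : FunSpace Y} {C : FunSpace Z}
    {F : X → Y} {G : Y → Z} (hG : IsMorphism B C G) (hF : IsMorphism A B F) :
    IsMorphism A C (G ∘ F) :=
  ⟨fun V hV => hF.1 _ (hG.1 V hV), fun V hV f hf => hF.2 _ (hG.1 V hV) _ (hG.2 V hV f hf)⟩

theorem IsIso.comp {X Y Z : Type*} {A : FunSpace X} {B : FunSpace Y} {C : FunSpace Z}
    {F : X → Y} {G : Y → Z} (hG : IsIso B C G) (hF : IsIso A B F) : IsIso A C (G ∘ F) := by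
  obtain ⟨h1, F', h2, h3, h4⟩ := hF
  obtain ⟨k1, G', k2, k3, k4⟩ := hG
  exact ⟨k1.comp h1, F' ∘ G', h2.comp k2, fun x => by simp [h3 _, k3 _], fun x => by simp [h4 _, k4 _]⟩

theorem isMorphism_quotient {X Y : Type*} (A : FunSpace X) (π : X → Y) :
    IsMorphism A (A.quotient π) π :=
  ⟨fun _ hV => hV, fun _ _ _ hf => hf⟩

theorem MorphismOn.of_quotient {X Y Z : Type*} {A : FunSpace X} {B : FunSpace Z} {π : X → Y}
    {O : Set Y} {F : Y → Z} (h : MorphismOn A B (π ⁻¹' O) (F ∘ π)) :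
    MorphismOn (A.quotient π) B O F :=
  ⟨fun V hV => h.1 V hV, fun V hV f hf => h.2 V hV f hf⟩

/-- A morphism on an open neighbourhood of a subvariety restricts to the subvariety. -/
theorem MorphismOn.induced {X Y X' Y' : Type*} {A : FunSpace X} {B : FunSpace Y} {O : Set X}
    {F : X → Y} (h : MorphismOn A B O F) (j : X' → X) (k : Y' → Y) (f : X' → Y')
    (hO : ∀ x, j x ∈ O) (hf : ∀ x, k (f x) = F (j x)) :
    IsMorphism (A.induced j) (B.induced k) f := by
  constructor
  · rintro V ⟨V₀, hV₀, rfl⟩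
    refine ⟨O ∩ F ⁻¹' V₀, h.1 V₀ hV₀, ?_⟩
    ext x
    simp [hO, hf]
  · intro V _ g hg x hx
    obtain ⟨V₁, hV₁, hx₁, g₁, hg₁, he⟩ := hg (f x) hx
    refine ⟨O ∩ F ⁻¹' V₁, h.1 V₁ hV₁, ⟨hO x, ?_⟩, g₁ ∘ F, h.2 V₁ hV₁ g₁ hg₁, ?_⟩
    · rw [Set.mem_preimage, ← hf]
      exact hx₁
    · intro x' hx' hx''
      have := he (f x') hx' (by rw [hf]; exact hx''.2)
      simpa [hf] using this

/-- The function `f` on `X` is, on `O`, a quotient of polynomials in the coordinates `j`. -/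
def IsRat {X ι : Type*} (j : X → ι → ℂ) (O : Set X) (f : X → ℂ) : Prop :=
  ∃ a b : MvPolynomial ι ℂ, ∀ x ∈ O, MvPolynomial.eval (j x) b ≠ 0 ∧
    f x = MvPolynomial.eval (j x) a / MvPolynomial.eval (j x) b

/-! ### Rational functions without poles and the morphisms they define -/

section IsRat

variable {X ι : Type*} {j : X → ι → ℂ} {O : Set X}

theorem isRat_const (c : ℂ) : IsRat j O fun _ => c :=
  ⟨MvPolynomial.C c, 1, fun x _ => by simp⟩

theorem isRat_coord (i : ι) : IsRat j O fun x => j x i :=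
  ⟨MvPolynomial.X i, 1, fun x _ => by simp⟩

theorem IsRat.congr {f g : X → ℂ} (hf : IsRat j O f) (h : ∀ x ∈ O, f x = g x) : IsRat j O g := by
  obtain ⟨a, b, hab⟩ := hf
  exact ⟨a, b, fun x hx => h x hx ▸ hab x hx⟩

theorem IsRat.add {f g : X → ℂ} (hf : IsRat j O f) (hg : IsRat j O g) :
    IsRat j O fun x => f x + g x := by
  obtain ⟨a, b, h⟩ := hf
  obtain ⟨a', b', h'⟩ := hg
  refine ⟨a * b' + b * a', b * b', fun x hx => ?_⟩
  obtain ⟨h1, h2⟩ := h x hx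
  obtain ⟨h3, h4⟩ := h' x hx
  refine ⟨by simp [h1, h3], ?_⟩
  change f x + g x = _
  rw [h2, h4, div_add_div _ _ h1 h3]
  simp

theorem IsRat.mul {f g : X → ℂ} (hf : IsRat j O f) (hg : IsRat j O g) :
    IsRat j O fun x => f x * g x := by
  obtain ⟨a, b, h⟩ := hf
  obtain ⟨a', b', h'⟩ := hg
  refine ⟨a * a', b * b', fun x hx => ?_⟩
  obtain ⟨h1, h2⟩ := h x hx
  obtain ⟨h3, h4⟩ := h' x hx
  refine ⟨by simp [h1, h3], ?_⟩
  change f x * g x = _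
  rw [h2, h4, div_mul_div_comm]
  simp

theorem IsRat.div {f g : X → ℂ} (hf : IsRat j O f) (hg : IsRat j O g) (h0 : ∀ x ∈ O, g x ≠ 0) :
    IsRat j O fun x => f x / g x := by
  obtain ⟨a, b, h⟩ := hf
  obtain ⟨a', b', h'⟩ := hg
  refine ⟨a * b', b * a', fun x hx => ?_⟩
  obtain ⟨h1, h2⟩ := h x hx
  obtain ⟨h3, h4⟩ := h' x hx
  have h5 : MvPolynomial.eval (j x) a' ≠ 0 := by
    intro h6
    exact h0 x hx (by rw [h4, h6, zero_div])
  refine ⟨by simp [h1, h5], ?_⟩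
  change f x / g x = _
  rw [h2, h4, div_div_div_eq]
  simp

theorem isRat_sum {κ : Type*} (s : Finset κ) {f : κ → X → ℂ} (h : ∀ k ∈ s, IsRat j O (f k)) :
    IsRat j O fun x => ∑ k ∈ s, f k x := by
  classical
  induction s using Finset.induction_on with
  | empty => simpa using isRat_const 0
  | insert a s ha ih =>
    simp only [Finset.sum_insert ha]
    exact (h a (by simp)).add (ih fun k hk => h k (by simp [hk]))

theorem isRat_eval {κ : Type*} {k : X → κ → ℂ} (h : ∀ i, IsRat j O fun x => k x i)
    (c : MvPolynomial κ ℂ) : IsRat j O fun x => MvPolynomial.eval (k x) c := by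
  induction c using MvPolynomial.induction_on with
  | C a => simpa using isRat_const a
  | add p q hp hq => simpa using hp.add hq
  | mul_X p i hp => simpa using hp.mul (h i)

theorem isOpen_eval_ne (b : MvPolynomial ι ℂ) :
    ((affine ι).induced j).top.IsOpen {x | MvPolynomial.eval (j x) b ≠ 0} :=
  ⟨{x | MvPolynomial.eval x b ≠ 0}, TopologicalSpace.GenerateOpen.basic _ ⟨b, rfl⟩, rfl⟩

/-- On `O` the zeros of `f` are those of its numerator, so the locus is cut out of `O` by one
polynomial. -/
theorem IsRat.isOpen_ne {f : X → ℂ} (hf : IsRat j O f)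
    (hO : ((affine ι).induced j).top.IsOpen O) :
    ((affine ι).induced j).top.IsOpen {x | x ∈ O ∧ f x ≠ 0} := by
  obtain ⟨a, b, h⟩ := hf
  have : {x | x ∈ O ∧ f x ≠ 0} = O ∩ {x | MvPolynomial.eval (j x) a ≠ 0} := by
    ext x
    simp only [Set.mem_ofPred_eq, Set.mem_inter_iff]
    refine and_congr_right fun hx => ?_
    obtain ⟨h1, h2⟩ := h x hx
    rw [h2, Ne, div_eq_zero_iff]
    simp [h1]
  rw [this]
  exact ((affine ι).induced j).top.isOpen_inter _ _ hO (isOpen_eval_ne a)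

/-- A map between subvarieties of affine spaces whose coordinates are rational functions without
poles is a morphism. -/
theorem morphismOn_of_isRat {Y κ : Type*} {k : Y → κ → ℂ} {F : X → Y}
    (hO : ((affine ι).induced j).top.IsOpen O) (h : ∀ i, IsRat j O fun x => k (F x) i) :
    MorphismOn ((affine ι).induced j) ((affine κ).induced k) O F := by
  -- The Zariski topology is given by generators, so openness of preimages is proved by induction on
  -- how an open set is generated; the basic sets come from `IsRat.isOpen_ne`.
  have key : ∀ V₀ : Set (κ → ℂ), (affine κ).top.IsOpen V₀ →
      ((affine ι).induced j).top.IsOpen (O ∩ (fun x => k (F x)) ⁻¹' V₀) := by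
    intro V₀ hV₀
    induction hV₀ with
    | basic s hs =>
      obtain ⟨a, rfl⟩ := hs
      exact (isRat_eval h a).isOpen_ne hO
    | univ => simpa using hO
    | inter s t _ _ hs ht =>
      rw [Set.preimage_inter, Set.inter_inter_distrib_left]
      exact ((affine ι).induced j).top.isOpen_inter _ _ hs ht
    | sUnion S _ hS =>
      have : O ∩ (fun x => k (F x)) ⁻¹' ⋃₀ S =
          ⋃₀ ((fun s => O ∩ (fun x => k (F x)) ⁻¹' s) '' S) := by
        ext x
        simp
      rw [this]
      refine ((affine ι).induced j).top.isOpen_sUnion _ ?_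
      rintro _ ⟨s, hs, rfl⟩
      exact hS s hs
  constructor
  · rintro V ⟨V₀, hV₀, rfl⟩
    exact key V₀ hV₀
  · intro V _ f hf x hx
    obtain ⟨V₁, hV₁, hx₁, g, hg, he⟩ := hf (F x) hx.2
    obtain ⟨a, b, hb, hab⟩ := hg _ hx₁
    obtain ⟨O', hO', hOO'⟩ := key V₁ hV₁
    obtain ⟨c, d, hcd⟩ := isRat_eval h a
    obtain ⟨c', d', hcd'⟩ := isRat_eval h b
    dsimp only at hcd hcd'
    have hc' : MvPolynomial.eval (j x) c' ≠ 0 := by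
      intro h6
      exact hb (by rw [(hcd' x hx.1).2, h6, zero_div])
    -- With `a ∘ F = c / d` and `b ∘ F = c' / d'`, the quotient `(a / b) ∘ F` is `c d' / (d c')`;
    -- the neighbourhood is shrunk to where this denominator does not vanish.
    refine ⟨O' ∩ {t | MvPolynomial.eval t (d * c') ≠ 0}, (affine ι).top.isOpen_inter _ _ hO'
      (TopologicalSpace.GenerateOpen.basic _ ⟨d * c', rfl⟩), ⟨?_, ?_⟩,
      fun t => MvPolynomial.eval t (c * d') / MvPolynomial.eval t (d * c'), ?_, ?_⟩
    · change x ∈ j ⁻¹' O'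
      rw [hOO']
      exact ⟨hx.1, hx₁⟩
    · simp [hc', (hcd x hx.1).1]
    · exact fun t ht => ⟨c * d', d * c', ht.2, fun _ _ _ => rfl⟩
    · intro x' hx' hx''
      have h1 : x' ∈ O ∩ (fun x => k (F x)) ⁻¹' V₁ := by
        rw [← hOO']
        exact hx''.1
      have h2 := he (F x') hx'.2 h1.2
      obtain ⟨e1, e2⟩ := hcd x' hx'.1
      obtain ⟨e3, e4⟩ := hcd' x' hx'.1
      have hb' : MvPolynomial.eval (k (F x')) b ≠ 0 := by
        rw [e4]
        refine div_ne_zero (fun h6 => hx''.2 ?_) e3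
        simp [h6]
      have h3 := hab _ h1.2 hb'
      dsimp only at h3
      rw [Function.comp_apply, h2, h3, e2, e4, div_div_div_eq]
      simp only [map_mul]

end IsRat

end FunSpace

namespace QuadricLG

variable {m : ℕ}

/-! ### Inverses and transposes in the symplectic group -/

theorem mat_injective : Function.Injective (mat : Sp m → _) :=
  fun _ _ h => Subtype.ext (Units.ext h)

theorem mat_one : mat (1 : Sp m) = 1 := rfl

theorem mat_mul_mat_inv (g : Sp m) : mat g * mat g⁻¹ = 1 := by
  rw [← mat_mul, mul_inv_cancel, mat_one]

theorem mat_inv_mul_mat (g : Sp m) : mat g⁻¹ * mat g = 1 := by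
  rw [← mat_mul, inv_mul_cancel, mat_one]

theorem neg_one_pow_congr {a b : ℕ} (h : a % 2 = b % 2) : (-1 : ℂ) ^ a = (-1) ^ b := by
  rw [neg_one_pow_eq_pow_mod_two, h, ← neg_one_pow_eq_pow_mod_two]

theorem neg_one_pow_congr_neg {a b : ℕ} (h : a % 2 ≠ b % 2) : (-1 : ℂ) ^ a = -(-1) ^ b := by
  rw [neg_one_pow_congr (b := b + 1) (by omega), pow_succ]
  ring

theorem neg_one_pow_mul_self (a : ℕ) : (-1 : ℂ) ^ a * (-1) ^ a = 1 := by
  rw [← pow_add, ← two_mul, pow_mul]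
  simp

theorem J_mul_apply (M : Matrix (Fin (2 * m)) (Fin (2 * m)) ℂ) (a b : Fin (2 * m)) :
    (J m * M) a b = (-1) ^ (a.val + 1) * M a.rev b := by
  rw [Matrix.mul_apply, Finset.sum_eq_single a.rev]
  · simp only [J, Matrix.of_apply]
    rw [if_pos (by rw [Fin.val_rev]; omega)]
  · intro c _ hc
    simp only [J, Matrix.of_apply]
    rw [if_neg, zero_mul]
    intro h
    apply hc
    ext
    rw [Fin.val_rev]
    omega
  · simp

theorem mul_J_apply (M : Matrix (Fin (2 * m)) (Fin (2 * m)) ℂ) (a b : Fin (2 * m)) :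
    (M * J m) a b = (-1) ^ b.val * M a b.rev := by
  rw [Matrix.mul_apply, Finset.sum_eq_single b.rev]
  · simp only [J, Matrix.of_apply]
    rw [if_pos (by rw [Fin.val_rev]; omega), mul_comm]
    rw [neg_one_pow_congr (b := b.val) (by rw [Fin.val_rev]; omega)]
  · intro c _ hc
    simp only [J, Matrix.of_apply]
    rw [if_neg, mul_zero]
    intro h
    apply hc
    ext
    rw [Fin.val_rev]
    omega
  · simp

theorem J_mul_J : J m * J m = -1 := by
  ext a b
  rw [J_mul_apply, Matrix.neg_apply, Matrix.one_apply]
  simp only [J, Matrix.of_apply, Fin.val_rev]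
  by_cases h : a = b
  · subst h
    rw [if_pos (by omega), if_pos rfl, ← pow_add]
    rw [neg_one_pow_congr (b := 1) (by omega), pow_one]
  · rw [if_neg, if_neg h]
    · simp
    · intro h'
      apply h
      ext
      omega

/-- The adjoint of a matrix with respect to the symplectic form. -/
def adj (M : Matrix (Fin (2 * m)) (Fin (2 * m)) ℂ) : Matrix (Fin (2 * m)) (Fin (2 * m)) ℂ :=
  Matrix.of fun a b => (-1) ^ (a.val + b.val) * M b.rev a.rev

theorem adj_apply (M : Matrix (Fin (2 * m)) (Fin (2 * m)) ℂ) (a b : Fin (2 * m)) :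
    adj M a b = (-1) ^ (a.val + b.val) * M b.rev a.rev := rfl

theorem adj_eq (M : Matrix (Fin (2 * m)) (Fin (2 * m)) ℂ) : adj M = -(J m * Mᵀ * J m) := by
  ext a b
  rw [Matrix.neg_apply, mul_J_apply, J_mul_apply, adj_apply, Matrix.transpose_apply]
  ring

theorem adj_mul (M N : Matrix (Fin (2 * m)) (Fin (2 * m)) ℂ) :
    adj (M * N) = adj N * adj M := by
  have : J m * Nᵀ * J m * (J m * Mᵀ * J m) = J m * Nᵀ * (J m * J m) * (Mᵀ * J m) := by
    simp only [Matrix.mul_assoc]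
  rw [adj_eq, adj_eq, adj_eq, Matrix.transpose_mul, neg_mul_neg, this, J_mul_J]
  simp [Matrix.mul_assoc]

theorem adj_transpose (M : Matrix (Fin (2 * m)) (Fin (2 * m)) ℂ) : adj Mᵀ = (adj M)ᵀ := by
  ext a b
  simp [adj_apply, add_comm]

theorem adj_mul_mat (g : Sp m) : adj (mat g) * mat g = 1 := by
  have h : (mat g)ᵀ * J m * mat g = J m := g.2
  rw [adj_eq, Matrix.neg_mul, Matrix.mul_assoc, Matrix.mul_assoc, ← Matrix.mul_assoc _ (J m), h,
    J_mul_J, neg_neg]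

theorem mat_inv (g : Sp m) : mat g⁻¹ = adj (mat g) := by
  calc mat g⁻¹ = adj (mat g) * mat g * mat g⁻¹ := by rw [adj_mul_mat, one_mul]
    _ = adj (mat g) := by rw [Matrix.mul_assoc, mat_mul_mat_inv, mul_one]

theorem mat_inv_apply (g : Sp m) (a b : Fin (2 * m)) :
    mat g⁻¹ a b = (-1) ^ (a.val + b.val) * mat g b.rev a.rev := by
  rw [mat_inv, adj_apply]

/-- The element of `Sp` given by a matrix whose adjoint is its inverse. -/
def ofAdj (M : Matrix (Fin (2 * m)) (Fin (2 * m)) ℂ) (h : M * adj M = 1) : Sp m :=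
  ⟨⟨M, adj M, h, mul_eq_one_comm.mp h⟩, by
    change Mᵀ * J m * M = J m
    have h1 : adj M * M = 1 := mul_eq_one_comm.mp h
    rw [adj_eq] at h1
    calc Mᵀ * J m * M = -(J m * J m) * (Mᵀ * J m * M) := by rw [J_mul_J]; simp
      _ = J m * (-(J m * Mᵀ * J m) * M) := by
        simp only [Matrix.neg_mul, Matrix.mul_neg, Matrix.mul_assoc]
      _ = J m := by rw [h1, mul_one]⟩

theorem mat_ofAdj (M : Matrix (Fin (2 * m)) (Fin (2 * m)) ℂ) (h : M * adj M = 1) :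
    mat (ofAdj M h) = M := rfl

/-- The transpose of a symplectic matrix. -/
def tr (g : Sp m) : Sp m :=
  ofAdj (mat g)ᵀ (by
    rw [adj_transpose, ← Matrix.transpose_mul, adj_mul_mat, Matrix.transpose_one])

theorem mat_tr (g : Sp m) : mat (tr g) = (mat g)ᵀ := rfl

theorem tr_mul (g h : Sp m) : tr (g * h) = tr h * tr g := by
  apply mat_injective
  rw [mat_tr, mat_mul, mat_mul, Matrix.transpose_mul, mat_tr, mat_tr]

theorem tr_tr (g : Sp m) : tr (tr g) = g := mat_injective rfl

theorem tr_one : tr (1 : Sp m) = 1 := by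
  apply mat_injective
  rw [mat_tr, mat_one, Matrix.transpose_one]

theorem tr_inv (g : Sp m) : tr g⁻¹ = (tr g)⁻¹ := by
  rw [eq_inv_iff_mul_eq_one, ← tr_mul, mul_inv_cancel, tr_one]

/-! ### Lifts from `PSp` to `Sp` -/

theorem cls_mul (g h : Sp m) : cls (g * h) = cls g * cls h := rfl

theorem cls_inv (g : Sp m) : cls g⁻¹ = (cls g)⁻¹ := rfl

theorem cls_surjective : Function.Surjective (cls : Sp m → PSp m) := QuotientGroup.mk_surjective

theorem cls_eq_iff {g h : Sp m} : cls g = cls h ↔ ∃ c : ℂ, c ≠ 0 ∧ mat h = c • mat g := by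
  unfold cls
  rw [QuotientGroup.eq]
  constructor
  · rintro ⟨c, hc, h1⟩
    refine ⟨c, hc, ?_⟩
    rw [← mul_inv_cancel_left g h, mat_mul, h1, Matrix.mul_smul, mul_one]
  · rintro ⟨c, hc, h1⟩
    refine ⟨c, hc, ?_⟩
    rw [mat_mul, h1, Matrix.mul_smul, mat_inv_mul_mat]

/-! ### The action of the Weyl group representatives on the standard basis -/

/-- The standard basis vector with index `k`. -/
def E (m k : ℕ) : Fin (2 * m) → ℂ := fun i => if i.val = k then 1 else 0

/-- `g` maps the basis vector `k` to `c` times the basis vector `l`. -/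
def Acts (g : Sp m) (k : ℕ) (c : ℂ) (l : ℕ) : Prop := mat g *ᵥ E m k = c • E m l

theorem mulVec_E (M : Matrix (Fin (2 * m)) (Fin (2 * m)) ℂ) (b : Fin (2 * m)) :
    M *ᵥ E m b = fun a => M a b := by
  ext a
  simp [Matrix.mulVec, dotProduct, E, Fin.val_inj]

theorem Acts.apply {g : Sp m} {c : ℂ} {l : ℕ} {b : Fin (2 * m)} (h : Acts g b c l)
    (a : Fin (2 * m)) : mat g a b = if a.val = l then c else 0 := by
  have := congrFun h a
  rw [mulVec_E] at this
  simpa [E] using this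

theorem Acts.mul {g h : Sp m} {k l r : ℕ} {c d : ℂ} (hg : Acts g l d r) (hh : Acts h k c l) :
    Acts (g * h) k (c * d) r := by
  unfold Acts at *
  rw [mat_mul, ← Matrix.mulVec_mulVec, hh, Matrix.mulVec_smul, hg, smul_smul]

theorem acts_one (k : ℕ) : Acts (1 : Sp m) k 1 k := by
  simp [Acts, mat_one]

theorem E_eq_zero {k : ℕ} (hk : 2 * m ≤ k) : E m k = 0 := by
  ext a
  simp only [E, Pi.zero_apply]
  exact if_neg (by omega)

theorem e_mulVec_E {i : ℕ} (hi : 1 ≤ i) (him : i ≤ m) (k : ℕ) : e m i *ᵥ E m k =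
    (if k = i ∨ k + i = 2 * m then (1 : ℂ) else 0) • E m (k - 1) := by
  by_cases hk : k < 2 * m
  · have := mulVec_E (e m i) ⟨k, hk⟩
    dsimp only at this
    rw [this]
    ext a
    simp only [e, Matrix.of_apply, E, Pi.smul_apply, smul_eq_mul]
    split_ifs <;> simp <;> omega
  · rw [E_eq_zero (by omega), if_neg (by omega)]
    simp

theorem f_mulVec_E {i : ℕ} (hi : 1 ≤ i) (him : i ≤ m) (k : ℕ) : (e m i)ᵀ *ᵥ E m k =
    (if k + 1 = i ∨ k + 1 + i = 2 * m then (1 : ℂ) else 0) • E m (k + 1) := by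
  by_cases hk : k < 2 * m
  · have := mulVec_E (e m i)ᵀ ⟨k, hk⟩
    dsimp only at this
    rw [this]
    ext a
    simp only [e, Matrix.of_apply, Matrix.transpose_apply, E, Pi.smul_apply, smul_eq_mul]
    split_ifs <;> simp <;> omega
  · rw [E_eq_zero (by omega), if_neg (by omega)]
    simp

/-- The lift of `ṡ_i` to `Sp`. -/
def sdotLift (m i : ℕ) : Sp m := y m i (-1) * x m i 1 * y m i (-1)

theorem sdotLift_mulVec (i : ℕ) (v : Fin (2 * m) → ℂ) :
    mat (sdotLift m i) *ᵥ v =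
      v - (e m i)ᵀ *ᵥ v + e m i *ᵥ (v - (e m i)ᵀ *ᵥ v)
        - (e m i)ᵀ *ᵥ (v - (e m i)ᵀ *ᵥ v + e m i *ᵥ (v - (e m i)ᵀ *ᵥ v)) := by
  have hy : mat (y m i (-1)) = 1 - (e m i)ᵀ := by
    change 1 + (-1 : ℂ) • (e m i)ᵀ = _
    rw [neg_one_smul, sub_eq_add_neg]
  have hx : mat (x m i 1) = 1 + e m i := by
    change 1 + (1 : ℂ) • e m i = _
    rw [one_smul]
  rw [sdotLift, mat_mul, mat_mul, hy, hx, ← Matrix.mulVec_mulVec, ← Matrix.mulVec_mulVec]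
  simp only [Matrix.sub_mulVec, Matrix.add_mulVec, Matrix.one_mulVec]

/-- In each two-dimensional block `ṡ_i` acts as `[[0, 1], [-1, 0]]`: going up by one index costs a
sign, going down does not. The condition `k + 1 = i` selects the lower vector of the first block, `k
+ 1 + i = 2m` that of the mirrored block. -/
theorem acts_sdotLift {i : ℕ} (hi : 1 ≤ i) (him : i ≤ m) (k : ℕ) :
    Acts (sdotLift m i) k (if k + 1 = i ∨ k + 1 + i = 2 * m then -1 else 1)
      (if k + 1 = i ∨ k + 1 + i = 2 * m then k + 1
        else if k = i ∨ k + i = 2 * m then k - 1 else k) := by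
  unfold Acts
  rw [sdotLift_mulVec]
  by_cases h1 : k + 1 = i ∨ k + 1 + i = 2 * m
  · rw [if_pos h1, if_pos h1, f_mulVec_E hi him, if_pos h1, Matrix.mulVec_sub, e_mulVec_E hi him,
      if_neg (by omega), one_smul, e_mulVec_E hi him, if_pos (by omega)]
    simp only [zero_smul, one_smul, zero_sub, Nat.add_sub_cancel]
    rw [show E m k - E m (k + 1) + -E m k = -E m (k + 1) by abel, Matrix.mulVec_neg,
      f_mulVec_E hi him, if_neg (by omega)]
    simp
  · rw [if_neg h1, if_neg h1, f_mulVec_E hi him, if_neg h1]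
    simp only [zero_smul, one_smul, sub_zero]
    rw [e_mulVec_E hi him]
    by_cases h2 : k = i ∨ k + i = 2 * m
    · rw [if_pos h2, if_pos h2, one_smul, Matrix.mulVec_add, f_mulVec_E hi him, if_neg h1,
        f_mulVec_E hi him, if_pos (by omega), show k - 1 + 1 = k by omega]
      simp
    · rw [if_neg h2, if_neg h2]
      simp [f_mulVec_E hi him, h1]

/-- The product `ṡ_a ⋯ ṡ_m`, lifted to `Sp`. -/
def coxLift (m a : ℕ) : Sp m := ((List.range' a (m + 1 - a)).map (sdotLift m)).prod

theorem coxLift_succ : coxLift m (m + 1) = 1 := by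
  simp [coxLift]

theorem coxLift_eq {a : ℕ} (ha : a ≤ m) : coxLift m a = sdotLift m a * coxLift m (a + 1) := by
  unfold coxLift
  rw [show m + 1 - a = (m + 1 - (a + 1)) + 1 by omega, List.range'_succ, List.map_cons,
    List.prod_cons]

theorem Acts.congr {g : Sp m} {k l l' : ℕ} {c c' : ℂ} (h : Acts g k c l) (hc : c = c')
    (hl : l = l') : Acts g k c' l' := by
  subst hc hl
  exact h

/-- Up to signs the Coxeter element of `⟨s_a, …, s_m⟩` is one cycle, `a-1 → a → ⋯ → m-1 → 2m-a →
2m-a-1 → ⋯ → m → a-1`, of length `2(m+1-a)`, and fixes the other basis vectors. The proof adds one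
generator on the left at a time. -/
theorem acts_coxLift {a : ℕ} (ha1 : 1 ≤ a) (ha : a ≤ m + 1) :
    (∀ k, k + 1 < a ∨ 2 * m < k + a → Acts (coxLift m a) k 1 k) ∧
    (∀ k, a ≤ k + 1 → k + 1 < m → Acts (coxLift m a) k (-1) (k + 1)) ∧
    (1 ≤ m → Acts (coxLift m a) (m - 1) ((-1) ^ (m + 1 - a)) (2 * m - a)) ∧
    (1 ≤ m → Acts (coxLift m a) m 1 (a - 1)) ∧
    (∀ k, m < k → k + a ≤ 2 * m → Acts (coxLift m a) k 1 (k - 1)) := by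
  obtain ⟨l, hl⟩ : ∃ l, a + l = m + 1 := ⟨m + 1 - a, by omega⟩
  induction l generalizing a with
  | zero =>
    obtain rfl : a = m + 1 := by omega
    rw [coxLift_succ]
    refine ⟨fun k _ => acts_one k, fun k _ _ => by omega, fun _ => ?_, fun _ => ?_,
      fun k _ _ => by omega⟩
    · exact (acts_one _).congr (by simp) (by omega)
    · exact (acts_one _).congr (by simp) (by omega)
  | succ l ih =>
    obtain ⟨h1, h2, h3, h4, h5⟩ := ih (a := a + 1) (by omega) (by omega) (by omega)
    have hs := acts_sdotLift (m := m) ha1 (by omega)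
    rw [coxLift_eq (by omega)]
    refine ⟨fun k hk => ?_, fun k hk hk' => ?_, fun hm => ?_, fun hm => ?_, fun k hk hk' => ?_⟩
    · refine ((hs k).mul (h1 k (by omega))).congr ?_ ?_
      · rw [if_neg (by omega), one_mul]
      · rw [if_neg (by omega), if_neg (by omega)]
    · by_cases hka : a = k + 1
      · refine ((hs k).mul (h1 k (by omega))).congr ?_ ?_
        · rw [if_pos (by omega), one_mul]
        · rw [if_pos (by omega)]
      · refine ((hs (k + 1)).mul (h2 k (by omega) hk')).congr ?_ ?_
        · rw [if_neg (by omega), mul_one]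
        · rw [if_neg (by omega), if_neg (by omega)]
    · refine ((hs _).mul (h3 hm)).congr ?_ ?_
      · rw [if_pos (by omega), show m + 1 - a = m + 1 - (a + 1) + 1 by omega, pow_succ]
      · rw [if_pos (by omega)]
        omega
    · refine ((hs _).mul (h4 hm)).congr ?_ ?_
      · rw [if_neg (by omega), one_mul]
      · rw [if_neg (by omega), if_pos (by omega)]
        omega
    · by_cases hka : k + a = 2 * m
      · refine ((hs k).mul (h1 k (by omega))).congr ?_ ?_
        · rw [if_neg (by omega), one_mul]
        · rw [if_neg (by omega), if_pos (by omega)]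
      · refine ((hs (k - 1)).mul (h5 k hk (by omega))).congr ?_ ?_
        · rw [if_neg (by omega), one_mul]
        · rw [if_neg (by omega), if_neg (by omega)]

theorem acts_coxLift_pow_low {a : ℕ} (ha1 : 1 ≤ a) (ha : a ≤ m + 1) (k : ℕ) (hk : a ≤ k + 1) :
    ∀ j, k + j < m → Acts (coxLift m a ^ j) k ((-1) ^ j) (k + j) := by
  intro j
  induction j with
  | zero => intro _; simpa using acts_one k
  | succ j ih =>
    intro hj
    rw [pow_succ']
    exact (((acts_coxLift ha1 ha).2.1 (k + j) (by omega) (by omega)).mul (ih (by omega))).congr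
      (by rw [pow_succ]) (by omega)

theorem acts_coxLift_pow_high {a : ℕ} (ha1 : 1 ≤ a) (ha : a ≤ m + 1) (k : ℕ)
    (hk : k + a ≤ 2 * m) : ∀ j, m + j ≤ k → Acts (coxLift m a ^ j) k 1 (k - j) := by
  intro j
  induction j with
  | zero => intro _; simpa using acts_one k
  | succ j ih =>
    intro hj
    rw [pow_succ']
    exact (((acts_coxLift ha1 ha).2.2.2.2 (k - j) (by omega) (by omega)).mul
      (ih (by omega))).congr (by simp) (by omega)

theorem acts_coxLift_pow_fix {a : ℕ} (ha1 : 1 ≤ a) (ha : a ≤ m + 1) (k : ℕ)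
    (hk : k + 1 < a ∨ 2 * m < k + a) (j : ℕ) : Acts (coxLift m a ^ j) k 1 k := by
  induction j with
  | zero => simpa using acts_one k
  | succ j ih =>
    rw [pow_succ']
    exact (((acts_coxLift ha1 ha).1 k hk).mul ih).congr (by simp) rfl

/-- The lift of the longest element of `⟨s_a, …, s_m⟩`. -/
def longLift (m a : ℕ) : Sp m := coxLift m a ^ (m + 1 - a)

/-- The longest element is half a turn of the cycle in `acts_coxLift`. Starting in the lower half,
the path climbs to `m-1`, jumps to `2m-a` and descends; from the upper half it descends to `m`,
jumps to `a-1` and climbs. The sign counts the climbs and the jump. -/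
theorem acts_longLift {a : ℕ} (hm : 1 ≤ m) (ha1 : 1 ≤ a) (ha : a ≤ m + 1) (k : ℕ)
    (hk : a ≤ k + 1) (hk' : k + a ≤ 2 * m) :
    Acts (longLift m a) k ((-1) ^ (k + a)) (2 * m - 1 - k) := by
  unfold longLift
  by_cases h : k < m
  · rw [show m + 1 - a = (k + 1 - a) + (1 + (m - 1 - k)) by omega, pow_add, pow_add, pow_one]
    refine ((acts_coxLift_pow_high ha1 ha (2 * m - a) (by omega) _ (by omega)).mul
      (((acts_coxLift ha1 ha).2.2.1 hm).mul ((acts_coxLift_pow_low ha1 ha k hk (m - 1 - k)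
        (by omega)).congr rfl (by omega)))).congr ?_ (by omega)
    rw [mul_one, ← pow_add]
    exact neg_one_pow_congr (by omega)
  · rw [show m + 1 - a = (2 * m - a - k) + (1 + (k - m)) by omega, pow_add, pow_add, pow_one]
    refine ((acts_coxLift_pow_low ha1 ha (a - 1) (by omega) _ (by omega)).mul
      (((acts_coxLift ha1 ha).2.2.2.1 hm).mul ((acts_coxLift_pow_high ha1 ha k hk' (k - m)
        (by omega)).congr rfl (by omega)))).congr ?_ (by omega)
    rw [one_mul, one_mul]
    exact neg_one_pow_congr (by omega)

theorem acts_longLift_fix {a : ℕ} (ha1 : 1 ≤ a) (ha : a ≤ m + 1) (k : ℕ)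
    (hk : k + 1 < a ∨ 2 * m < k + a) : Acts (longLift m a) k 1 k :=
  acts_coxLift_pow_fix ha1 ha k hk _

/-- The class map as a homomorphism. -/
theorem cls_list_prod (l : List ℕ) : cls ((l.map (sdotLift m)).prod) = wordRep m l := by
  unfold wordRep
  induction l with
  | nil => rfl
  | cons a l ih =>
    rw [List.map_cons, List.prod_cons, cls_mul, ih, List.map_cons, List.prod_cons]
    rfl

theorem cls_pow (g : Sp m) (k : ℕ) : cls (g ^ k) = cls g ^ k := rfl

theorem cls_longLift_one : cls (longLift m 1) = w0 m := by
  unfold longLift coxLift w0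
  rw [cls_pow, cls_list_prod, Nat.add_sub_cancel]

theorem cls_longLift_two : cls (longLift m 2) = wP m := by
  unfold longLift coxLift wP
  rw [cls_pow, cls_list_prod, show m + 1 - 2 = m - 1 by omega]

/-- The lift of `ẇ^P`. -/
def wUpPLift (m : ℕ) : Sp m :=
  ((List.range' 1 m ++ (List.range' 1 (m - 1)).reverse).map (sdotLift m)).prod

theorem cls_wUpPLift : cls (wUpPLift m) = wUpP m := cls_list_prod _

/-- The palindromic word is the word for `i + 1` conjugated by `s_i`, so it represents the
reflection that interchanges the indices `i-1` and `2m-i`. Only the shape of the monomial matrix is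
needed later, so the scalars are left unspecified. -/
theorem acts_reflection (l : ℕ) : ∀ i, 1 ≤ i → i + l = m → ∀ k, ∃ c : ℂ,
    Acts ((((List.range' i (l + 1)) ++ (List.range' i l).reverse).map (sdotLift m)).prod) k c
      (if k + 1 = i ∨ k + i = 2 * m then 2 * m - 1 - k else k) := by
  induction l with
  | zero =>
    intro i hi him k
    simp only [zero_add, List.range'_one, List.range'_zero, List.reverse_nil, List.append_nil,
      List.map_cons, List.map_nil, List.prod_cons, List.prod_nil, mul_one]
    refine ⟨_, (acts_sdotLift hi (by omega) k).congr rfl ?_⟩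
    split_ifs <;> omega
  | succ l ih =>
    intro i hi him k
    have hw : ((((List.range' i (l + 1 + 1)) ++ (List.range' i (l + 1)).reverse).map
        (sdotLift m)).prod) = sdotLift m i *
        ((((List.range' (i + 1) (l + 1)) ++ (List.range' (i + 1) l).reverse).map
          (sdotLift m)).prod * sdotLift m i) := by
      rw [List.range'_succ (s := i) (n := l + 1), List.range'_succ (s := i) (n := l)]
      simp [mul_assoc]
    have hs := acts_sdotLift (m := m) hi (by omega)
    rw [hw]
    have h1 := hs k
    obtain ⟨c, h2⟩ := ih (i + 1) (by omega) (by omega) (if k + 1 = i ∨ k + 1 + i = 2 * m then k + 1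
        else if k = i ∨ k + i = 2 * m then k - 1 else k)
    refine ⟨_, ((hs _).mul (h2.mul h1)).congr rfl ?_⟩
    split_ifs <;> omega

theorem acts_wUpPLift (hm : 1 ≤ m) (k : ℕ) (hk : k < 2 * m) : ∃ c : ℂ, Acts (wUpPLift m) k c
    (if k = 0 ∨ k + 1 = 2 * m then 2 * m - 1 - k else k) := by
  obtain ⟨c, hc⟩ := acts_reflection (m := m) (m - 1) 1 le_rfl (by omega) k
  rw [show m - 1 + 1 = m by omega] at hc
  exact ⟨c, hc.congr rfl (by split_ifs <;> omega)⟩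

/-! ### Matrix entries indexed by natural numbers -/

/-- The entry of a matrix with row and column numbers given as natural numbers. -/
def ent (M : Matrix (Fin (2 * m)) (Fin (2 * m)) ℂ) (a b : ℕ) : ℂ :=
  if h : a < 2 * m ∧ b < 2 * m then M ⟨a, h.1⟩ ⟨b, h.2⟩ else 0

theorem entry_eq_ent (g : Sp m) (a b : ℕ) : entry g a b = ent (mat g) a b := rfl

theorem ent_coe (M : Matrix (Fin (2 * m)) (Fin (2 * m)) ℂ) (a b : Fin (2 * m)) :
    ent M a b = M a b := by
  simp [ent]

theorem ent_eq_zero_left (M : Matrix (Fin (2 * m)) (Fin (2 * m)) ℂ) {a b : ℕ} (h : 2 * m ≤ a) :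
    ent M a b = 0 :=
  dif_neg (by omega)

theorem ent_eq_zero_right (M : Matrix (Fin (2 * m)) (Fin (2 * m)) ℂ) {a b : ℕ}
    (h : 2 * m ≤ b) : ent M a b = 0 :=
  dif_neg (by omega)

theorem ent_of (f : ℕ → ℕ → ℂ) {a b : ℕ} (ha : a < 2 * m) (hb : b < 2 * m) :
    ent (Matrix.of fun a b : Fin (2 * m) => f a b) a b = f a b := by
  simp [ent, ha, hb]

theorem ent_ext {M N : Matrix (Fin (2 * m)) (Fin (2 * m)) ℂ}
    (h : ∀ a b, a < 2 * m → b < 2 * m → ent M a b = ent N a b) : M = N := by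
  ext a b
  rw [← ent_coe M, ← ent_coe N]
  exact h _ _ a.2 b.2

theorem ent_mul (M N : Matrix (Fin (2 * m)) (Fin (2 * m)) ℂ) (a b : ℕ) :
    ent (M * N) a b = ∑ k ∈ Finset.range (2 * m), ent M a k * ent N k b := by
  by_cases h : a < 2 * m ∧ b < 2 * m
  · rw [← Fin.sum_univ_eq_sum_range (fun k => ent M a k * ent N k b)]
    simp only [ent, h, and_self, dite_true, Matrix.mul_apply, Fin.is_lt]
  · rw [ent, dif_neg h]
    refine (Finset.sum_eq_zero fun k _ => ?_).symm
    by_cases ha : a < 2 * m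
    · rw [ent_eq_zero_right N (by omega), mul_zero]
    · rw [ent_eq_zero_left M (by omega), zero_mul]

theorem ent_one {a b : ℕ} (ha : a < 2 * m) :
    ent (1 : Matrix (Fin (2 * m)) (Fin (2 * m)) ℂ) a b = if a = b then 1 else 0 := by
  by_cases hb : b < 2 * m
  · simp [ent, ha, hb, Matrix.one_apply]
  · rw [ent_eq_zero_right _ (by omega), if_neg (by omega)]

theorem ent_smul (c : ℂ) (M : Matrix (Fin (2 * m)) (Fin (2 * m)) ℂ) (a b : ℕ) :
    ent (c • M) a b = c * ent M a b := by
  unfold ent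
  split_ifs <;> simp

theorem ent_transpose (M : Matrix (Fin (2 * m)) (Fin (2 * m)) ℂ) (a b : ℕ) :
    ent Mᵀ a b = ent M b a := by
  unfold ent
  simp only [Matrix.transpose_apply]
  split_ifs <;> first | rfl | omega

theorem ent_adj (M : Matrix (Fin (2 * m)) (Fin (2 * m)) ℂ) {a b : ℕ} (ha : a < 2 * m)
    (hb : b < 2 * m) :
    ent (adj M) a b = (-1) ^ (a + b) * ent M (2 * m - 1 - b) (2 * m - 1 - a) := by
  have h1 : 2 * m - 1 - b < 2 * m := by omega
  have h2 : 2 * m - 1 - a < 2 * m := by omega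
  simp only [ent, ha, hb, h1, h2, and_self, dite_true, adj_apply]
  congr 2 <;> ext <;> rw [Fin.val_rev] <;> dsimp only <;> omega

theorem ent_inv (g : Sp m) {a b : ℕ} (ha : a < 2 * m) (hb : b < 2 * m) :
    ent (mat g⁻¹) a b = (-1) ^ (a + b) * ent (mat g) (2 * m - 1 - b) (2 * m - 1 - a) := by
  rw [mat_inv, ent_adj _ ha hb]

theorem Acts.ent {g : Sp m} {c : ℂ} {b l : ℕ} (h : Acts g b c l) {a : ℕ} (ha : a < 2 * m)
    (hb : b < 2 * m) : ent (mat g) a b = if a = l then c else 0 := by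
  have := Acts.apply (b := ⟨b, hb⟩) h ⟨a, ha⟩
  rw [← ent_coe (mat g)] at this
  exact this

theorem Acts.ent_mul {g : Sp m} {c : ℂ} {b l : ℕ} (h : Acts g b c l) (hb : b < 2 * m)
    (hl : l < 2 * m) (M : Matrix (Fin (2 * m)) (Fin (2 * m)) ℂ) (a : ℕ) :
    QuadricLG.ent (M * mat g) a b = c * QuadricLG.ent M a l := by
  rw [QuadricLG.ent_mul, Finset.sum_eq_single l]
  · rw [h.ent hl hb, if_pos rfl, mul_comm]
  · intro k hk hkl
    rw [h.ent (Finset.mem_range.mp hk) hb, if_neg hkl, mul_zero]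
  · intro hl'
    exact absurd (Finset.mem_range.mpr hl) hl'

/-! ### Triangular matrices -/

theorem mem_upperSp_iff {g : Sp m} : g ∈ upperSp m ↔ ∀ a b, b < a → ent (mat g) a b = 0 := by
  constructor
  · intro h a b hab
    unfold ent
    split_ifs with h1
    · exact h (by simpa using hab)
    · rfl
  · intro h a b hab
    rw [← ent_coe (mat g)]
    exact h _ _ hab

theorem mem_lowerSp_iff {g : Sp m} : g ∈ lowerSp m ↔ ∀ a b, a < b → ent (mat g) a b = 0 := by
  constructor
  · intro h a b hab
    unfold ent
    split_ifs with h1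
    · exact h (by simpa using hab)
    · rfl
  · intro h a b hab
    rw [← ent_coe (mat g)]
    exact h _ _ hab

theorem mem_Uplus_iff {g : Sp m} : g ∈ Uplus m ↔
    (∀ a b, b < a → ent (mat g) a b = 0) ∧ ∀ a, a < 2 * m → ent (mat g) a a = 1 := by
  rw [← mem_upperSp_iff]
  refine and_congr_right fun _ => ⟨fun h a ha => ?_, fun h i => ?_⟩
  · rw [← h ⟨a, ha⟩, ← ent_coe (mat g)]
  · rw [← h i i.2, ent_coe]

theorem mem_Uminus_iff {g : Sp m} : g ∈ Uminus m ↔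
    (∀ a b, a < b → ent (mat g) a b = 0) ∧ ∀ a, a < 2 * m → ent (mat g) a a = 1 := by
  rw [← mem_lowerSp_iff]
  refine and_congr_right fun _ => ⟨fun h a ha => ?_, fun h i => ?_⟩
  · rw [← h ⟨a, ha⟩, ← ent_coe (mat g)]
  · rw [← h i i.2, ent_coe]

theorem tr_mem_Uminus {g : Sp m} (h : g ∈ Uplus m) : tr g ∈ Uminus m := by
  rw [mem_Uplus_iff] at h
  rw [mem_Uminus_iff, mat_tr]
  simp only [ent_transpose]
  exact ⟨fun a b hab => h.1 b a hab, h.2⟩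

theorem tr_mem_Uplus {g : Sp m} (h : g ∈ Uminus m) : tr g ∈ Uplus m := by
  rw [mem_Uminus_iff] at h
  rw [mem_Uplus_iff, mat_tr]
  simp only [ent_transpose]
  exact ⟨fun a b hab => h.1 b a hab, h.2⟩

theorem Uplus_inv {g : Sp m} (h : g ∈ Uplus m) : g⁻¹ ∈ Uplus m := by
  refine ⟨(upperSp m).inv_mem h.1, fun i => ?_⟩
  rw [mat_inv_apply, h.2, mul_one, pow_add, neg_one_pow_mul_self]

theorem Uplus_mul {g h : Sp m} (hg : g ∈ Uplus m) (hh : h ∈ Uplus m) : g * h ∈ Uplus m := by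
  refine ⟨(upperSp m).mul_mem hg.1 hh.1, fun i => ?_⟩
  rw [mat_mul, Matrix.mul_apply, Finset.sum_eq_single i]
  · rw [hg.2, hh.2, mul_one]
  · intro k _ hk
    rcases lt_or_gt_of_ne hk with h1 | h1
    · rw [hg.1 h1, zero_mul]
    · rw [hh.1 h1, mul_zero]
  · simp

theorem Uminus_inv {g : Sp m} (h : g ∈ Uminus m) : g⁻¹ ∈ Uminus m := by
  have := tr_mem_Uminus (Uplus_inv (tr_mem_Uplus h))
  rwa [tr_inv, tr_tr] at this

theorem Uminus_mul {g h : Sp m} (hg : g ∈ Uminus m) (hh : h ∈ Uminus m) : g * h ∈ Uminus m := by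
  have := tr_mem_Uminus (Uplus_mul (tr_mem_Uplus hh) (tr_mem_Uplus hg))
  rwa [tr_mul, tr_tr, tr_tr] at this

theorem eq_one_of_mem {g : Sp m} (h : g ∈ Uplus m) (h' : g ∈ lowerSp m) : g = 1 := by
  rw [mem_Uplus_iff] at h
  rw [mem_lowerSp_iff] at h'
  apply mat_injective
  rw [mat_one]
  refine ent_ext fun a b ha hb => ?_
  rw [ent_one ha]
  rcases lt_trichotomy a b with h1 | h1 | h1
  · rw [h' _ _ h1, if_neg (by omega)]
  · subst h1
    rw [h.2 a ha, if_pos rfl]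
  · rw [h.1 _ _ h1, if_neg (by omega)]

/-- On unipotent triangular matrices only two terms of the product reach the first superdiagonal, so
`sumE` is additive. -/
theorem sumE_mul {u v : Sp m} (hu : u ∈ Uplus m) (hv : v ∈ Uplus m) :
    sumE (u * v) = sumE u + sumE v := by
  rw [mem_Uplus_iff] at hu hv
  unfold sumE
  rw [← Finset.sum_add_distrib]
  refine Finset.sum_congr rfl fun i _ => ?_
  have hi := i.2
  rw [entry_eq_ent, mat_mul, ent_mul, Finset.sum_eq_add (i.val + 1) i.val (by omega)]
  · rw [hu.2 _ (by omega), hv.2 _ (by omega), mul_one, one_mul]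
    rfl
  · intro k _ hk
    by_cases h : k < i.val
    · rw [hu.1 _ _ h, zero_mul]
    · rw [hv.1 _ _ (by omega), mul_zero]
  · intro h
    rw [Finset.mem_range] at h
    omega
  · intro h
    rw [Finset.mem_range] at h
    omega

theorem sumE_tr (u : Sp m) : sumE (tr u) = sumF u := by
  unfold sumE sumF
  refine Finset.sum_congr rfl fun i _ => ?_
  rw [entry_eq_ent, mat_tr, ent_transpose, entry_eq_ent]

theorem sumF_mul {u v : Sp m} (hu : u ∈ Uminus m) (hv : v ∈ Uminus m) :
    sumF (u * v) = sumF u + sumF v := by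
  rw [← sumE_tr, tr_mul, sumE_mul (tr_mem_Uplus hv) (tr_mem_Uplus hu), sumE_tr, sumE_tr, add_comm]

theorem sumF_one : sumF (1 : Sp m) = 0 := by
  unfold sumF
  refine Finset.sum_eq_zero fun i _ => ?_
  have hi := i.2
  rw [entry_eq_ent, mat_one, ent_one (by omega), if_neg (by omega)]

theorem sumF_inv {u : Sp m} (hu : u ∈ Uminus m) : sumF u⁻¹ = -sumF u := by
  rw [eq_neg_iff_add_eq_zero, ← sumF_mul (Uminus_inv hu) hu, inv_mul_cancel, sumF_one]

/-- If `U` is upper unipotent and `U g` is lower triangular for some symplectic `g`, then `U` is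
symplectic. -/
theorem mul_adj_eq_one_of_lower {U : Matrix (Fin (2 * m)) (Fin (2 * m)) ℂ} {g : Sp m}
    (hU : ∀ a b, b < a → ent U a b = 0) (hU1 : ∀ a, a < 2 * m → ent U a a = 1)
    (hl : ∀ a b, a < b → ent (U * mat g) a b = 0) : U * adj U = 1 := by
  set l := U * mat g with hldef
  -- The symplectic factor cancels in `l * adj l`. The left side is lower triangular and the right
  -- side upper unipotent, so both are the identity.
  have h0 : l * adj l = U * adj U := by
    rw [hldef, adj_mul, ← mat_inv, Matrix.mul_assoc, ← Matrix.mul_assoc (mat g), mat_mul_mat_inv,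
      one_mul]
  have hadjU : ∀ a b, b < a → ent (adj U) a b = 0 := by
    intro a b hab
    by_cases ha : a < 2 * m
    · rw [ent_adj _ ha (by omega), hU _ _ (by omega), mul_zero]
    · exact ent_eq_zero_left _ (by omega)
  have hadjl : ∀ a b, a < b → ent (adj l) a b = 0 := by
    intro a b hab
    by_cases hb : b < 2 * m
    · rw [ent_adj _ (by omega) hb, hl _ _ (by omega), mul_zero]
    · exact ent_eq_zero_right _ (by omega)
  refine ent_ext fun a b ha hb => ?_
  rw [ent_one ha]
  rcases lt_trichotomy a b with h1 | h1 | h1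
  · rw [← h0, ent_mul, if_neg (by omega)]
    refine Finset.sum_eq_zero fun k _ => ?_
    by_cases hk : a < k
    · rw [hl _ _ hk, zero_mul]
    · rw [hadjl _ _ (by omega), mul_zero]
  · subst h1
    rw [if_pos rfl, ent_mul, Finset.sum_eq_single a]
    · rw [hU1 a ha, ent_adj _ ha ha, hU1 _ (by omega), pow_add, neg_one_pow_mul_self]
      ring
    · intro k _ hk
      rcases lt_or_gt_of_ne hk with h1 | h1
      · rw [hU _ _ h1, zero_mul]
      · rw [hadjU _ _ h1, mul_zero]
    · intro h
      exact absurd (Finset.mem_range.mpr ha) h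
  · rw [ent_mul, if_neg (by omega)]
    refine Finset.sum_eq_zero fun k _ => ?_
    by_cases hk : k < a
    · rw [hU _ _ hk, zero_mul]
    · rw [hadjU _ _ (by omega), mul_zero]

/-! ### The quadratic forms `r_l` -/

/-- The partial sums of `Σ (-1)^j P_j P_{2m-1-j}`. -/
def quad (m : ℕ) (P : ℕ → ℂ) (k : ℕ) : ℂ :=
  ∑ j ∈ Finset.range k, (-1) ^ j * (P j * P (2 * m - 1 - j))

theorem quad_succ (P : ℕ → ℂ) (k : ℕ) :
    quad m P (k + 1) = quad m P k + (-1) ^ k * (P k * P (2 * m - 1 - k)) :=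
  Finset.sum_range_succ _ _

theorem quad_one (P : ℕ → ℂ) : quad m P 1 = P 0 * P (2 * m - 1) := by
  simp [quad]

/-- The terms with indices `j` and `2m-1-j` have equal products and opposite signs, so the terms
with `k ≤ j < 2m-k` cancel in pairs. -/
theorem quad_symm (P : ℕ → ℂ) {k : ℕ} (hk : k ≤ 2 * m) :
    quad m P (2 * m - k) = quad m P k := by
  have key : ∀ l k, k + l = m → quad m P (2 * m - k) = quad m P k := by
    intro l
    induction l with
    | zero => intro k hk; rw [show 2 * m - k = k by omega]
    | succ l ih =>
      intro k hk
      have h1 := ih (k + 1) (by omega)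
      have h2 := quad_succ (m := m) P k
      have h3 := quad_succ (m := m) P (2 * m - (k + 1))
      rw [show 2 * m - (k + 1) + 1 = 2 * m - k by omega,
        show 2 * m - 1 - (2 * m - (k + 1)) = k by omega,
        neg_one_pow_congr_neg (b := k) (by omega), h1, h2,
        show 2 * m - (k + 1) = 2 * m - 1 - k by omega] at h3
      rw [h3]
      ring
  rcases le_total k m with h | h
  · exact key (m - k) k (by omega)
  · have := key (m - (2 * m - k)) (2 * m - k) (by omega)
    rw [show 2 * m - (2 * m - k) = k by omega] at this
    exact this.symm

theorem quad_eq_Ico (P : ℕ → ℂ) (h0 : P 0 = 1) {k : ℕ} (hk : 1 ≤ k) :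
    quad m P k = P (2 * m - 1) +
      ∑ j ∈ Finset.Ico 1 k, (-1) ^ j * (P j * P (2 * m - 1 - j)) := by
  unfold quad
  rw [Finset.range_eq_Ico, Finset.sum_eq_sum_Ico_succ_bot (by omega)]
  simp [h0]

/-- Shape of the sums met below: a row of a triangular matrix against a first column, where only a
diagonal position `t` and the two extreme positions stand apart from a regular middle range. -/
theorem sum_range_split {n t : ℕ} (ht : 1 ≤ t) (htn : t + 1 < n) (f : ℕ → ℂ)
    (h : ∀ k, t < k → k + 1 < n → f k = 0) :
    ∑ k ∈ Finset.range n, f k = f 0 + ∑ k ∈ Finset.Ico 1 t, f k + f t + f (n - 1) := by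
  obtain ⟨n, rfl⟩ : ∃ n', n = n' + 1 := ⟨n - 1, by omega⟩
  rw [Finset.sum_range_succ, Nat.add_sub_cancel, Finset.range_eq_Ico,
    ← Finset.sum_Ico_consecutive f (Nat.zero_le (t + 1)) (by omega),
    Finset.sum_Ico_succ_top (by omega), Finset.sum_eq_sum_Ico_succ_bot (by omega),
    Finset.sum_eq_zero (s := Finset.Ico (t + 1) n)]
  · ring
  · intro k hk
    rw [Finset.mem_Ico] at hk
    exact h k (by omega) (by omega)

/-! ### The Heisenberg group -/

/-- The lower unipotent matrix with bottom row `(P_{2m-1}, …, P_1, 1)` that is the identity outside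
of the first column and the last row. -/
def heisMat (m : ℕ) (P : ℕ → ℂ) : Matrix (Fin (2 * m)) (Fin (2 * m)) ℂ :=
  Matrix.of fun a b : Fin (2 * m) => if a.val = b.val then 1
    else if b.val = 0 then (-1) ^ (a.val + 1) * P a.val
    else if a.val + 1 = 2 * m then P (2 * m - 1 - b.val) else 0

theorem ent_heisMat (P : ℕ → ℂ) {a b : ℕ} (ha : a < 2 * m) (hb : b < 2 * m) :
    ent (heisMat m P) a b = if a = b then 1 else if b = 0 then (-1) ^ (a + 1) * P a
      else if a + 1 = 2 * m then P (2 * m - 1 - b) else 0 := by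
  simp [ent, ha, hb, heisMat]

theorem ent_heisMat_diag (P : ℕ → ℂ) {a : ℕ} (ha : a < 2 * m) :
    ent (heisMat m P) a a = 1 := by
  rw [ent_heisMat _ ha ha, if_pos rfl]

theorem ent_heisMat_col (P : ℕ → ℂ) {a : ℕ} (ha : a < 2 * m) (ha1 : 1 ≤ a) :
    ent (heisMat m P) a 0 = (-1) ^ (a + 1) * P a := by
  rw [ent_heisMat _ ha (by omega), if_neg (by omega), if_pos rfl]

theorem ent_heisMat_row (P : ℕ → ℂ) {a b : ℕ} (ha : a + 1 = 2 * m) (hb : b < a) :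
    ent (heisMat m P) a b = P (2 * m - 1 - b) := by
  rw [ent_heisMat _ (by omega) (by omega), if_neg (by omega)]
  split_ifs with h
  · rw [neg_one_pow_congr (b := 0) (by omega), pow_zero, one_mul, show a = 2 * m - 1 - b by omega]
  · rfl

theorem ent_heisMat_zero (P : ℕ → ℂ) {a b : ℕ} (hb : 1 ≤ b) (hab : a ≠ b)
    (ha : a + 1 ≠ 2 * m) : ent (heisMat m P) a b = 0 := by
  by_cases h : a < 2 * m ∧ b < 2 * m
  · rw [ent_heisMat _ h.1 h.2, if_neg hab, if_neg (by omega), if_neg ha]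
  · exact dif_neg h

theorem ent_heisMat_upper (P : ℕ → ℂ) {a b : ℕ} (hab : a < b) : ent (heisMat m P) a b = 0 := by
  by_cases hb : b < 2 * m
  · exact ent_heisMat_zero P (by omega) (by omega) (by omega)
  · exact ent_eq_zero_right _ (by omega)

theorem ent_mul_heisMat (P : ℕ → ℂ) (M : Matrix (Fin (2 * m)) (Fin (2 * m)) ℂ) {a b : ℕ}
    (hb : 1 ≤ b) (hb' : b + 1 < 2 * m) : ent (M * heisMat m P) a b =
      ent M a b + ent M a (2 * m - 1) * P (2 * m - 1 - b) := by
  rw [ent_mul, Finset.sum_eq_add b (2 * m - 1) (by omega)]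
  · rw [ent_heisMat_diag _ (by omega), ent_heisMat_row _ (by omega) (by omega), mul_one]
  · intro k hk hkb
    rw [Finset.mem_range] at hk
    rw [ent_heisMat_zero _ hb (by omega) (by omega), mul_zero]
  · intro h
    rw [Finset.mem_range] at h
    omega
  · intro h
    rw [Finset.mem_range] at h
    omega

theorem ent_mul_heisMat_last (P : ℕ → ℂ) (M : Matrix (Fin (2 * m)) (Fin (2 * m)) ℂ) {a b : ℕ}
    (hb' : b + 1 = 2 * m) : ent (M * heisMat m P) a b = ent M a b := by
  rw [ent_mul, Finset.sum_eq_single b]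
  · rw [ent_heisMat_diag _ (by omega), mul_one]
  · intro k hk hkb
    rw [Finset.mem_range] at hk
    rw [ent_heisMat_zero _ (by omega) (by omega) (by omega), mul_zero]
  · intro h
    rw [Finset.mem_range] at h
    omega

theorem ent_mul_heisMat_zero (P : ℕ → ℂ) (M : Matrix (Fin (2 * m)) (Fin (2 * m)) ℂ) {a t : ℕ}
    (ht : 1 ≤ t) (htm : t + 1 < 2 * m) (h : ∀ k, t < k → k + 1 < 2 * m → ent M a k = 0) :
    ent (M * heisMat m P) a 0 = ent M a 0
      + ∑ k ∈ Finset.Ico 1 t, ent M a k * ((-1) ^ (k + 1) * P k)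
      + ent M a t * ((-1) ^ (t + 1) * P t) + ent M a (2 * m - 1) * P (2 * m - 1) := by
  rw [ent_mul, sum_range_split ht htm]
  · rw [ent_heisMat_diag _ (by omega), ent_heisMat_col _ (by omega) ht,
      ent_heisMat_row _ (by omega) (by omega), mul_one, Nat.sub_zero]
    congr 3
    refine Finset.sum_congr rfl fun k hk => ?_
    rw [Finset.mem_Ico] at hk
    rw [ent_heisMat_col _ (by omega) hk.1]
  · intro k hk hk'
    rw [h k hk hk', zero_mul]

/-- The value `P 0` never enters `heisMat`, since the diagonal is set to 1; hence only indices `k ≥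
1` are compared, and `Q 0` remains free. -/
theorem adj_heisMat (P Q : ℕ → ℂ) (hQ : ∀ k, 1 ≤ k → Q k = -P k) :
    adj (heisMat m P) = heisMat m Q := by
  refine ent_ext fun a b ha hb => ?_
  rw [ent_adj _ ha hb]
  by_cases h1 : a = b
  · subst h1
    rw [ent_heisMat_diag _ ha, ent_heisMat_diag _ (by omega), pow_add, neg_one_pow_mul_self,
      mul_one]
  by_cases h2 : b = 0
  · subst h2
    rw [ent_heisMat_col _ ha (by omega), ent_heisMat_row _ (by omega) (by omega),
      show 2 * m - 1 - (2 * m - 1 - a) = a by omega, hQ a (by omega), add_zero, pow_succ]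
    ring
  by_cases h3 : a + 1 = 2 * m
  · rw [ent_heisMat_row _ h3 (by omega), show 2 * m - 1 - a = 0 by omega,
      ent_heisMat_col _ (by omega) (by omega), hQ _ (by omega), ← mul_assoc, ← pow_add,
      neg_one_pow_congr (b := 1) (by omega)]
    ring
  · rw [ent_heisMat_zero _ (by omega) h1 h3, ent_heisMat_zero _ (by omega) (by omega) (by omega),
      mul_zero]

/-- All entries except the lower left corner are linear in `P` and cancel at once; the corner
contains the quadratic sum, which vanishes because its terms cancel in pairs. -/
theorem heisMat_mul_adj (hm : 2 ≤ m) (P : ℕ → ℂ) (h0 : P 0 = 1) :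
    heisMat m P * adj (heisMat m P) = 1 := by
  obtain ⟨Q, hQ⟩ : ∃ Q : ℕ → ℂ, ∀ k, 1 ≤ k → Q k = -P k := ⟨fun k => -P k, fun _ _ => rfl⟩
  rw [adj_heisMat P Q hQ]
  refine ent_ext fun a b ha hb => ?_
  rw [ent_one ha]
  by_cases hb0 : b = 0
  · subst hb0
    rw [ent_mul_heisMat_zero (t := 2 * m - 2) _ _ (by omega) (by omega)
      (fun k _ _ => by omega), add_assoc (ent _ _ _), ← Finset.sum_Ico_succ_top (by omega)
        (fun k => ent (heisMat m P) a k * ((-1) ^ (k + 1) * Q k)),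
      show 2 * m - 2 + 1 = 2 * m - 1 by omega]
    by_cases ha1 : a + 1 = 2 * m
    · obtain rfl : a = 2 * m - 1 := by omega
      have hsum : ∑ k ∈ Finset.Ico 1 (2 * m - 1), ent (heisMat m P) (2 * m - 1) k *
          ((-1) ^ (k + 1) * Q k) =
          ∑ k ∈ Finset.Ico 1 (2 * m - 1), (-1) ^ k * (P k * P (2 * m - 1 - k)) := by
        refine Finset.sum_congr rfl fun k hk => ?_
        rw [Finset.mem_Ico] at hk
        rw [ent_heisMat_row _ (by omega) (by omega), hQ k hk.1, pow_succ]
        ring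
      -- `S_{2m-1} = S_1 = P_{2m-1}` says exactly that the sum over the middle indices is zero.
      have hq := quad_symm (m := m) P (k := 1) (by omega)
      rw [quad_one, h0, one_mul, quad_eq_Ico P h0 (by omega)] at hq
      rw [hsum, ent_heisMat_row _ (by omega) (by omega), ent_heisMat_diag _ (by omega),
        hQ _ (by omega), if_neg (by omega), Nat.sub_zero]
      linear_combination hq
    · have hsum : ∑ k ∈ Finset.Ico 1 (2 * m - 1), ent (heisMat m P) a k *
          ((-1) ^ (k + 1) * Q k) = if a = 0 then 0 else (-1) ^ a * P a := by
        by_cases ha0 : a = 0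
        · rw [if_pos ha0]
          refine Finset.sum_eq_zero fun k hk => ?_
          rw [Finset.mem_Ico] at hk
          rw [ent_heisMat_zero _ hk.1 (by omega) (by omega), zero_mul]
        · rw [if_neg ha0, Finset.sum_eq_single a]
          · rw [ent_heisMat_diag _ ha, hQ a (by omega), pow_succ]
            ring
          · intro k hk hka
            rw [Finset.mem_Ico] at hk
            rw [ent_heisMat_zero _ hk.1 (by omega) ha1, zero_mul]
          · intro h
            rw [Finset.mem_Ico] at h
            omega
      rw [hsum, ent_heisMat_upper _ (by omega : a < 2 * m - 1)]
      by_cases ha0 : a = 0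
      · subst ha0
        rw [ent_heisMat_diag _ ha]
        simp
      · rw [if_neg ha0, if_neg ha0, ent_heisMat_col _ ha (by omega), pow_succ]
        ring
  · by_cases hb1 : b + 1 = 2 * m
    · rw [ent_mul_heisMat_last _ _ hb1]
      by_cases h1 : a = b
      · rw [if_pos h1, h1, ent_heisMat_diag _ hb]
      · rw [if_neg h1, ent_heisMat_zero _ (by omega) h1 (by omega)]
    · rw [ent_mul_heisMat _ _ (by omega) (by omega), hQ _ (by omega)]
      by_cases h1 : a = b
      · rw [if_pos h1, h1, ent_heisMat_diag _ hb, ent_heisMat_upper _ (by omega)]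
        ring
      · rw [if_neg h1]
        by_cases h2 : a + 1 = 2 * m
        · rw [show 2 * m - 1 = a by omega, ent_heisMat_diag _ ha,
            ent_heisMat_row _ h2 (by omega), show 2 * m - 1 = a by omega]
          ring
        · rw [ent_heisMat_zero _ (by omega) h1 h2, ent_heisMat_upper _ (by omega)]
          ring

/-- The Heisenberg element with bottom row `(P_{2m-1}, …, P_1, 1)`. -/
def heis (hm : 2 ≤ m) (P : ℕ → ℂ) (h0 : P 0 = 1) : Sp m :=
  ofAdj (heisMat m P) (heisMat_mul_adj hm P h0)

theorem mat_heis (hm : 2 ≤ m) (P : ℕ → ℂ) (h0 : P 0 = 1) :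
    mat (heis hm P h0) = heisMat m P := rfl

theorem heis_mem (hm : 2 ≤ m) (P : ℕ → ℂ) (h0 : P 0 = 1) : heis hm P h0 ∈ Uminus m := by
  rw [mem_Uminus_iff, mat_heis]
  exact ⟨fun a b hab => ent_heisMat_upper P hab, fun a ha => ent_heisMat_diag P ha⟩

theorem sumF_heis (hm : 2 ≤ m) (P : ℕ → ℂ) (h0 : P 0 = 1) : sumF (heis hm P h0) = P 1 := by
  unfold sumF
  rw [Finset.sum_eq_single ⟨0, by omega⟩]
  · rw [entry_eq_ent, mat_heis]
    dsimp only
    rw [ent_heisMat_col _ (by omega) (by omega)]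
    simp
  · intro i _ hi
    have h1 := i.2
    have h2 : i.val ≠ 0 := fun h => hi (Fin.ext h)
    rw [entry_eq_ent, mat_heis, ent_heisMat_zero _ (by omega) (by omega) (by omega)]
  · simp

/-- Lower unipotent elements whose first column and last row are trivial. -/
def IsLevi (v : Sp m) : Prop :=
  v ∈ Uminus m ∧ ∀ b, b + 1 < 2 * m → ent (mat v) (2 * m - 1) b = 0

/-- By the adjoint formula the last row of `v` is, up to signs, the first column of `v⁻¹`; that
column is thus the first basis vector, and so is the first column of `v`. -/
theorem IsLevi.col {v : Sp m} (h : IsLevi v) {a : ℕ} (ha : 1 ≤ a) : ent (mat v) a 0 = 0 := by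
  by_cases ham : a < 2 * m
  · have hinv : ∀ k, 1 ≤ k → k < 2 * m → ent (mat v⁻¹) k 0 = 0 := by
      intro k hk hkm
      rw [ent_inv _ hkm (by omega), Nat.sub_zero, h.2 _ (by omega), mul_zero]
    have h1 : ent (mat v * mat v⁻¹) a 0 = 0 := by
      rw [mat_mul_mat_inv, ent_one ham, if_neg (by omega)]
    rw [ent_mul, Finset.sum_eq_single 0] at h1
    · rw [ent_inv _ (by omega) (by omega), Nat.sub_zero,
        (mem_Uminus_iff.mp h.1).2 _ (by omega)] at h1
      simpa using h1
    · intro k hk hk0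
      rw [hinv k (by omega) (Finset.mem_range.mp hk), mul_zero]
    · intro h2
      rw [Finset.mem_range] at h2
      omega
  · exact ent_eq_zero_left _ (by omega)

theorem IsLevi.inv {v : Sp m} (h : IsLevi v) : IsLevi v⁻¹ := by
  refine ⟨Uminus_inv h.1, fun b hb => ?_⟩
  rw [ent_inv _ (by omega) (by omega), show 2 * m - 1 - (2 * m - 1) = 0 by omega,
    h.col (by omega), mul_zero]

/-- The bottom row of a matrix, read from right to left. -/
def bottom (g : Sp m) (k : ℕ) : ℂ := ent (mat g) (2 * m - 1) (2 * m - 1 - k)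

theorem bottom_zero (hm : 2 ≤ m) {u : Sp m} (hu : u ∈ Uminus m) : bottom u 0 = 1 := by
  unfold bottom
  rw [Nat.sub_zero, (mem_Uminus_iff.mp hu).2 _ (by omega)]

theorem bottom_heis (hm : 2 ≤ m) (P : ℕ → ℂ) (h0 : P 0 = 1) {k : ℕ} (hk : k < 2 * m) :
    bottom (heis hm P h0) k = P k := by
  unfold bottom
  rw [mat_heis]
  by_cases hk0 : k = 0
  · subst hk0
    rw [Nat.sub_zero, ent_heisMat_diag _ (by omega), h0]
  · rw [ent_heisMat_row _ (by omega) (by omega), show 2 * m - 1 - (2 * m - 1 - k) = k by omega]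

/-- This is the decomposition of `U_-` into its Levi part and the unipotent radical of the
parabolic. The radical factor must have the bottom row of `u`, and this determines it. -/
theorem exists_levi_mul_heis (hm : 2 ≤ m) {u : Sp m} (hu : u ∈ Uminus m) :
    ∃ v, IsLevi v ∧ u = v * heis hm (bottom u) (bottom_zero hm hu) := by
  set y := heis hm (bottom u) (bottom_zero hm hu) with hy
  have hyU : y ∈ Uminus m := heis_mem hm _ _
  refine ⟨u * y⁻¹, ⟨Uminus_mul hu (Uminus_inv hyU), fun b hb => ?_⟩, by group⟩
  have hrow : ∀ k, k < 2 * m → ent (mat u) (2 * m - 1) k = ent (mat y) (2 * m - 1) k := by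
    intro k hk
    have := bottom_heis hm (bottom u) (bottom_zero hm hu) (k := 2 * m - 1 - k) (by omega)
    rw [← hy] at this
    unfold bottom at this
    rw [show 2 * m - 1 - (2 * m - 1 - k) = k by omega] at this
    exact this.symm
  -- Since `u` and `y` share the bottom row, the bottom row of `u y⁻¹` is that of `y y⁻¹ = 1`.
  have h1 : ent (mat y * mat y⁻¹) (2 * m - 1) b = 0 := by
    rw [mat_mul_mat_inv, ent_one (by omega), if_neg (by omega)]
  rw [← h1, mat_mul, ent_mul, ent_mul]
  refine Finset.sum_congr rfl fun k hk => ?_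
  rw [hrow k (Finset.mem_range.mp hk)]

/-! ### The torus element and its product with `ẇ_P` -/

/-- The diagonal entries `(q, 1, …, 1, q⁻¹)`. -/
def diagEntry (m : ℕ) (q : ℂ) (i : ℕ) : ℂ := if i = 0 then q else if i + 1 = 2 * m then q⁻¹ else 1

theorem diagonal_mul_adj {q : ℂ} (hq : q ≠ 0) :
    Matrix.diagonal (fun i : Fin (2 * m) => diagEntry m q i) *
      adj (Matrix.diagonal fun i : Fin (2 * m) => diagEntry m q i) = 1 := by
  ext a b
  rw [Matrix.diagonal_mul, adj_apply, Matrix.one_apply, Matrix.diagonal_apply]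
  by_cases h : a = b
  · subst h
    rw [if_pos rfl, if_pos rfl, pow_add, neg_one_pow_mul_self, one_mul]
    have ha := a.2
    unfold diagEntry
    rw [Fin.val_rev]
    by_cases h1 : a.val = 0
    · rw [if_pos h1, if_neg (by omega), if_pos (by omega), mul_inv_cancel₀ hq]
    · rw [if_neg h1]
      by_cases h2 : a.val + 1 = 2 * m
      · rw [if_pos h2, if_pos (by omega), inv_mul_cancel₀ hq]
      · rw [if_neg h2, if_neg (by omega), if_neg (by omega), mul_one]
  · rw [if_neg h, if_neg (fun h' => h (Fin.rev_injective h').symm), mul_zero, mul_zero]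

/-- The matrix `diag(q, 1, …, 1, q⁻¹)` in `Sp`. -/
def diagLift (m : ℕ) {q : ℂ} (hq : q ≠ 0) : Sp m := ofAdj _ (diagonal_mul_adj hq)

theorem acts_diagLift {q : ℂ} (hq : q ≠ 0) (k : ℕ) :
    Acts (diagLift m hq) k (diagEntry m q k) k := by
  unfold Acts
  change Matrix.diagonal (fun i : Fin (2 * m) => diagEntry m q i) *ᵥ _ = _
  ext i
  rw [Matrix.mulVec_diagonal, Pi.smul_apply, smul_eq_mul]
  unfold E
  by_cases h : i.val = k
  · rw [if_pos h, h]
  · rw [if_neg h, mul_zero, mul_zero]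

/-- The lift of `d ẇ_P`. -/
def cLift (m : ℕ) {q : ℂ} (hq : q ≠ 0) : Sp m := diagLift m hq * longLift m 2

section cLift

variable (hm : 1 ≤ m) {q : ℂ} (hq : q ≠ 0)

include hm

theorem acts_cLift_first : Acts (cLift m hq) 0 q 0 := by
  refine ((acts_diagLift hq 0).mul (acts_longLift_fix (a := 2) (by omega) (by omega) 0
    (by omega))).congr ?_ rfl
  simp [diagEntry]

theorem acts_cLift_last : Acts (cLift m hq) (2 * m - 1) q⁻¹ (2 * m - 1) := by
  refine ((acts_diagLift hq _).mul (acts_longLift_fix (a := 2) (by omega) (by omega) _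
    (by omega))).congr ?_ rfl
  rw [diagEntry, if_neg (by omega), if_pos (by omega), one_mul]

theorem acts_cLift_mid {k : ℕ} (hk : 1 ≤ k) (hk' : k + 1 < 2 * m) :
    Acts (cLift m hq) k ((-1) ^ k) (2 * m - 1 - k) := by
  refine ((acts_diagLift hq _).mul (acts_longLift (a := 2) hm (by omega) (by omega) k
    (by omega) (by omega))).congr ?_ rfl
  rw [diagEntry, if_neg (by omega), if_neg (by omega), mul_one]
  exact neg_one_pow_congr (by omega)

theorem ent_mul_cLift_first (M : Matrix (Fin (2 * m)) (Fin (2 * m)) ℂ) (a : ℕ) :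
    ent (M * mat (cLift m hq)) a 0 = q * ent M a 0 :=
  (acts_cLift_first hm hq).ent_mul (by omega) (by omega) M a

theorem ent_mul_cLift_last (M : Matrix (Fin (2 * m)) (Fin (2 * m)) ℂ) (a : ℕ) :
    ent (M * mat (cLift m hq)) a (2 * m - 1) = q⁻¹ * ent M a (2 * m - 1) :=
  (acts_cLift_last hm hq).ent_mul (by omega) (by omega) M a

theorem ent_mul_cLift_mid (M : Matrix (Fin (2 * m)) (Fin (2 * m)) ℂ) (a : ℕ) {b : ℕ}
    (hb : 1 ≤ b) (hb' : b + 1 < 2 * m) :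
    ent (M * mat (cLift m hq)) a b = (-1) ^ b * ent M a (2 * m - 1 - b) :=
  (acts_cLift_mid hm hq hb hb').ent_mul (by omega) (by omega) M a

theorem ent_cLift {a b : ℕ} (ha : a < 2 * m) (hb : b < 2 * m) : ent (mat (cLift m hq)) a b =
    if b = 0 then (if a = 0 then q else 0)
    else if b = 2 * m - 1 then (if a = 2 * m - 1 then q⁻¹ else 0)
    else if a = 2 * m - 1 - b then (-1) ^ b else 0 := by
  by_cases h0 : b = 0
  · subst h0
    rw [if_pos rfl]
    exact (acts_cLift_first hm hq).ent ha hb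
  · rw [if_neg h0]
    by_cases h1 : b = 2 * m - 1
    · rw [if_pos h1, h1]
      exact (acts_cLift_last hm hq).ent ha (by omega)
    · rw [if_neg h1]
      exact (acts_cLift_mid hm hq (by omega) (by omega)).ent ha hb

theorem ent_cLift_mul_first (M : Matrix (Fin (2 * m)) (Fin (2 * m)) ℂ) (b : ℕ) :
    ent (mat (cLift m hq) * M) 0 b = q * ent M 0 b := by
  rw [ent_mul, Finset.sum_eq_single 0]
  · rw [ent_cLift (by omega) _ (by omega) (by omega), if_pos rfl, if_pos rfl]
  · intro k hk hk0
    rw [Finset.mem_range] at hk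
    rw [ent_cLift (by omega) _ (by omega) hk, if_neg hk0]
    split_ifs <;> first | omega | simp
  · simp
    omega

theorem ent_cLift_mul_last (M : Matrix (Fin (2 * m)) (Fin (2 * m)) ℂ) (b : ℕ) :
    ent (mat (cLift m hq) * M) (2 * m - 1) b = q⁻¹ * ent M (2 * m - 1) b := by
  rw [ent_mul, Finset.sum_eq_single (2 * m - 1)]
  · rw [ent_cLift (by omega) _ (by omega) (by omega), if_neg (by omega), if_pos rfl, if_pos rfl]
  · intro k hk hk0
    rw [Finset.mem_range] at hk
    rw [ent_cLift (by omega) _ (by omega) hk, if_neg hk0]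
    split_ifs <;> first | omega | simp
  · simp
    omega

theorem ent_cLift_mul_mid (M : Matrix (Fin (2 * m)) (Fin (2 * m)) ℂ) {a : ℕ} (b : ℕ)
    (ha : 1 ≤ a) (ha' : a + 1 < 2 * m) :
    ent (mat (cLift m hq) * M) a b = (-1) ^ (a + 1) * ent M (2 * m - 1 - a) b := by
  rw [ent_mul, Finset.sum_eq_single (2 * m - 1 - a)]
  · rw [ent_cLift (by omega) _ (by omega) (by omega), if_neg (by omega), if_neg (by omega),
      if_pos (by omega), neg_one_pow_congr (b := a + 1) (by omega)]
  · intro k hk hk0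
    rw [Finset.mem_range] at hk
    rw [ent_cLift (by omega) _ (by omega) hk]
    split_ifs <;> first | omega | simp
  · simp
    omega

/-- The torus part of `c` is trivial on the Levi block, and the signs of `ẇ_P` there match those of
the symplectic adjoint, so conjugation by `c` sends `v` to the transposed inverse. The explicit form
matters: it gives `sumE (tr v⁻¹) = -sumF v`. -/
theorem cLift_mul_levi {v : Sp m} (hv : IsLevi v) :
    cLift m hq * v = tr v⁻¹ * cLift m hq := by
  have hl := mem_Uminus_iff.mp hv.1
  have hl' := mem_Uminus_iff.mp hv.inv.1
  apply mat_injective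
  rw [mat_mul, mat_mul]
  refine ent_ext fun a b ha hb => ?_
  by_cases hb0 : b = 0
  · subst hb0
    rw [ent_mul_cLift_first (by omega), mat_tr, ent_transpose]
    by_cases ha0 : a = 0
    · subst ha0
      rw [ent_cLift_mul_first (by omega), hl.2 _ ha, hl'.2 _ ha]
    · rw [hl'.1 _ _ (by omega)]
      by_cases ha1 : a = 2 * m - 1
      · subst ha1
        rw [ent_cLift_mul_last (by omega), hv.col (by omega)]
        simp
      · rw [ent_cLift_mul_mid (by omega) _ _ _ (by omega) (by omega), hv.col (by omega)]
        simp
  by_cases hb1 : b = 2 * m - 1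
  · subst hb1
    rw [ent_mul_cLift_last (by omega), mat_tr, ent_transpose]
    by_cases ha1 : a = 2 * m - 1
    · subst ha1
      rw [ent_cLift_mul_last (by omega), hl.2 _ ha, hl'.2 _ ha]
    · rw [hv.inv.2 _ (by omega)]
      by_cases ha0 : a = 0
      · subst ha0
        rw [ent_cLift_mul_first (by omega), hl.1 _ _ (by omega)]
        simp
      · rw [ent_cLift_mul_mid (by omega) _ _ _ (by omega) (by omega), hl.1 _ _ (by omega)]
        simp
  rw [ent_mul_cLift_mid (by omega) _ _ _ (by omega) (by omega), mat_tr, ent_transpose,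
    ent_inv _ (by omega) (by omega), show 2 * m - 1 - (2 * m - 1 - b) = b by omega, ← mul_assoc,
    ← pow_add, neg_one_pow_congr (b := a + 1) (by omega)]
  by_cases ha0 : a = 0
  · subst ha0
    rw [ent_cLift_mul_first (by omega), hl.1 _ _ (by omega), Nat.sub_zero, hv.2 _ (by omega)]
    simp
  by_cases ha1 : a = 2 * m - 1
  · subst ha1
    rw [ent_cLift_mul_last (by omega), hv.2 _ (by omega), show 2 * m - 1 - (2 * m - 1) = 0 by omega,
      hl.1 _ _ (by omega)]
    simp
  rw [ent_cLift_mul_mid (by omega) _ _ _ (by omega) (by omega)]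

end cLift

/-! ### The set `B_- ẇ₀` -/

/-- The entries above the antidiagonal vanish. -/
def AntiTri (M : Matrix (Fin (2 * m)) (Fin (2 * m)) ℂ) : Prop :=
  ∀ a b, a + b + 1 < 2 * m → ent M a b = 0

theorem ent_mul_long {M : Matrix (Fin (2 * m)) (Fin (2 * m)) ℂ} (hm : 1 ≤ m) {b : ℕ}
    (hb : b < 2 * m) (a : ℕ) :
    ent (M * mat (longLift m 1)) a b = (-1) ^ (b + 1) * ent M a (2 * m - 1 - b) :=
  (acts_longLift hm le_rfl (by omega) b (by omega) (by omega)).ent_mul (by omega) (by omega) M a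

theorem antiTri_mul_long {M : Matrix (Fin (2 * m)) (Fin (2 * m)) ℂ} (hm : 1 ≤ m)
    (h : ∀ a b, a < b → ent M a b = 0) : AntiTri (M * mat (longLift m 1)) := by
  intro a b hab
  rw [ent_mul_long hm (by omega), h _ _ (by omega), mul_zero]

theorem AntiTri.lower {M : Matrix (Fin (2 * m)) (Fin (2 * m)) ℂ} (hm : 1 ≤ m)
    (h : AntiTri M) (a b : ℕ) (hab : a < b) : ent (M * mat (longLift m 1)⁻¹) a b = 0 := by
  by_cases hb : b < 2 * m
  · set N := M * mat (longLift m 1)⁻¹ with hN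
    have hM : M = N * mat (longLift m 1) := by
      rw [hN, Matrix.mul_assoc, mat_inv_mul_mat, mul_one]
    have h1 := h a (2 * m - 1 - b) (by omega)
    rw [hM, ent_mul_long hm (by omega), show 2 * m - 1 - (2 * m - 1 - b) = b by omega] at h1
    exact (mul_eq_zero.mp h1).resolve_left (pow_ne_zero _ (by norm_num))
  · exact ent_eq_zero_right _ (by omega)

theorem AntiTri.smul {M : Matrix (Fin (2 * m)) (Fin (2 * m)) ℂ} (h : AntiTri M) (c : ℂ) :
    AntiTri (c • M) := by
  intro a b hab
  rw [ent_smul, h a b hab, mul_zero]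

/-- Right multiplication by the lift of `ẇ₀` reverses the columns up to sign and so turns lower
triangular into anti-triangular. The latter condition is stable under scalars, hence well defined on
`PSp`. -/
theorem cls_mem_Bminus_mul_w0 (hm : 1 ≤ m) (g : Sp m) :
    (∃ b ∈ Bminus m, cls g = b * w0 m) ↔ AntiTri (mat g) := by
  rw [← cls_longLift_one]
  constructor
  · rintro ⟨_, ⟨b, hb, rfl⟩, h⟩
    have h1 : cls (b * longLift m 1) = cls g := h.symm
    obtain ⟨c, -, h2⟩ := cls_eq_iff.mp h1
    rw [h2, mat_mul]
    exact (antiTri_mul_long hm (mem_lowerSp_iff.mp hb)).smul c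
  · intro h
    refine ⟨cls (g * (longLift m 1)⁻¹), ⟨_, ?_, rfl⟩, ?_⟩
    · change _ ∈ lowerSp m
      rw [mem_lowerSp_iff, mat_mul]
      exact h.lower hm
    · rw [← cls_mul, inv_mul_cancel_right]

/-- In `(g g⁻¹)_{aa} = 1` only the antidiagonal term can survive: before it the entry of `g`
vanishes, after it that of `g⁻¹`, by the adjoint formula. -/
theorem AntiTri.ne_zero {g : Sp m} (h : AntiTri (mat g)) {a b : ℕ} (hab : a + b + 1 = 2 * m) :
    ent (mat g) a b ≠ 0 := by
  intro h0
  have h1 : ent (mat g * mat g⁻¹) a a = 1 := by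
    rw [mat_mul_mat_inv, ent_one (by omega), if_pos rfl]
  rw [ent_mul, Finset.sum_eq_zero] at h1
  · exact zero_ne_one h1
  · intro k hk
    rw [Finset.mem_range] at hk
    rcases lt_trichotomy k b with h2 | h2 | h2
    · rw [h _ _ (by omega), zero_mul]
    · rw [h2, h0, zero_mul]
    · rw [ent_inv _ (by omega) (by omega), h (2 * m - 1 - a) _ (by omega), mul_zero, mul_zero]

/-! ### The equations defining `Z_d` -/

section equations

variable (hm : 2 ≤ m) {q : ℂ} (hq : q ≠ 0) {P : ℕ → ℂ} (h0 : P 0 = 1)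

/-- The element `U d ẇ_P y` with `y` the Heisenberg element with coordinates `P`. -/
def zElt (U : Sp m) : Sp m :=
  U * cLift m hq * heis hm P h0

variable {U : Sp m}

include hm in
theorem ent_mul_cLift_heis_last (M : Matrix (Fin (2 * m)) (Fin (2 * m)) ℂ) (a : ℕ) :
    ent (M * mat (cLift m hq) * heisMat m P) a (2 * m - 1) =
      q⁻¹ * ent M a (2 * m - 1) := by
  rw [ent_mul_heisMat_last _ _ (by omega), ent_mul_cLift_last (by omega)]

include hm in
theorem ent_mul_cLift_heis_mid (M : Matrix (Fin (2 * m)) (Fin (2 * m)) ℂ) (a : ℕ) {b : ℕ}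
    (hb : 1 ≤ b) (hb' : b + 1 < 2 * m) :
    ent (M * mat (cLift m hq) * heisMat m P) a b =
      (-1) ^ b * ent M a (2 * m - 1 - b) + q⁻¹ * ent M a (2 * m - 1) * P (2 * m - 1 - b) := by
  rw [ent_mul_heisMat _ _ hb hb', ent_mul_cLift_last (by omega), ent_mul_cLift_mid (by omega) _ _ _ hb hb']

theorem mat_zElt : mat (zElt hm hq h0 U) =
    mat U * mat (cLift m hq) * heisMat m P := rfl

theorem ent_zElt_last (a : ℕ) :
    ent (mat (zElt hm hq h0 U)) a (2 * m - 1) = q⁻¹ * ent (mat U) a (2 * m - 1) := by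
  rw [mat_zElt, ent_mul_cLift_heis_last hm]

theorem ent_zElt_mid (a : ℕ) {b : ℕ} (hb : 1 ≤ b) (hb' : b + 1 < 2 * m) :
    ent (mat (zElt hm hq h0 U)) a b = (-1) ^ b * ent (mat U) a (2 * m - 1 - b) +
      ent (mat (zElt hm hq h0 U)) a (2 * m - 1) * P (2 * m - 1 - b) := by
  rw [ent_zElt_last, mat_zElt, ent_mul_cLift_heis_mid hm hq _ _ hb hb']

/-- The last row of `U c` is `q⁻¹` times the last basis row, so `z` has the bottom row of its
Heisenberg factor up to this scalar. -/
theorem bottom_zElt (hU : U ∈ Uplus m) {k : ℕ} (hk : k < 2 * m) :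
    bottom (zElt hm hq h0 U) k = q⁻¹ * P k := by
  have hU' := mem_Uplus_iff.mp hU
  have hrow : ∀ b, b < 2 * m → ent (mat U * mat (cLift m hq)) (2 * m - 1) b =
      if b = 2 * m - 1 then q⁻¹ else 0 := by
    intro b hb
    by_cases hb1 : b = 2 * m - 1
    · rw [if_pos hb1, hb1, ent_mul_cLift_last (by omega), hU'.2 _ (by omega), mul_one]
    · rw [if_neg hb1]
      by_cases hb0 : b = 0
      · rw [hb0, ent_mul_cLift_first (by omega), hU'.1 _ _ (by omega), mul_zero]
      · rw [ent_mul_cLift_mid (by omega) _ _ _ (by omega) (by omega), hU'.1 _ _ (by omega), mul_zero]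
  rw [← bottom_heis hm P h0 hk]
  unfold bottom
  rw [mat_zElt, ent_mul, Finset.sum_eq_single (2 * m - 1)]
  · rw [hrow _ (by omega), if_pos rfl, mat_heis]
  · intro b hb hb1
    rw [hrow _ (Finset.mem_range.mp hb), if_neg hb1, zero_mul]
  · simp
    omega

variable (hU : U ∈ Uplus m) (hz : AntiTri (mat (zElt hm hq h0 U)))

include hU hz in
-- Read off from the vanishing entry of row `2m-1-k` in column 0. The entries of `U c` in that row
-- at the columns `1 ≤ j < k` are eliminated with the vanishing entries of `z` in those columns,
-- which leaves the last entry of the row times the partial sums of `quad`.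
theorem last_mul_quad {k : ℕ} (hk : 1 ≤ k) (hk' : k + 1 < 2 * m) :
    ent (mat (zElt hm hq h0 U)) (2 * m - 1 - k) (2 * m - 1) * quad m P k = P k := by
  have hU' := mem_Uplus_iff.mp hU
  set A := ent (mat (zElt hm hq h0 U)) (2 * m - 1 - k) (2 * m - 1) with hA
  have h1 := hz (2 * m - 1 - k) 0 (by omega)
  rw [mat_zElt, ent_mul_heisMat_zero (t := k) _ _ hk hk', ent_mul_cLift_first (by omega),
    hU'.1 _ _ (by omega), ent_mul_cLift_mid (by omega) _ _ _ hk hk', hU'.2 _ (by omega),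
    ent_mul_cLift_last (by omega), ← ent_zElt_last hm hq h0, ← hA] at h1
  · have h2 : ∑ j ∈ Finset.Ico 1 k, ent (mat U * mat (cLift m hq))
        (2 * m - 1 - k) j * ((-1) ^ (j + 1) * P j) =
        A * ∑ j ∈ Finset.Ico 1 k, (-1) ^ j * (P j * P (2 * m - 1 - j)) := by
      rw [Finset.mul_sum]
      refine Finset.sum_congr rfl fun j hj => ?_
      rw [Finset.mem_Ico] at hj
      have h3 := hz (2 * m - 1 - k) j (by omega)
      rw [ent_zElt_mid hm hq h0 _ (by omega) (by omega), ← hA] at h3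
      rw [ent_mul_cLift_mid (by omega) _ _ _ (by omega) (by omega), pow_succ]
      linear_combination (-(-1) ^ j * P j) * h3
    rw [h2, pow_succ] at h1
    rw [quad_eq_Ico P h0 hk]
    have h4 := neg_one_pow_mul_self k
    linear_combination h1 + P k * h4
  · intro j hj hj'
    rw [ent_mul_cLift_mid (by omega) _ _ _ (by omega) (by omega), hU'.1 _ _ (by omega), mul_zero]

include hU hz in
-- The same elimination in row 0, where all middle columns occur. Their sum vanishes by `quad_symm`,
-- and only the entry `q` of `c` remains.
theorem first_mul_last :
    ent (mat (zElt hm hq h0 U)) 0 (2 * m - 1) * P (2 * m - 1) = -q := by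
  have hU' := mem_Uplus_iff.mp hU
  set A := ent (mat (zElt hm hq h0 U)) 0 (2 * m - 1) with hA
  have h1 := hz 0 0 (by omega)
  rw [mat_zElt, ent_mul_heisMat_zero (t := 2 * m - 2) _ _ (by omega) (by omega)
      (fun _ _ _ => by omega), add_assoc (ent _ _ _), ← Finset.sum_Ico_succ_top (by omega)
        (fun k => ent (mat U * mat (cLift m hq)) 0 k * ((-1) ^ (k + 1) * P k)),
      show 2 * m - 2 + 1 = 2 * m - 1 by omega, ent_mul_cLift_first (by omega), hU'.2 _ (by omega),
      ent_mul_cLift_last (by omega), ← ent_zElt_last hm hq h0, ← hA] at h1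
  have h2 : ∑ j ∈ Finset.Ico 1 (2 * m - 1), ent (mat U * mat (cLift m hq))
      0 j * ((-1) ^ (j + 1) * P j) =
      A * ∑ j ∈ Finset.Ico 1 (2 * m - 1), (-1) ^ j * (P j * P (2 * m - 1 - j)) := by
    rw [Finset.mul_sum]
    refine Finset.sum_congr rfl fun j hj => ?_
    rw [Finset.mem_Ico] at hj
    have h3 := hz 0 j (by omega)
    rw [ent_zElt_mid hm hq h0 _ (by omega) (by omega), ← hA] at h3
    rw [ent_mul_cLift_mid (by omega) _ _ _ (by omega) (by omega), pow_succ]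
    linear_combination (-(-1) ^ j * P j) * h3
  have hq1 := quad_symm (m := m) P (k := 1) (by omega)
  rw [quad_one, h0, one_mul, quad_eq_Ico P h0 (by omega)] at hq1
  rw [h2] at h1
  linear_combination h1 - A * hq1

include hU hz in
-- Induction on `k`: successive forms differ by a factor that is, up to sign, an antidiagonal entry
-- of `z`, and these are nonzero. The start `P_{2m-1} ≠ 0` comes from `first_mul_last` and `q ≠ 0`.
theorem quad_ne_zero {k : ℕ} (hk : 1 ≤ k) (hk' : k < 2 * m) : quad m P k ≠ 0 := by
  induction k, hk using Nat.le_induction with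
  | base =>
    rw [quad_one, h0, one_mul]
    intro h
    have := first_mul_last hm hq h0 hU hz
    rw [h, mul_zero] at this
    exact hq (neg_eq_zero.mp this.symm)
  | succ k hk ih =>
    have hU' := mem_Uplus_iff.mp hU
    have h1 := last_mul_quad hm hq h0 hU hz hk (by omega)
    have h2 := ent_zElt_mid (U := U) hm hq h0 (2 * m - 1 - k) hk (by omega)
    rw [hU'.2 _ (by omega)] at h2
    have h3 : quad m P (k + 1) =
        (-1) ^ k * (quad m P k * ent (mat (zElt hm hq h0 U)) (2 * m - 1 - k) k) := by
      rw [h2, quad_succ]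
      linear_combination (-(-1) ^ k * P (2 * m - 1 - k)) * h1 - quad m P k * neg_one_pow_mul_self k
    rw [h3]
    exact mul_ne_zero (pow_ne_zero _ (by norm_num))
      (mul_ne_zero (ih (by omega)) (hz.ne_zero (by omega)))

include hU hz in
-- The entry of `z` just above the antidiagonal in row `i` vanishes and expresses `U_{i,i+1}`
-- through the last column of `z`. That column is known from `first_mul_last` for `i = 0`, giving
-- the `q`-term, and from `last_mul_quad` for `i ≥ 1`, where `quad_symm` replaces `S_{2m-1-i}` by
-- `S_{i+1}`.
theorem sumE_eq : sumE U = q * (P 1 / P (2 * m - 1)) -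
    ∑ l ∈ Finset.Icc 1 (m - 1), P (l + 1) * P (2 * m - 1 - l) / ((-1) ^ l * quad m P (l + 1)) := by
  have key : ∀ i, i < m → ent (mat U) i (i + 1) =
      -((-1) ^ i * (ent (mat (zElt hm hq h0 U)) i (2 * m - 1) * P (i + 1))) := by
    intro i hi
    have h1 := hz i (2 * m - 2 - i) (by omega)
    rw [ent_zElt_mid hm hq h0 _ (by omega) (by omega),
      show 2 * m - 1 - (2 * m - 2 - i) = i + 1 by omega,
      neg_one_pow_congr (b := i) (by omega)] at h1
    linear_combination (-1) ^ i * h1 - ent (mat U) i (i + 1) * neg_one_pow_mul_self i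
  have hsum : sumE U = ∑ i ∈ Finset.range m, ent (mat U) i (i + 1) := by
    unfold sumE
    simp only [entry_eq_ent]
    exact Fin.sum_univ_eq_sum_range (fun i => ent (mat U) i (i + 1)) m
  rw [hsum, Finset.range_eq_Ico, Finset.sum_eq_sum_Ico_succ_bot (by omega), key 0 (by omega),
    sub_eq_add_neg, ← Finset.sum_neg_distrib, show Finset.Icc 1 (m - 1) = Finset.Ico 1 m by
      ext; simp only [Finset.mem_Icc, Finset.mem_Ico]; omega]
  congr 1
  · have h1 := first_mul_last hm hq h0 hU hz
    have h2 : P (2 * m - 1) ≠ 0 := by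
      intro h
      rw [h, mul_zero] at h1
      exact hq (neg_eq_zero.mp h1.symm)
    field_simp
    linear_combination -P 1 * h1
  · refine Finset.sum_congr rfl fun i hi => ?_
    rw [Finset.mem_Ico] at hi
    rw [key i (by omega)]
    have h1 := last_mul_quad hm hq h0 hU hz (k := 2 * m - 1 - i) (by omega) (by omega)
    have h2 := quad_ne_zero hm hq h0 hU hz (k := i + 1) (by omega) (by omega)
    rw [show 2 * m - 1 - (2 * m - 1 - i) = i by omega,
      show 2 * m - 1 - i = 2 * m - (i + 1) by omega, quad_symm P (by omega)] at h1
    rw [show 2 * m - 1 - i = 2 * m - (i + 1) by omega, ← h1]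
    have h3 : ((-1 : ℂ) ^ i) ≠ 0 := pow_ne_zero _ (by norm_num)
    rw [neg_inj, eq_div_iff (mul_ne_zero h3 h2)]
    linear_combination (P (i + 1) * ent (mat (zElt hm hq h0 U)) i (2 * m - 1) *
      quad m P (i + 1)) * neg_one_pow_mul_self i

end equations

/-! ### Solving the equations defining `Z_d` -/

/-- The entries of the unipotent factor `U` of the element of `Z_d` with coordinates `P`. -/
def uEntry (m : ℕ) (q : ℂ) (P : ℕ → ℂ) (a b : ℕ) : ℂ :=
  -- Forced values. The last column of `U` is `q A_a`, with `A_0 = -q / P_{2m-1}` and `A_a =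
  -- P_{2m-1-a} / S_{2m-1-a}`. For `a < b < 2m-1` the vanishing of `z_{a,2m-1-b}` gives `U_{ab} =
  -- (-1)^b A_a P_b`.
  if b < a then 0 else if a = b then 1
  else if a = 0 then
    (if b + 1 = 2 * m then -(q * q) / P (2 * m - 1) else (-1) ^ (b + 1) * (q * P b / P (2 * m - 1)))
  else if b + 1 = 2 * m then q * P (2 * m - 1 - a) / quad m P (2 * m - 1 - a)
  else (-1) ^ b * (P (2 * m - 1 - a) * P b / quad m P (2 * m - 1 - a))

/-- The unipotent factor `U` as a matrix. -/
def uMat (m : ℕ) (q : ℂ) (P : ℕ → ℂ) : Matrix (Fin (2 * m)) (Fin (2 * m)) ℂ :=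
  Matrix.of fun a b : Fin (2 * m) => uEntry m q P a b

theorem ent_uMat (q : ℂ) (P : ℕ → ℂ) {a b : ℕ} (ha : a < 2 * m) (hb : b < 2 * m) :
    ent (uMat m q P) a b = uEntry m q P a b :=
  ent_of _ ha hb

theorem ent_uMat_lower (q : ℂ) (P : ℕ → ℂ) (a b : ℕ) (hab : b < a) :
    ent (uMat m q P) a b = 0 := by
  by_cases ha : a < 2 * m
  · rw [ent_uMat _ _ ha (by omega), uEntry, if_pos hab]
  · exact ent_eq_zero_left _ (by omega)

theorem ent_uMat_diag (q : ℂ) (P : ℕ → ℂ) (a : ℕ) (ha : a < 2 * m) :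
    ent (uMat m q P) a a = 1 := by
  rw [ent_uMat _ _ ha ha, uEntry, if_neg (by omega), if_pos rfl]

theorem ent_uMat_first (q : ℂ) (P : ℕ → ℂ) {b : ℕ} (hb : 1 ≤ b) (hb' : b + 1 < 2 * m) :
    ent (uMat m q P) 0 b = (-1) ^ (b + 1) * (q * P b / P (2 * m - 1)) := by
  rw [ent_uMat _ _ (by omega) (by omega), uEntry, if_neg (by omega), if_neg (by omega),
    if_pos rfl, if_neg (by omega)]

theorem ent_uMat_corner (hm : 1 ≤ m) (q : ℂ) (P : ℕ → ℂ) :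
    ent (uMat m q P) 0 (2 * m - 1) = -(q * q) / P (2 * m - 1) := by
  rw [ent_uMat _ _ (by omega) (by omega), uEntry, if_neg (by omega), if_neg (by omega),
    if_pos rfl, if_pos (by omega)]

theorem ent_uMat_last (q : ℂ) (P : ℕ → ℂ) {a : ℕ} (ha : 1 ≤ a) (ha' : a + 1 < 2 * m) :
    ent (uMat m q P) a (2 * m - 1) = q * P (2 * m - 1 - a) / quad m P (2 * m - 1 - a) := by
  rw [ent_uMat _ _ (by omega) (by omega), uEntry, if_neg (by omega), if_neg (by omega),
    if_neg (by omega), if_pos (by omega)]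

theorem ent_uMat_mid (q : ℂ) (P : ℕ → ℂ) {a b : ℕ} (ha : 1 ≤ a) (hab : a < b)
    (hb : b + 1 < 2 * m) : ent (uMat m q P) a b =
      (-1) ^ b * (P (2 * m - 1 - a) * P b / quad m P (2 * m - 1 - a)) := by
  rw [ent_uMat _ _ (by omega) (by omega), uEntry, if_neg (by omega), if_neg (by omega),
    if_neg (by omega), if_neg (by omega)]

section solve

variable (hm : 2 ≤ m) {q : ℂ} (hq : q ≠ 0) {P : ℕ → ℂ} (h0 : P 0 = 1)
  (hP : ∀ k, 1 ≤ k → k < 2 * m → quad m P k ≠ 0)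

include hm h0 hP

/-- In the columns `b ≥ 1` the conditions are the definition of `U`. In column 0 they are the
remaining relations on `A`: they hold by the choice of denominators in the rows `a ≥ 1`, and by the
vanishing of the middle sum in row 0. -/
theorem antiTri_uMat : AntiTri (uMat m q P * mat (cLift m hq) * heisMat m P) := by
  have hlast : P (2 * m - 1) ≠ 0 := by
    have := hP 1 le_rfl (by omega)
    rwa [quad_one, h0, one_mul] at this
  intro a b hab
  by_cases hb0 : b = 0
  · subst hb0
    by_cases ha0 : a = 0
    · subst ha0
      rw [ent_mul_heisMat_zero (t := 2 * m - 2) _ _ (by omega) (by omega)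
          (fun _ _ _ => by omega), add_assoc (ent _ _ _), ← Finset.sum_Ico_succ_top (by omega)
          (fun k => ent (uMat m q P * mat (cLift m hq)) 0 k * ((-1) ^ (k + 1) * P k)),
        show 2 * m - 2 + 1 = 2 * m - 1 by omega, ent_mul_cLift_first (by omega),
        ent_uMat_diag _ _ _ (by omega), ent_mul_cLift_last (by omega),
        ent_uMat_corner (by omega)]
      have h2 : ∑ j ∈ Finset.Ico 1 (2 * m - 1), ent (uMat m q P * mat (cLift m hq))
          0 j * ((-1) ^ (j + 1) * P j) = -(q / P (2 * m - 1)) *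
          ∑ j ∈ Finset.Ico 1 (2 * m - 1), (-1) ^ j * (P j * P (2 * m - 1 - j)) := by
        rw [Finset.mul_sum]
        refine Finset.sum_congr rfl fun j hj => ?_
        rw [Finset.mem_Ico] at hj
        rw [ent_mul_cLift_mid (by omega) _ _ _ (by omega) (by omega),
          ent_uMat_first _ _ (by omega) (by omega),
          neg_one_pow_congr (a := 2 * m - 1 - j + 1) (b := j) (by omega), pow_succ]
        have := neg_one_pow_mul_self j
        linear_combination (-(q * P (2 * m - 1 - j) / P (2 * m - 1)) * (-1) ^ j * P j) * this
      have hq1 := quad_symm (m := m) P (k := 1) (by omega)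
      rw [quad_one, h0, one_mul, quad_eq_Ico P h0 (by omega)] at hq1
      rw [h2, show ∑ j ∈ Finset.Ico 1 (2 * m - 1), (-1) ^ j * (P j * P (2 * m - 1 - j)) = 0 by
        linear_combination hq1]
      field_simp
      ring
    · rw [ent_mul_heisMat_zero (t := 2 * m - 1 - a) _ _ (by omega) (by omega),
        ent_mul_cLift_first (by omega), ent_uMat_lower _ _ _ _ (by omega),
        ent_mul_cLift_mid (by omega) _ _ _ (by omega) (by omega),
        show 2 * m - 1 - (2 * m - 1 - a) = a by omega, ent_uMat_diag _ _ _ (by omega),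
        ent_mul_cLift_last (by omega), ent_uMat_last _ _ (by omega) (by omega)]
      · have hS := hP (2 * m - 1 - a) (by omega) (by omega)
        have hS' := quad_eq_Ico (m := m) P h0 (k := 2 * m - 1 - a) (by omega)
        have h2 : ∑ j ∈ Finset.Ico 1 (2 * m - 1 - a), ent (uMat m q P * mat (cLift m hq))
            a j * ((-1) ^ (j + 1) * P j) =
            P (2 * m - 1 - a) / quad m P (2 * m - 1 - a) * ∑ j ∈ Finset.Ico 1 (2 * m - 1 - a),
              (-1) ^ j * (P j * P (2 * m - 1 - j)) := by
          rw [Finset.mul_sum]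
          refine Finset.sum_congr rfl fun j hj => ?_
          rw [Finset.mem_Ico] at hj
          rw [ent_mul_cLift_mid (by omega) _ _ _ (by omega) (by omega),
            ent_uMat_mid _ _ (by omega) (by omega) (by omega),
            neg_one_pow_congr (a := 2 * m - 1 - j) (b := j + 1) (by omega), pow_succ]
          have := neg_one_pow_mul_self j
          linear_combination (P (2 * m - 1 - a) * P (2 * m - 1 - j) /
            quad m P (2 * m - 1 - a) * (-1) ^ j * P j) * this
        rw [h2, pow_succ]
        generalize quad m P (2 * m - 1 - a) = S at hS hS' ⊢
        generalize ∑ j ∈ Finset.Ico 1 (2 * m - 1 - a), (-1) ^ j * (P j * P (2 * m - 1 - j)) = T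
          at hS' ⊢
        have hs := neg_one_pow_mul_self (2 * m - 1 - a)
        have e1 : q⁻¹ * (q * P (2 * m - 1 - a) / S) = P (2 * m - 1 - a) / S := by
          field_simp
        have e2 : P (2 * m - 1 - a) / S * S = P (2 * m - 1 - a) := div_mul_cancel₀ _ hS
        rw [e1]
        linear_combination (-P (2 * m - 1 - a) / S) * hS' + e2 - P (2 * m - 1 - a) * hs
      · intro j hj hj'
        rw [ent_mul_cLift_mid (by omega) _ _ _ (by omega) (by omega),
          ent_uMat_lower _ _ _ _ (by omega), mul_zero]
  · rw [ent_mul_cLift_heis_mid hm _ _ _ (by omega) (by omega)]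
    by_cases ha0 : a = 0
    · subst ha0
      rw [ent_uMat_first _ _ (by omega) (by omega), ent_uMat_corner (by omega),
        neg_one_pow_congr (a := 2 * m - 1 - b + 1) (b := b) (by omega)]
      have := neg_one_pow_mul_self b
      have e1 : q⁻¹ * (-(q * q) / P (2 * m - 1)) = -q / P (2 * m - 1) := by
        field_simp
      rw [e1]
      linear_combination (q * P (2 * m - 1 - b) / P (2 * m - 1)) * this
    · rw [ent_uMat_mid _ _ (by omega) (by omega) (by omega), ent_uMat_last _ _ (by omega) (by omega),
        neg_one_pow_congr (a := 2 * m - 1 - b) (b := b + 1) (by omega), pow_succ]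
      have := neg_one_pow_mul_self b
      have e1 : q⁻¹ * (q * P (2 * m - 1 - a) / quad m P (2 * m - 1 - a)) =
          P (2 * m - 1 - a) / quad m P (2 * m - 1 - a) := by
        field_simp
      rw [e1]
      linear_combination (-P (2 * m - 1 - a) * P (2 * m - 1 - b) / quad m P (2 * m - 1 - a)) * this

include hq in
-- Symplecticity needs no computation: `U` is upper unipotent and becomes lower triangular after
-- multiplication by the symplectic matrix `c y ẇ₀⁻¹`, so `mul_adj_eq_one_of_lower` applies.
theorem uMat_mul_adj : uMat m q P * adj (uMat m q P) = 1 := by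
  refine mul_adj_eq_one_of_lower (g := cLift m hq * heis hm P h0 * (longLift m 1)⁻¹)
    (ent_uMat_lower q P) (ent_uMat_diag q P) ?_
  rw [mat_mul, mat_mul, ← Matrix.mul_assoc, ← Matrix.mul_assoc, mat_heis]
  exact (antiTri_uMat hm hq h0 hP).lower (by omega)

/-- The unipotent factor `U` in `Sp`. -/
def uLift : Sp m := ofAdj (uMat m q P) (uMat_mul_adj hm hq h0 hP)

theorem uLift_mem : uLift hm hq h0 hP ∈ Uplus m := by
  rw [mem_Uplus_iff]
  exact ⟨ent_uMat_lower q P, ent_uMat_diag q P⟩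

theorem antiTri_uLift : AntiTri (mat (zElt hm hq h0 (uLift hm hq h0 hP))) :=
  antiTri_uMat hm hq h0 hP

end solve

section unique

variable (hm : 2 ≤ m) {q : ℂ} (hq : q ≠ 0) {P : ℕ → ℂ} (h0 : P 0 = 1) {U : Sp m}
  (hU : U ∈ Uplus m) (hz : AntiTri (mat (zElt hm hq h0 U)))

theorem AntiTri.mul_inv_mem (hm : 1 ≤ m) {g h : Sp m} (hg : AntiTri (mat g))
    (hh : AntiTri (mat h)) : g * h⁻¹ ∈ lowerSp m := by
  have h1 : g * (longLift m 1)⁻¹ ∈ lowerSp m := by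
    rw [mem_lowerSp_iff, mat_mul]
    exact hg.lower hm
  have h2 : h * (longLift m 1)⁻¹ ∈ lowerSp m := by
    rw [mem_lowerSp_iff, mat_mul]
    exact hh.lower hm
  have h3 := (lowerSp m).mul_mem h1 ((lowerSp m).inv_mem h2)
  have h4 : g * (longLift m 1)⁻¹ * (h * (longLift m 1)⁻¹)⁻¹ = g * h⁻¹ := by group
  rwa [h4] at h3

include hU hz in
-- The quotient of the two elements is `U U'⁻¹`. It is both upper unipotent and, as a quotient of
-- elements of `B_- ẇ₀`, lower triangular.
theorem zElt_unique {U' : Sp m} (hU' : U' ∈ Uplus m)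
    (hz' : AntiTri (mat (zElt hm hq h0 U'))) : U = U' := by
  have h1 := hz.mul_inv_mem (by omega) hz'
  have h2 : zElt hm hq h0 U * (zElt hm hq h0 U')⁻¹ = U * U'⁻¹ := by
    unfold zElt
    group
  rw [h2] at h1
  exact mul_inv_eq_one.mp (eq_one_of_mem (Uplus_mul hU (Uplus_inv hU')) h1)

/-- The coordinates `P` of an element of `Z_d` in terms of its last column `B`. -/
def pInv (m : ℕ) (q : ℂ) (B : ℕ → ℂ) (k : ℕ) : ℂ :=
  -- Solved from `last_mul_quad`, `first_mul_last` and `S_k(B) S_k(P) = -1`. The relation `q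
  -- B_{2m-1} = 1`, valid for the column of `z` itself, is used to make each formula homogeneous of
  -- degree 0, so that `B` may be rescaled.
  if k = 0 then 1 else if k = 2 * m - 1 then -(q * q) * B (2 * m - 1) / B 0
  else -q * (B (2 * m - 1 - k) * B (2 * m - 1)) / quad m B k

include hU hz in
-- Makes the passage from `P` to the last column invertible. In the induction step both new factors
-- of the last column are eliminated with `last_mul_quad`, at `k` and at `2m-1-k`; the latter
-- involves `S_{k+1}` by `quad_symm`.
theorem quad_last_mul_quad {k : ℕ} (hk : 1 ≤ k) (hk' : k < 2 * m) :
    quad m (fun i => ent (mat (zElt hm hq h0 U)) i (2 * m - 1)) k * quad m P k = -1 := by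
  have hlast : ent (mat (zElt hm hq h0 U)) (2 * m - 1) (2 * m - 1) = q⁻¹ := by
    rw [ent_zElt_last, (mem_Uplus_iff.mp hU).2 _ (by omega), mul_one]
  have hfirst := first_mul_last hm hq h0 hU hz
  induction k, hk using Nat.le_induction with
  | base =>
    rw [quad_one, quad_one, h0, hlast]
    have : q⁻¹ * q = 1 := inv_mul_cancel₀ hq
    linear_combination q⁻¹ * hfirst - this
  | succ k hk ih =>
    have h1 := ih (by omega)
    have h2 := last_mul_quad hm hq h0 hU hz hk (by omega)
    have h3 := last_mul_quad hm hq h0 hU hz (k := 2 * m - 1 - k) (by omega) (by omega)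
    have h4 := quad_succ (m := m) P k
    have h5 := quad_ne_zero hm hq h0 hU hz hk (by omega)
    rw [show 2 * m - 1 - (2 * m - 1 - k) = k by omega,
      show 2 * m - 1 - k = 2 * m - (k + 1) by omega, quad_symm P (by omega),
      show 2 * m - (k + 1) = 2 * m - 1 - k by omega] at h3
    rw [quad_succ]
    generalize quad m (fun i => ent (mat (zElt hm hq h0 U)) i (2 * m - 1)) k = T at h1 ⊢
    generalize ent (mat (zElt hm hq h0 U)) k (2 * m - 1) = A at h3 ⊢
    generalize ent (mat (zElt hm hq h0 U)) (2 * m - 1 - k) (2 * m - 1) = A' at h2 ⊢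
    have h6 := neg_one_pow_mul_self k
    apply mul_right_cancel₀ h5
    linear_combination (quad m P (k + 1)) * h1 + ((-1) ^ k * A * quad m P (k + 1)) * h2 +
      (-1) ^ k * P k * h3 - h4

include hU hz in
theorem pInv_zElt {k : ℕ} (hk : k < 2 * m) :
    pInv m q (fun i => ent (mat (zElt hm hq h0 U)) i (2 * m - 1)) k = P k := by
  have hlast : ent (mat (zElt hm hq h0 U)) (2 * m - 1) (2 * m - 1) = q⁻¹ := by
    rw [ent_zElt_last, (mem_Uplus_iff.mp hU).2 _ (by omega), mul_one]
  unfold pInv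
  split_ifs with h1 h2
  · rw [h1, h0]
  · have hfirst := first_mul_last hm hq h0 hU hz
    have h3 : ent (mat (zElt hm hq h0 U)) 0 (2 * m - 1) ≠ 0 := by
      intro h
      rw [h, zero_mul] at hfirst
      exact hq (neg_eq_zero.mp hfirst.symm)
    dsimp only
    rw [hlast, h2, div_eq_iff h3]
    field_simp
    linear_combination -hfirst
  · have h3 := quad_last_mul_quad hm hq h0 hU hz (k := k) (by omega) hk
    have h4 := last_mul_quad hm hq h0 hU hz (k := k) (by omega) (by omega)
    have h5 : quad m (fun i => ent (mat (zElt hm hq h0 U)) i (2 * m - 1)) k ≠ 0 := by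
      intro h
      rw [h, zero_mul] at h3
      norm_num at h3
    dsimp only
    rw [hlast, div_eq_iff h5, ← h4]
    field_simp
    linear_combination -ent (mat (zElt hm hq h0 U)) (2 * m - 1 - k) (2 * m - 1) * h3

theorem quad_smul (c : ℂ) (B : ℕ → ℂ) (k : ℕ) :
    quad m (fun i => c * B i) k = c * c * quad m B k := by
  unfold quad
  rw [Finset.mul_sum]
  exact Finset.sum_congr rfl fun j _ => by ring

theorem quad_congr {P Q : ℕ → ℂ} (h : ∀ k, k < 2 * m → P k = Q k) {k : ℕ} (hk : k ≤ 2 * m) :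
    quad m P k = quad m Q k := by
  unfold quad
  refine Finset.sum_congr rfl fun j hj => ?_
  rw [Finset.mem_range] at hj
  rw [h j (by omega), h _ (by omega)]

theorem pInv_smul (q : ℂ) {c : ℂ} (hc : c ≠ 0) (B : ℕ → ℂ) (k : ℕ) :
    pInv m q (fun i => c * B i) k = pInv m q B k := by
  unfold pInv
  rw [quad_smul]
  split_ifs
  · rfl
  · rw [show -(q * q) * (c * B (2 * m - 1)) = c * (-(q * q) * B (2 * m - 1)) by ring,
      mul_div_mul_left _ _ hc]
  · rw [show -q * (c * B (2 * m - 1 - k) * (c * B (2 * m - 1))) =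
        c * c * (-q * (B (2 * m - 1 - k) * B (2 * m - 1))) by ring,
      mul_div_mul_left _ _ (mul_ne_zero hc hc)]

end unique

/-! ### The double coset of `(ẇ^P)⁻¹` -/

theorem Acts.inv {g : Sp m} {k l : ℕ} {c : ℂ} (h : Acts g k c l) (hk : k < 2 * m) :
    c ≠ 0 ∧ Acts g⁻¹ l c⁻¹ k := by
  unfold Acts at *
  have h1 : E m k = c • (mat g⁻¹ *ᵥ E m l) := by
    rw [← Matrix.mulVec_smul, ← h, Matrix.mulVec_mulVec, mat_inv_mul_mat, Matrix.one_mulVec]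
  have hc : c ≠ 0 := by
    rintro rfl
    rw [zero_smul] at h1
    have := congrFun h1 ⟨k, hk⟩
    simp [E] at this
  exact ⟨hc, by rw [h1, smul_smul, inv_mul_cancel₀ hc, one_smul]⟩

theorem upperSp_diag_ne_zero {g : Sp m} (hg : g ∈ upperSp m) {a : ℕ} (ha : a < 2 * m) :
    ent (mat g) a a ≠ 0 := by
  intro h0
  have h1 : ent (mat g * mat g⁻¹) a a = 1 := by
    rw [mat_mul_mat_inv, ent_one ha, if_pos rfl]
  rw [ent_mul, Finset.sum_eq_zero] at h1
  · exact zero_ne_one h1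
  · intro k _
    rcases lt_trichotomy k a with h2 | h2 | h2
    · rw [mem_upperSp_iff.mp hg _ _ h2, zero_mul]
    · rw [h2, h0, zero_mul]
    · rw [mem_upperSp_iff.mp ((upperSp m).inv_mem hg) _ _ h2, mul_zero]

/-- The strictly lower triangular part has rank one. -/
def RankOne (u : Sp m) : Prop :=
  bottom u (2 * m - 1) ≠ 0 ∧ ∀ a b, b < a → a < 2 * m →
    ent (mat u) a b * bottom u (2 * m - 1) = ent (mat u) a 0 * bottom u (2 * m - 1 - b)

/-- Up to scalars `(ẇ^P)⁻¹` swaps the two extreme basis vectors and fixes the middle ones. Below the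
diagonal of `b₁ (ẇ^P)⁻¹ b₂` the middle terms die by triangularity, and what is left is the last
column of `b₁` times the first row of `b₂`. -/
theorem rankOne_of_mem_doubleCoset (hm : 1 ≤ m) {u : Sp m}
    (h : cls u ∈ DoubleCoset.doubleCoset (wUpP m)⁻¹ (Bplus m) (Bplus m)) : RankOne u := by
  obtain ⟨_, ⟨b₁, hb₁, rfl⟩, _, ⟨b₂, hb₂, rfl⟩, h⟩ := DoubleCoset.mem_doubleCoset.mp h
  have h1 : cls (b₁ * (wUpPLift m)⁻¹ * b₂) = cls u := by
    rw [h, ← cls_wUpPLift]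
    rfl
  obtain ⟨c, hc, h2⟩ := cls_eq_iff.mp h1
  rw [mat_mul] at h2
  have hb₁' := mem_upperSp_iff.mp hb₁
  have hb₂' := mem_upperSp_iff.mp hb₂
  obtain ⟨s, hs⟩ := acts_wUpPLift hm (2 * m - 1) (by omega)
  rw [if_pos (by omega), show 2 * m - 1 - (2 * m - 1) = 0 by omega] at hs
  obtain ⟨hs0, hs⟩ := hs.inv (by omega)
  have key : ∀ a b, b < a → a < 2 * m → ent (mat u) a b =
      c * (s⁻¹ * ent (mat b₁) a (2 * m - 1) * ent (mat b₂) 0 b) := by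
    intro a b hab ha
    rw [h2, ent_smul, ent_mul, Finset.sum_eq_single 0]
    · rw [mat_mul, hs.ent_mul (by omega) (by omega)]
    · intro l hl hl0
      rw [Finset.mem_range] at hl
      by_cases hlb : b < l
      · rw [hb₂' _ _ hlb, mul_zero]
      · obtain ⟨t, ht⟩ := acts_wUpPLift hm l (by omega)
        rw [if_neg (by omega)] at ht
        rw [mat_mul, (ht.inv (by omega)).2.ent_mul (by omega) (by omega), hb₁' _ _ (by omega)]
        ring
    · simp
      omega
  refine ⟨?_, ?_⟩
  · unfold bottom
    rw [key _ _ (by omega) (by omega)]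
    refine mul_ne_zero hc (mul_ne_zero (mul_ne_zero (inv_ne_zero hs0)
      (upperSp_diag_ne_zero hb₁ (by omega))) ?_)
    rw [show 2 * m - 1 - (2 * m - 1) = 0 by omega]
    exact upperSp_diag_ne_zero hb₂ (by omega)
  · intro a b hab ha
    unfold bottom
    rw [show 2 * m - 1 - (2 * m - 1) = 0 by omega, show 2 * m - 1 - (2 * m - 1 - b) = b by omega,
      key a b hab ha, key a 0 (by omega) ha, key (2 * m - 1) 0 (by omega) (by omega),
      key (2 * m - 1) b (by omega) (by omega)]
    ring

/-- Column operations by an upper unipotent Heisenberg element `k` subtract multiples of the first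
column and clear the other columns below the diagonal. The resulting `M` becomes upper triangular
after multiplication by `ẇ^P`. -/
theorem mem_doubleCoset_of_rankOne (hm : 2 ≤ m) {u : Sp m} (hu : u ∈ Uminus m) (h : RankOne u) :
    cls u ∈ DoubleCoset.doubleCoset (wUpP m)⁻¹ (Bplus m) (Bplus m) := by
  obtain ⟨hs, hr⟩ := h
  have hb0 := bottom_zero hm hu
  set s := bottom u (2 * m - 1) with hsdef
  -- The multipliers are the ratios of the bottom row of `u` to its first entry; by rank one they
  -- serve every row. The sign undoes the one in the first column of `heisMat`.
  set Q : ℕ → ℂ := fun j => if j = 0 then 1 else (-1) ^ (j + 1) * (bottom u (2 * m - 1 - j) / s)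
    with hQdef
  have hQ0 : Q 0 = 1 := if_pos rfl
  have hQ : ∀ j, 1 ≤ j → (-1) ^ (j + 1) * Q j = bottom u (2 * m - 1 - j) / s := by
    intro j hj
    rw [hQdef]
    dsimp only
    rw [if_neg (by omega), ← mul_assoc, neg_one_pow_mul_self, one_mul]
  set k := tr (heis hm Q hQ0) with hk
  have hkU : k ∈ Uplus m := tr_mem_Uplus (heis_mem hm Q hQ0)
  have hkent : ∀ a b, ent (mat k) a b = ent (heisMat m Q) b a := by
    intro a b
    rw [hk, mat_tr, ent_transpose, mat_heis]
  obtain ⟨M, hM⟩ : ∃ M, M = u * k⁻¹ := ⟨_, rfl⟩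
  have hMk : M * k = u := by rw [hM]; group
  have hMk' : ∀ a b, ∑ l ∈ Finset.range (2 * m), ent (mat M) a l * ent (heisMat m Q) b l =
      ent (mat u) a b := by
    intro a b
    rw [← hMk, mat_mul, ent_mul]
    simp only [hkent]
  have hMfirst : ∀ a, ent (mat M) a 0 = ent (mat u) a 0 := by
    intro a
    rw [← hMk' a 0, Finset.sum_eq_single 0]
    · rw [ent_heisMat_diag _ (by omega), mul_one]
    · intro l hl hl0
      rw [ent_heisMat_upper _ (by omega), mul_zero]
    · simp
      omega
  have hMmid : ∀ a b, 1 ≤ b → b + 1 < 2 * m → b < a → a < 2 * m → ent (mat M) a b = 0 := by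
    intro a b hb hb' hab ha
    have h1 := hMk' a b
    rw [Finset.sum_eq_add 0 b (by omega)] at h1
    · rw [ent_heisMat_diag _ (by omega), ent_heisMat_col _ (by omega) hb, hQ b hb, hMfirst] at h1
      have h2 := hr a b hab ha
      have h3 : ent (mat u) a b = ent (mat u) a 0 * (bottom u (2 * m - 1 - b) / s) := by
        rw [← mul_div_assoc, eq_div_iff hs, h2]
      linear_combination h1 + h3
    · intro l _ hl
      rw [ent_heisMat_zero _ (by omega) (by omega) (by omega), mul_zero]
    · simp
      omega
    · simp
      omega
  have hu0 : ent (mat u) (2 * m - 1) 0 = s := by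
    rw [hsdef, bottom, show 2 * m - 1 - (2 * m - 1) = 0 by omega]
  have hMcorner : ent (mat M) (2 * m - 1) (2 * m - 1) = 0 := by
    have h1 := hMk' (2 * m - 1) (2 * m - 1)
    rw [Finset.sum_eq_add 0 (2 * m - 1) (by omega)] at h1
    · rw [ent_heisMat_diag _ (by omega), ent_heisMat_col _ (by omega) (by omega),
        hQ _ (by omega), hMfirst, hu0, (mem_Uminus_iff.mp hu).2 _ (by omega),
        show 2 * m - 1 - (2 * m - 1) = 0 by omega, hb0, mul_one_div_cancel hs] at h1
      linear_combination h1
    · intro l hl hl'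
      rw [Finset.mem_range] at hl
      rw [hMmid _ _ (by omega) (by omega) (by omega) (by omega), zero_mul]
    · simp
      omega
    · simp
      omega
  -- The bottom row of `M` is supported in column 0, so by the adjoint formula the first column of
  -- `M⁻¹` is supported in the last row; then `M M⁻¹ = 1` kills the last column of `M` below row 0.
  have hMlast : ∀ a, 1 ≤ a → a < 2 * m → ent (mat M) a (2 * m - 1) = 0 := by
    intro a ha ha'
    have h1 : ent (mat M * mat M⁻¹) a 0 = 0 := by
      rw [mat_mul_mat_inv, ent_one ha', if_neg (by omega)]
    rw [ent_mul, Finset.sum_eq_single (2 * m - 1)] at h1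
    · rw [ent_inv _ (by omega) (by omega), Nat.sub_zero,
        show 2 * m - 1 - (2 * m - 1) = 0 by omega, hMfirst, hu0] at h1
      exact (mul_eq_zero.mp h1).resolve_right
        (mul_ne_zero (pow_ne_zero _ (by norm_num)) hs)
    · intro l hl hl'
      rw [Finset.mem_range] at hl
      rw [ent_inv _ (by omega) (by omega), Nat.sub_zero]
      by_cases hl0 : l = 0
      · rw [hl0, Nat.sub_zero, hMcorner]
        ring
      · rw [hMmid (2 * m - 1) _ (by omega) (by omega) (by omega) (by omega)]
        ring
    · simp
      omega
  have hN : M * wUpPLift m ∈ upperSp m := by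
    rw [mem_upperSp_iff]
    intro a b hab
    by_cases ha : a < 2 * m
    · obtain ⟨c, hc⟩ := acts_wUpPLift (m := m) (by omega) b (by omega)
      rw [mat_mul, hc.ent_mul (by omega) (by split_ifs <;> omega)]
      by_cases hb : b = 0
      · rw [if_pos (by omega), hb, Nat.sub_zero, hMlast a (by omega) ha, mul_zero]
      · rw [if_neg (by omega), hMmid a b (by omega) (by omega) hab ha, mul_zero]
    · exact ent_eq_zero_left _ (by omega)
  refine DoubleCoset.mem_doubleCoset.mpr ⟨cls (M * wUpPLift m), ⟨_, hN, rfl⟩, cls k,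
    ⟨_, hkU.1, rfl⟩, ?_⟩
  rw [← cls_wUpPLift, ← cls_inv, ← cls_mul, ← cls_mul, mul_inv_cancel_right, hMk]

/-- By rank one a subdiagonal entry `u_{i+1,i}` is a multiple of the first-column entry `u_{i+1,0}`.
The latter follows from `(u u⁻¹)_{i0} = 0`: the first column of `u⁻¹` is the signed bottom row of
`u`, and rank one collects the sum into `quad`. -/
theorem sumF_of_rankOne (hm : 2 ≤ m) {u : Sp m} (hu : u ∈ Uminus m) (h : RankOne u)
    (hP : ∀ k, 1 ≤ k → k < 2 * m → quad m (bottom u) k ≠ 0) :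
    sumF u = bottom u 1 + ∑ l ∈ Finset.Icc 1 (m - 1), bottom u (l + 1) *
      bottom u (2 * m - 1 - l) / ((-1) ^ l * quad m (bottom u) (l + 1)) := by
  obtain ⟨hs, hr⟩ := h
  have hu' := mem_Uminus_iff.mp hu
  have hb0 := bottom_zero hm hu
  set P := bottom u with hPdef
  have hcol : ∀ i, 1 ≤ i → i + 1 < 2 * m →
      ent (mat u) i 0 * quad m P i = (-1) ^ (i + 1) * (P (2 * m - 1) * P i) := by
    intro i hi him
    have h1 : ent (mat u * mat u⁻¹) i 0 = 0 := by
      rw [mat_mul_mat_inv, ent_one (by omega), if_neg (by omega)]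
    have hinv : ∀ k, k < 2 * m → ent (mat u⁻¹) k 0 = (-1) ^ k * P k := by
      intro k hk
      rw [ent_inv _ hk (by omega), Nat.sub_zero, add_zero, hPdef]
      rfl
    rw [ent_mul, sum_range_split hi him, hinv 0 (by omega), hinv i (by omega), hu'.2 i (by omega),
      hu'.1 i (2 * m - 1) (by omega), hb0] at h1
    · have h2 : (∑ k ∈ Finset.Ico 1 i, ent (mat u) i k * ent (mat u⁻¹) k 0) * P (2 * m - 1) =
          ent (mat u) i 0 * ∑ j ∈ Finset.Ico 1 i, (-1) ^ j * (P j * P (2 * m - 1 - j)) := by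
        rw [Finset.mul_sum, Finset.sum_mul]
        refine Finset.sum_congr rfl fun j hj => ?_
        rw [Finset.mem_Ico] at hj
        have h3 := hr i j hj.2 (by omega)
        rw [hinv j (by omega)]
        linear_combination ((-1) ^ j * P j) * h3
      rw [quad_eq_Ico P hb0 hi, pow_succ]
      rw [pow_zero] at h1
      linear_combination P (2 * m - 1) * h1 - h2
    · intro k hk _
      rw [hu'.1 _ _ hk, zero_mul]
  have hsum : sumF u = ∑ i ∈ Finset.range m, ent (mat u) (i + 1) i := by
    unfold sumF
    simp only [entry_eq_ent]
    exact Fin.sum_univ_eq_sum_range (fun i => ent (mat u) (i + 1) i) m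
  rw [hsum, Finset.range_eq_Ico, Finset.sum_eq_sum_Ico_succ_bot (by omega),
    show Finset.Icc 1 (m - 1) = Finset.Ico 1 m by
      ext; simp only [Finset.mem_Icc, Finset.mem_Ico]; omega]
  congr 1
  · have h1 := hcol 1 le_rfl (by omega)
    rw [quad_one, hb0] at h1
    apply mul_right_cancel₀ hs
    linear_combination h1
  · refine Finset.sum_congr rfl fun i hi => ?_
    rw [Finset.mem_Ico] at hi
    have h1 := hcol (i + 1) (by omega) (by omega)
    have h2 := hr (i + 1) i (by omega) (by omega)
    have h3 := hP (i + 1) (by omega) (by omega)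
    have h4 : ((-1 : ℂ) ^ i) ≠ 0 := pow_ne_zero _ (by norm_num)
    rw [eq_div_iff (mul_ne_zero h4 h3)]
    rw [pow_succ, pow_succ] at h1
    apply mul_right_cancel₀ hs
    linear_combination ((-1) ^ i * quad m P (i + 1)) * h2 + (-1) ^ i * P (2 * m - 1 - i) * h1 +
      (P (i + 1) * P (2 * m - 1 - i) * P (2 * m - 1)) * neg_one_pow_mul_self i

/-! ### Factorizations -/

section factor

variable (hm : 2 ≤ m) {q : ℂ} (hq : q ≠ 0) {P : ℕ → ℂ} (h0 : P 0 = 1)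

theorem bottom_levi_mul {v y : Sp m} (hv : IsLevi v) {k : ℕ} (hk : k < 2 * m) :
    bottom (v * y) k = bottom y k := by
  unfold bottom
  rw [mat_mul, ent_mul, Finset.sum_eq_single (2 * m - 1)]
  · rw [(mem_Uminus_iff.mp hv.1).2 _ (by omega), one_mul]
  · intro l hl hl'
    rw [Finset.mem_range] at hl
    rw [hv.2 _ (by omega), zero_mul]
  · simp
    omega

theorem mul_levi_heis {u v : Sp m} (hv : IsLevi v) :
    u * cLift m hq * (v * heis hm P h0) = zElt hm hq h0 (u * tr v⁻¹) := by
  unfold zElt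
  calc u * cLift m hq * (v * heis hm P h0) = u * (cLift m hq * v) * heis hm P h0 := by group
    _ = u * tr v⁻¹ * cLift m hq * heis hm P h0 := by
      rw [cLift_mul_levi (by omega) hq hv]
      group

theorem sumE_tr_levi_inv {v : Sp m} (hv : IsLevi v) : sumE (tr v⁻¹) = -sumF v := by
  rw [sumE_tr, sumF_inv hv.1]

/-- The factorization with second factor in the double coset of `(ẇ^P)⁻¹`. -/
theorem exists_rankOne_factorization {U : Sp m} (hU : U ∈ Uplus m)
    (hz : AntiTri (mat (zElt hm hq h0 U))) :
    ∃ u₁ ∈ Uplus m, ∃ u₂ ∈ Uminus m, RankOne u₂ ∧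
      u₁ * cLift m hq * u₂ = zElt hm hq h0 U := by
  obtain ⟨v, hv, hvU⟩ := exists_levi_mul_heis hm (tr_mem_Uminus hU)
  set Q := bottom (tr U) with hQ
  have hQ0 := bottom_zero hm (tr_mem_Uminus hU)
  set y := heis hm Q hQ0 with hy
  -- The Heisenberg decomposition is applied to the transpose of `U`; its Levi part is moved across
  -- `c` into the second factor, leaving the sparse first factor `tr y`.
  have hU' : U = tr y * tr v := by
    rw [← tr_mul, ← hvU, tr_tr]
  have hu2 : v⁻¹ * heis hm P h0 ∈ Uminus m := Uminus_mul hv.inv.1 (heis_mem hm P h0)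
  have hfac : tr y * cLift m hq * (v⁻¹ * heis hm P h0) = zElt hm hq h0 U := by
    rw [mul_levi_heis hm hq h0 hv.inv, inv_inv, ← hU']
  have hbot : ∀ k, k < 2 * m → bottom (v⁻¹ * heis hm P h0) k = P k := fun k hk => by
    rw [bottom_levi_mul hv.inv hk, bottom_heis hm P h0 hk]
  refine ⟨tr y, tr_mem_Uplus (heis_mem hm _ _), v⁻¹ * heis hm P h0, hu2, ⟨?_, ?_⟩, hfac⟩
  · rw [hbot _ (by omega)]
    have := quad_ne_zero hm hq h0 hU hz (k := 1) le_rfl (by omega)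
    rwa [quad_one, h0, one_mul] at this
  · set u := v⁻¹ * heis hm P h0 with hu
    have hrow : ∀ b, b < 2 * m → ent (mat u) (2 * m - 1) b = bottom u (2 * m - 1 - b) := by
      intro b hb
      unfold bottom
      rw [show 2 * m - 1 - (2 * m - 1 - b) = b by omega]
    -- Row `2m-1-a` of `tr y` has only its diagonal and last entries, so the vanishing of
    -- `z_{2m-1-a,b}` makes row `a` of `u`, left of the diagonal, a multiple of the bottom row.
    have key : ∀ a b, b < a → a + 1 < 2 * m → ent (mat u) a b =
        -((-1) ^ (2 * m - 1 - a + 1) * (Q a * (q⁻¹ * bottom u (2 * m - 1 - b)))) := by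
      intro a b hab ha
      have h1 := hz (2 * m - 1 - a) b (by omega)
      rw [← hfac, mul_assoc, mat_mul, ent_mul, Finset.sum_eq_add (2 * m - 1 - a) (2 * m - 1)
        (by omega)] at h1
      · rw [mat_tr, ent_transpose, ent_transpose, hy, mat_heis, ent_heisMat_diag _ (by omega),
          ent_heisMat_row _ (by omega) (by omega), mat_mul,
          ent_cLift_mul_mid (by omega) _ _ _ (by omega) (by omega),
          ent_cLift_mul_last (by omega), show 2 * m - 1 - (2 * m - 1 - a) = a by omega,
          hrow b (by omega)] at h1
        have h2 := neg_one_pow_mul_self (2 * m - 1 - a + 1)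
        linear_combination (-1) ^ (2 * m - 1 - a + 1) * h1 - ent (mat u) a b * h2
      · intro l hl hl'
        rw [mat_tr, ent_transpose, hy, mat_heis, ent_heisMat_zero _ (by omega) (by omega)
          (by omega), zero_mul]
      · simp
        omega
      · simp
        omega
    intro a b hab ha
    by_cases ha' : a + 1 = 2 * m
    · rw [show a = 2 * m - 1 by omega, hrow b (by omega), hrow 0 (by omega), Nat.sub_zero]
      ring
    · rw [key a b hab (by omega), key a 0 (by omega) (by omega), Nat.sub_zero]
      ring

end factor

/-! ### The torus element `d` -/

theorem acts_ext {g h : Sp m} (H : ∀ k, k < 2 * m → ∃ c l, Acts g k c l ∧ Acts h k c l) :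
    g = h := by
  apply mat_injective
  ext a b
  obtain ⟨c, l, h1, h2⟩ := H b b.2
  rw [h1.apply, h2.apply]

/-- Diagonal elements of `Sp`. -/
def IsTorus (t : Sp m) : Prop := ∀ k, k < 2 * m → ∃ c, Acts t k c k

theorem IsTorus.mul {s t : Sp m} (hs : IsTorus s) (ht : IsTorus t) : IsTorus (s * t) := by
  intro k hk
  obtain ⟨c, hc⟩ := hs k hk
  obtain ⟨d, hd⟩ := ht k hk
  exact ⟨_, hc.mul hd⟩

theorem IsTorus.inv {t : Sp m} (ht : IsTorus t) : IsTorus t⁻¹ := by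
  intro k hk
  obtain ⟨c, hc⟩ := ht k hk
  exact ⟨_, (hc.inv hk).2⟩

theorem IsTorus.conj {t w : Sp m} (ht : IsTorus t)
    (hw : ∀ k, k < 2 * m → ∃ c l, l < 2 * m ∧ Acts w k c l) : IsTorus (w⁻¹ * t * w) := by
  intro k hk
  obtain ⟨c, l, hl, hc⟩ := hw k hk
  obtain ⟨d, hd⟩ := ht l hl
  exact ⟨_, ((hc.inv hk).2.mul hd).mul hc⟩

theorem isTorus_of_ent {t : Sp m} (h : ∀ a b, a ≠ b → ent (mat t) a b = 0) {k : ℕ}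
    (hk : k < 2 * m) : Acts t k (ent (mat t) k k) k := by
  unfold Acts
  have := mulVec_E (mat t) ⟨k, hk⟩
  dsimp only at this
  rw [this]
  ext a
  rw [← ent_coe (mat t)]
  simp only [E, Pi.smul_apply, smul_eq_mul]
  split_ifs with h1
  · rw [h1, mul_one]
  · rw [h _ _ h1, mul_zero]

theorem IsTorus.ent {t : Sp m} (ht : IsTorus t) {a b : ℕ} (hab : a ≠ b) :
    ent (mat t) a b = 0 := by
  by_cases h : a < 2 * m ∧ b < 2 * m
  · obtain ⟨c, hc⟩ := ht b h.2
    rw [hc.ent h.1 h.2, if_neg hab]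
  · exact dif_neg h

theorem IsTorus.lower {t : Sp m} (ht : IsTorus t) : t ∈ lowerSp m :=
  mem_lowerSp_iff.mpr fun _ _ h => ht.ent h.ne

theorem IsTorus.upper {t : Sp m} (ht : IsTorus t) : t ∈ upperSp m :=
  mem_upperSp_iff.mpr fun _ _ h => ht.ent h.ne'

theorem isTorus_diagLift {q : ℂ} (hq : q ≠ 0) : IsTorus (diagLift m hq) :=
  fun k _ => ⟨_, acts_diagLift hq k⟩

theorem isTorus_iff_isDiag {t : Sp m} : IsTorus t ↔ (mat t).IsDiag := by
  constructor
  · intro h a b hab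
    rw [← ent_coe (mat t)]
    exact h.ent fun h' => hab (Fin.ext h')
  · intro h k hk
    refine ⟨_, isTorus_of_ent (fun a b hab => ?_) hk⟩
    unfold QuadricLG.ent
    split_ifs with h1
    · exact h fun h2 => hab (Fin.mk.inj h2)
    · rfl

theorem cls_diagLift_mem {q : ℂ} (hq : q ≠ 0) : cls (diagLift m hq) ∈ TWP m := by
  refine ⟨⟨_, isTorus_iff_isDiag.mp (isTorus_diagLift hq), rfl⟩, fun i hi him => ?_⟩
  have h : sdotLift m i * diagLift m hq = diagLift m hq * sdotLift m i := by
    refine acts_ext fun k hk => ?_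
    have hs := acts_sdotLift (m := m) (by omega : 1 ≤ i) him k
    refine ⟨_, _, hs.mul (acts_diagLift hq k), ((acts_diagLift hq _).mul hs).congr ?_ rfl⟩
    rw [mul_comm]
    congr 1
    by_cases h1 : k + 1 = i ∨ k + 1 + i = 2 * m
    · rw [if_pos h1]
      unfold diagEntry
      rw [if_neg (by omega), if_neg (by omega), if_neg (by omega), if_neg (by omega)]
    by_cases h2 : k = i ∨ k + i = 2 * m
    · rw [if_neg h1, if_pos h2]
      unfold diagEntry
      rw [if_neg (by omega), if_neg (by omega), if_neg (by omega), if_neg (by omega)]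
    · rw [if_neg h1, if_neg h2]
  change cls (sdotLift m i) * cls (diagLift m hq) * (cls (sdotLift m i))⁻¹ = _
  rw [← cls_mul, h, cls_mul, mul_inv_cancel_right]

theorem alpha1_cls (g : Sp m) : alpha1 (cls g) = ent (mat g) 0 0 / ent (mat g) 1 1 := rfl

theorem alpha1_diagLift (hm : 2 ≤ m) {q : ℂ} (hq : q ≠ 0) : alpha1 (cls (diagLift m hq)) = q := by
  rw [alpha1_cls, (acts_diagLift hq 0).ent (by omega) (by omega),
    (acts_diagLift hq 1).ent (by omega) (by omega), if_pos rfl, if_pos rfl, diagEntry, if_pos rfl,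
    diagEntry, if_neg (by omega), if_neg (by omega), div_one]

theorem Acts.scalar {g h : Sp m} {k l : ℕ} {c c₁ c₂ : ℂ} (hg : Acts g k c₁ l)
    (hh : Acts h k c₂ l) (hl : l < 2 * m) (H : mat h = c • mat g) : c₂ = c * c₁ := by
  unfold Acts at *
  rw [H, Matrix.smul_mulVec, hg, smul_smul] at hh
  have := congrFun hh ⟨l, hl⟩
  simp [E] at this
  exact this.symm

/-- Invariance under `s_2, …, s_m` makes the middle diagonal entries equal, and the symplectic
relation makes their common value `±1`. This sign is trivial in `PSp`, and `α_1(d) = q` fixes the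
rest. -/
theorem eq_diagLift (hm : 2 ≤ m) {q : ℂ} (hq : q ≠ 0) {d : PSp m} (hd : d ∈ TWP m)
    (hα : alpha1 d = q) : d = cls (diagLift m hq) := by
  obtain ⟨⟨g, hg, rfl⟩, hfix⟩ := hd
  have hg' := isTorus_iff_isDiag.mpr hg
  set D : ℕ → ℂ := fun k => ent (mat g) k k with hD
  have hact : ∀ k, k < 2 * m → Acts g k (D k) k := fun k hk =>
    isTorus_of_ent (fun a b hab => hg'.ent hab) hk
  have hD0 : ∀ k, k < 2 * m → D k ≠ 0 := fun k hk => ((hact k hk).inv hk).1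
  have hstep : ∀ i, 2 ≤ i → i ≤ m → D i = D (i - 1) := by
    intro i hi him
    have h1 : cls (sdotLift m i * g) = cls (g * sdotLift m i) := by
      rw [cls_mul, cls_mul]
      exact mul_inv_eq_iff_eq_mul.mp (hfix i hi him)
    obtain ⟨c, -, h2⟩ := cls_eq_iff.mp h1
    have hs := acts_sdotLift (m := m) (by omega : 1 ≤ i) him
    have hs0 := hs 0
    rw [if_neg (by omega), if_neg (by omega), if_neg (by omega)] at hs0
    have e1 := Acts.scalar (hs0.mul (hact 0 (by omega))) ((hact 0 (by omega)).mul hs0)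
      (by omega) h2
    -- Invariance holds only up to a scalar in `Sp`; the basis vector 0, fixed by `s_i` for `i ≥ 2`,
    -- shows that the scalar is 1.
    have hc : c = 1 := by
      have : (c - 1) * D 0 = 0 := by linear_combination -e1
      exact sub_eq_zero.mp ((mul_eq_zero.mp this).resolve_right (hD0 0 (by omega)))
    have hs1 := hs (i - 1)
    rw [if_pos (by omega), if_pos (by omega), show i - 1 + 1 = i by omega] at hs1
    have e2 := Acts.scalar (hs1.mul (hact (i - 1) (by omega))) ((hact i (by omega)).mul hs1)
      (by omega) h2
    rw [hc] at e2
    linear_combination -e2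
  have hconst : ∀ k, 1 ≤ k → k ≤ m → D k = D 1 := by
    intro k hk
    induction k, hk using Nat.le_induction with
    | base => intro _; rfl
    | succ k hk ih =>
      intro hk'
      rw [hstep (k + 1) (by omega) hk', Nat.add_sub_cancel, ih (by omega)]
  have hrev : ∀ k, k < 2 * m → D k * D (2 * m - 1 - k) = 1 := by
    intro k hk
    have h1 := (hact k hk).inv hk
    have h2 := h1.2.ent hk hk
    rw [if_pos rfl, ent_inv _ hk hk, pow_add, neg_one_pow_mul_self, one_mul] at h2
    change D (2 * m - 1 - k) = _ at h2
    rw [h2, mul_inv_cancel₀ h1.1]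
  -- The indices `m-1` and `m` are mirror images, and both entries equal `D 1`.
  have hsq : D 1 * D 1 = 1 := by
    have := hrev m (by omega)
    rwa [show 2 * m - 1 - m = m - 1 by omega, hconst m (by omega) le_rfl,
      hconst (m - 1) (by omega) (by omega)] at this
  have hq' : D 0 = q * D 1 := by
    rw [alpha1_cls, div_eq_iff (hD0 1 (by omega))] at hα
    exact hα
  refine (cls_eq_iff.mpr ⟨D 1, hD0 1 (by omega), ?_⟩).symm
  refine ent_ext fun a b ha hb => ?_
  rw [ent_smul, (acts_diagLift hq b).ent ha hb, (hact b hb).ent ha hb]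
  split_ifs with hab
  · unfold diagEntry
    by_cases hb0 : b = 0
    · rw [if_pos hb0, hb0, hq', mul_comm]
    · rw [if_neg hb0]
      by_cases hb1 : b + 1 = 2 * m
      · rw [if_pos hb1]
        have h1 := hrev b hb
        rw [show 2 * m - 1 - b = 0 by omega, hq'] at h1
        field_simp
        linear_combination D 1 * h1 - D b * q * hsq
      · rw [if_neg hb1, mul_one]
        by_cases hbm : b ≤ m
        · exact hconst b (by omega) hbm
        · have h1 := hrev b hb
          rw [hconst (2 * m - 1 - b) (by omega) (by omega)] at h1
          linear_combination D 1 * h1 - D b * hsq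
  · rw [mul_zero]

/-! ### Homogeneous coordinates and the divisor -/

/-- Homogeneous coordinates as a function on the natural numbers. -/
def pv (v : Fin (2 * m) → ℂ) (k : ℕ) : ℂ := if h : k < 2 * m then v ⟨k, h⟩ else 0

theorem pv_coe (v : Fin (2 * m) → ℂ) (k : Fin (2 * m)) : pv v k = v k := by
  simp [pv]

theorem eval_p (v : Fin (2 * m) → ℂ) (k : ℕ) : MvPolynomial.eval v (p m k) = pv v k := by
  unfold p pv
  split_ifs <;> simp

theorem pv_smul (c : ℂ) (v : Fin (2 * m) → ℂ) (k : ℕ) : pv (c • v) k = c * pv v k := by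
  unfold pv
  split_ifs <;> simp

theorem eval_r (v : Fin (2 * m) → ℂ) {l : ℕ} (hl : l < 2 * m) :
    MvPolynomial.eval v (r m l) = (-1) ^ l * quad m (pv v) (l + 1) := by
  unfold r quad
  rw [map_sum, ← Finset.sum_range_reflect, Finset.mul_sum]
  refine Finset.sum_congr rfl fun j hj => ?_
  rw [Finset.mem_range] at hj
  simp only [map_mul, map_pow, map_neg, map_one, eval_p]
  rw [show l - (l + 1 - 1 - j) = j by omega, show 2 * m - 1 - l + (l + 1 - 1 - j) = 2 * m - 1 - j by
    omega]
  have h1 : (-1 : ℂ) ^ (l + 1 - 1 - j) = (-1) ^ l * (-1) ^ j := by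
    rw [← pow_add]
    exact neg_one_pow_congr (by omega)
  rw [h1]
  ring

/-- `S_1 = p_0 p_{2m-1}` accounts for `D_0` and `D_m` together and `S_{l+1} = ± r_l` for `D_l`; the
indices beyond `m` repeat these by `quad_symm`. -/
theorem deq_ne_zero_iff (hm : 2 ≤ m) (v : Fin (2 * m) → ℂ) :
    (∀ i ≤ m, MvPolynomial.eval v (Deq m i) ≠ 0) ↔
      ∀ k, 1 ≤ k → k < 2 * m → quad m (pv v) k ≠ 0 := by
  constructor
  · intro h
    have h0 := h 0 (by omega)
    have hl := h m le_rfl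
    rw [Deq, if_pos rfl, eval_p] at h0
    rw [Deq, if_neg (by omega), if_pos rfl, eval_p] at hl
    have key : ∀ k, 1 ≤ k → k ≤ m → quad m (pv v) k ≠ 0 := by
      intro k hk hkm
      by_cases hk1 : k = 1
      · rw [hk1, quad_one]
        exact mul_ne_zero h0 hl
      · have := h (k - 1) (by omega)
        rw [Deq, if_neg (by omega), if_neg (by omega), eval_r _ (by omega),
          show k - 1 + 1 = k by omega] at this
        exact right_ne_zero_of_mul this
    intro k hk hk'
    by_cases hkm : k ≤ m
    · exact key k hk hkm
    · rw [← quad_symm _ (by omega)]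
      exact key _ (by omega) (by omega)
  · intro h i hi
    have h1 := h 1 le_rfl (by omega)
    rw [quad_one] at h1
    unfold Deq
    split_ifs with hi0 him
    · rw [eval_p]
      exact left_ne_zero_of_mul h1
    · rw [eval_p]
      exact right_ne_zero_of_mul h1
    · rw [eval_r _ (by omega)]
      exact mul_ne_zero (pow_ne_zero _ (by norm_num)) (h _ (by omega) (by omega))

theorem eval_Dsum_ne_zero_iff (hm : 2 ≤ m) (v : Fin (2 * m) → ℂ) :
    MvPolynomial.eval v (Dsum m) ≠ 0 ↔ ∀ k, 1 ≤ k → k < 2 * m → quad m (pv v) k ≠ 0 := by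
  rw [← deq_ne_zero_iff hm, Dsum, map_prod, Finset.prod_ne_zero_iff]
  simp only [Finset.mem_range, Nat.lt_succ_iff]

theorem p_isHomogeneous (k : ℕ) : (p m k).IsHomogeneous 1 := by
  unfold p
  split_ifs
  · exact MvPolynomial.isHomogeneous_X _ _
  · exact MvPolynomial.isHomogeneous_zero _ _ _

theorem r_isHomogeneous (l : ℕ) : (r m l).IsHomogeneous 2 := by
  unfold r
  refine MvPolynomial.IsHomogeneous.sum _ _ _ fun k _ => ?_
  have h1 : ((-1 : MvPolynomial (Fin (2 * m)) ℂ) ^ k).IsHomogeneous 0 := by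
    have := MvPolynomial.isHomogeneous_C (Fin (2 * m)) ((-1 : ℂ) ^ k)
    simpa using this
  exact (h1.mul (p_isHomogeneous _)).mul (p_isHomogeneous _)

theorem isAnticanonicalEq_Dsum (hm : 2 ≤ m) : IsAnticanonicalEq m (Dsum m) := by
  constructor
  · intro h
    -- At the point with `p_0 = p_{2m-1} = 1` and zeros elsewhere only the term `j = 0` survives, so
    -- every `S_k` equals 1.
    let v : Fin (2 * m) → ℂ := fun k => if k.val = 0 ∨ k.val + 1 = 2 * m then 1 else 0
    have hv : ∀ k, k < 2 * m → pv v k = if k = 0 ∨ k + 1 = 2 * m then 1 else 0 :=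
      fun k hk => dif_pos hk
    have hne := (eval_Dsum_ne_zero_iff hm v).mpr fun k hk hk' => by
      have : quad m (pv v) k = 1 := by
        unfold quad
        rw [Finset.sum_eq_single 0]
        · rw [hv _ (by omega), hv _ (by omega), if_pos (by omega), if_pos (by omega)]
          simp
        · intro j hj hj0
          rw [Finset.mem_range] at hj
          rw [hv _ (by omega), if_neg (by omega)]
          simp
        · simp
          omega
      rw [this]
      exact one_ne_zero
    rw [h] at hne
    simp at hne
  · have h1 : ∀ i ∈ Finset.range (m + 1),
        (Deq m i).IsHomogeneous (if i = 0 then 1 else if i = m then 1 else 2) := by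
      intro i _
      unfold Deq
      split_ifs
      · exact p_isHomogeneous _
      · exact p_isHomogeneous _
      · exact r_isHomogeneous _
    have h2 := MvPolynomial.IsHomogeneous.prod _ _ _ h1
    have h3 : ∑ i ∈ Finset.range (m + 1), (if i = 0 then 1 else if i = m then 1 else 2) =
        2 * m := by
      rw [Finset.sum_range_succ, Finset.range_eq_Ico, Finset.sum_eq_sum_Ico_succ_bot (by omega),
        Finset.sum_congr rfl (g := fun _ => 2)]
      · simp
        omega
      · intro i hi
        rw [Finset.mem_Ico] at hi
        rw [if_neg (by omega), if_neg (by omega)]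
    rw [h3] at h2
    exact h2

theorem mk_mem_Xo_iff (hm : 2 ≤ m) (v : Fin (2 * m) → ℂ) (hv : v ≠ 0) :
    (Projectivization.mk ℂ v hv : Xch m) ∈ Xo m ↔
      ∀ k, 1 ≤ k → k < 2 * m → quad m (pv v) k ≠ 0 := by
  rw [← deq_ne_zero_iff hm]
  constructor
  · intro h i hi
    exact h i hi v ⟨hv, rfl⟩
  · rintro h i hi w ⟨hw, he⟩
    obtain ⟨c, hc⟩ := (Projectivization.mk_eq_mk_iff' ℂ v w hv hw).mp he
    have hc0 : c ≠ 0 := by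
      rintro rfl
      rw [zero_smul] at hc
      exact hv hc.symm
    refine (deq_ne_zero_iff hm w).mpr (fun k hk hk' h0 => ?_) i hi
    refine (deq_ne_zero_iff hm v).mp h k hk hk' ?_
    rw [← hc, show pv (c • w) = fun k => c * pv w k from funext (pv_smul c w), quad_smul, h0,
      mul_zero]

theorem W_of_hasCoords (q : ℂ) {ξ : Xch m} {v : Fin (2 * m) → ℂ} (h : HasCoords ξ v) :
    W q ξ = Wvec q v := by
  obtain ⟨hv, rfl⟩ := h
  rfl

/-- The vector of homogeneous coordinates given by a sequence. -/
def toVec (m : ℕ) (P : ℕ → ℂ) : Fin (2 * m) → ℂ := fun k => P k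

theorem pv_toVec (P : ℕ → ℂ) {k : ℕ} (hk : k < 2 * m) : pv (toVec m P) k = P k :=
  dif_pos hk

theorem Wvec_toVec (hm : 2 ≤ m) (q : ℂ) (P : ℕ → ℂ) (h0 : P 0 = 1) : Wvec q (toVec m P) =
    P 1 + ∑ l ∈ Finset.Icc 1 (m - 1), P (l + 1) * P (2 * m - 1 - l) /
      ((-1) ^ l * quad m P (l + 1)) + q * (P 1 / P (2 * m - 1)) := by
  unfold Wvec
  rw [eval_p, eval_p, eval_p, pv_toVec _ (by omega), pv_toVec _ (by omega), pv_toVec _ (by omega),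
    h0, div_one]
  congr 2
  refine Finset.sum_congr rfl fun l hl => ?_
  rw [Finset.mem_Icc] at hl
  rw [eval_p, eval_p, eval_r _ (by omega), pv_toVec _ (by omega), pv_toVec _ (by omega),
    quad_congr (P := pv (toVec m P)) (Q := P) (fun k hk => pv_toVec P hk) (by omega)]

theorem quad_sign (s : ℂ) (P : ℕ → ℂ) {k : ℕ} (hk : k ≤ 2 * m) :
    quad m (fun i => s ^ i * P i) k = s ^ (2 * m - 1) * quad m P k := by
  unfold quad
  rw [Finset.mul_sum]
  refine Finset.sum_congr rfl fun j hj => ?_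
  rw [Finset.mem_range] at hj
  rw [show s ^ (2 * m - 1) = s ^ j * s ^ (2 * m - 1 - j) by rw [← pow_add]; congr 1; omega]
  ring

/-- Under `p_k ↦ (-1)^k p_k` every `r_l` changes sign, while the product `p_{l+1} p_{2m-1-l}`, of
even total index, does not; `p_1 / p_0` changes sign and `p_1 / p_{2m-1}` does not. -/
theorem Wvec_toVec_sign (hm : 2 ≤ m) (q : ℂ) (P : ℕ → ℂ) (h0 : P 0 = 1) :
    Wvec q (toVec m fun k => (-1) ^ k * P k) =
    -P 1 - ∑ l ∈ Finset.Icc 1 (m - 1), P (l + 1) * P (2 * m - 1 - l) /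
      ((-1) ^ l * quad m P (l + 1)) + q * (P 1 / P (2 * m - 1)) := by
  rw [Wvec_toVec hm q _ (by simp [h0]), pow_one, neg_one_mul, sub_eq_add_neg,
    ← Finset.sum_neg_distrib]
  congr 1
  · congr 1
    refine Finset.sum_congr rfl fun l hl => ?_
    rw [Finset.mem_Icc] at hl
    rw [quad_sign _ _ (by omega), neg_one_pow_congr (a := 2 * m - 1) (b := 1) (by omega),
      pow_one, show (-1 : ℂ) ^ (l + 1) * P (l + 1) * ((-1) ^ (2 * m - 1 - l) * P (2 * m - 1 - l)) =
      (-1) ^ (l + 1 + (2 * m - 1 - l)) * (P (l + 1) * P (2 * m - 1 - l)) by rw [pow_add]; ring,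
      neg_one_pow_congr (b := 0) (by omega), pow_zero, one_mul, neg_one_mul, mul_neg, div_neg]
  · rw [neg_one_pow_congr (a := 2 * m - 1) (b := 1) (by omega), pow_one, neg_one_mul, neg_div_neg_eq]

/-! ### Elements of `Z_d` and of the open Richardson variety -/

section Z

variable (hm : 2 ≤ m) {q : ℂ} (hq : q ≠ 0)

theorem cls_factorization (u₁ u₂ : Sp m) :
    cls u₁ * cls (diagLift m hq) * wP m * cls u₂ = cls (u₁ * cLift m hq * u₂) := by
  rw [← cls_longLift_two]
  unfold cLift
  simp only [← cls_mul, mul_assoc]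

include hm in
theorem cls_zElt_mem {P : ℕ → ℂ} (h0 : P 0 = 1) {U : Sp m} (hU : U ∈ Uplus m)
    (hz : AntiTri (mat (zElt hm hq h0 U))) : cls (zElt hm hq h0 U) ∈ Z m (cls (diagLift m hq)) :=
  ⟨(cls_mem_Bminus_mul_w0 (by omega) _).mpr hz, U, hU, _, heis_mem hm P h0,
    (cls_factorization hq _ _).symm⟩

include hm in
-- Moving the Levi part `v` of `u₂` to the left factor lowers `sumE` and `sumF` by the same amount
-- `sumF v`, so their difference does not depend on the factorization.
theorem factorization_eq_zElt {u₁ u₂ : Sp m} (h₁ : u₁ ∈ Uplus m) (h₂ : u₂ ∈ Uminus m) :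
    ∃ U ∈ Uplus m, u₁ * cLift m hq * u₂ = zElt hm hq (bottom_zero hm h₂) U ∧
      sumE u₁ - sumF u₂ = sumE U - bottom u₂ 1 := by
  obtain ⟨v, hv, hvu⟩ := exists_levi_mul_heis hm h₂
  have hvU : tr v⁻¹ ∈ Uplus m := tr_mem_Uplus hv.inv.1
  refine ⟨u₁ * tr v⁻¹, Uplus_mul h₁ hvU, ?_, ?_⟩
  · conv_lhs => rw [hvu]
    exact mul_levi_heis hm hq _ hv
  · have h3 : sumF u₂ = sumF v + bottom u₂ 1 := by
      conv_lhs => rw [hvu, sumF_mul hv.1 (heis_mem hm _ _), sumF_heis]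
    have h4 : sumE (u₁ * tr v⁻¹) = sumE u₁ - sumF v := by
      rw [sumE_mul h₁ hvU, sumE_tr_levi_inv hv, sub_eq_add_neg]
    rw [h3, h4]
    ring

include hm in
theorem exists_zElt {z : PSp m} (hz : z ∈ Z m (cls (diagLift m hq))) :
    ∃ (P : ℕ → ℂ) (h0 : P 0 = 1), ∃ U ∈ Uplus m, AntiTri (mat (zElt hm hq h0 U)) ∧
      z = cls (zElt hm hq h0 U) := by
  obtain ⟨h1, u₁, hu₁, u₂, hu₂, h2⟩ := hz
  obtain ⟨U, hU, h3, -⟩ := factorization_eq_zElt hm hq hu₁ hu₂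
  rw [cls_factorization, h3] at h2
  rw [h2] at h1
  exact ⟨_, _, U, hU, (cls_mem_Bminus_mul_w0 (by omega) _).mp h1, h2⟩

theorem upperSp_factorization {b : Sp m} (hb : b ∈ upperSp m) :
    ∃ u ∈ Uplus m, ∃ t, IsTorus t ∧ b = u * t := by
  have hb' := mem_upperSp_iff.mp hb
  have hrev : ∀ k, k < 2 * m → ent (mat b) k k * ent (mat b) (2 * m - 1 - k) (2 * m - 1 - k) = 1 := by
    intro k hk
    have h1 : ent (mat b * mat b⁻¹) k k = 1 := by
      rw [mat_mul_mat_inv, ent_one hk, if_pos rfl]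
    rw [ent_mul, Finset.sum_eq_single k] at h1
    · rwa [ent_inv _ hk hk, pow_add, neg_one_pow_mul_self, one_mul] at h1
    · intro l _ hl
      rcases lt_or_gt_of_ne hl with h2 | h2
      · rw [hb' _ _ h2, zero_mul]
      · rw [mem_upperSp_iff.mp ((upperSp m).inv_mem hb) _ _ h2, mul_zero]
    · intro h
      exact absurd (Finset.mem_range.mpr hk) h
  let f : Fin (2 * m) → ℂ := fun i => mat b i i
  have hT : Matrix.diagonal f * adj (Matrix.diagonal f) = 1 := by
    ext i j
    rw [Matrix.diagonal_mul, adj_apply, Matrix.one_apply, Matrix.diagonal_apply]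
    by_cases h : i = j
    · subst h
      rw [if_pos rfl, if_pos rfl, pow_add, neg_one_pow_mul_self, one_mul]
      have := hrev i i.2
      rw [show 2 * m - 1 - i.val = i.rev.val by rw [Fin.val_rev]; omega, ent_coe, ent_coe] at this
      exact this
    · rw [if_neg h, if_neg (fun h' => h (Fin.rev_injective h').symm), mul_zero, mul_zero]
  have ht : IsTorus (ofAdj _ hT) := isTorus_iff_isDiag.mpr (Matrix.isDiag_diagonal f)
  refine ⟨b * (ofAdj _ hT)⁻¹, ⟨(upperSp m).mul_mem hb ((upperSp m).inv_mem ht.upper), fun i => ?_⟩,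
    _, ht, by group⟩
  rw [mat_mul, mat_inv, mat_ofAdj, Matrix.mul_apply, Finset.sum_eq_single i]
  · rw [adj_apply, Matrix.diagonal_apply_eq, pow_add, neg_one_pow_mul_self, one_mul]
    have := hrev i i.2
    rw [show 2 * m - 1 - i.val = i.rev.val by rw [Fin.val_rev]; omega, ent_coe, ent_coe] at this
    exact this
  · intro l _ hl
    rw [adj_apply, Matrix.diagonal_apply_ne _ (fun h => hl (Fin.rev_injective h).symm), mul_zero,
      mul_zero]
  · simp

theorem tr_mem_upperSp {b : Sp m} (hb : b ∈ lowerSp m) : tr b ∈ upperSp m := by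
  rw [mem_upperSp_iff, mat_tr]
  intro i j hij
  rw [ent_transpose, mem_lowerSp_iff.mp hb _ _ hij]

theorem IsTorus.tr {t : Sp m} (ht : IsTorus t) : tr t = t := by
  apply mat_injective
  rw [mat_tr]
  refine ent_ext fun a b _ _ => ?_
  rw [ent_transpose]
  by_cases h : a = b
  · rw [h]
  · rw [ht.ent h, ht.ent (Ne.symm h)]

theorem lowerSp_factorization {b : Sp m} (hb : b ∈ lowerSp m) :
    ∃ u ∈ Uminus m, ∃ t, IsTorus t ∧ b = u * t := by
  obtain ⟨u, hu, t, ht, h⟩ := upperSp_factorization ((upperSp m).inv_mem (tr_mem_upperSp hb))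
  refine ⟨QuadricLG.tr u⁻¹, tr_mem_Uminus (Uplus_inv hu), t⁻¹, ht.inv, ?_⟩
  have h1 : QuadricLG.tr b = t⁻¹ * u⁻¹ := by
    rw [← mul_inv_rev, ← h, inv_inv]
  have h2 := congrArg QuadricLG.tr h1
  rwa [tr_tr, tr_mul, ht.inv.tr] at h2

theorem mk_mem_R {z : PSp m} (hz : z ∈ Z m (cls (diagLift m hq))) :
    (QuotientGroup.mk z : Flag m) ∈ R m := by
  obtain ⟨⟨b, hb, h1⟩, u₁, hu₁, u₂, hu₂, h2⟩ := hz
  refine ⟨z, ⟨?_, ?_⟩, rfl⟩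
  · exact DoubleCoset.mem_doubleCoset.mpr ⟨cls u₁ * cls (diagLift m hq),
      ⟨u₁ * diagLift m hq, (upperSp m).mul_mem hu₁.1 (isTorus_diagLift hq).upper, rfl⟩,
      cls u₂, ⟨u₂, hu₂.1, rfl⟩, h2⟩
  · exact DoubleCoset.mem_doubleCoset.mpr ⟨b, hb, 1, (Bminus m).one_mem, by rw [h1, mul_one]⟩

include hm in
-- A representative `g` is corrected on the right by `B_-`: removing `b₄` puts it in `B_- ẇ₀`. The
-- torus discrepancy with `d` passes through `ẇ_P` into the lower factor, whose own torus part `t₃`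
-- is then removed and passes through `ẇ₀`.
theorem exists_mk_eq {ξ : Flag m} (hξ : ξ ∈ R m) :
    ∃ z ∈ Z m (cls (diagLift m hq)), (QuotientGroup.mk z : Flag m) = ξ := by
  obtain ⟨g, ⟨h1, h2⟩, rfl⟩ := hξ
  obtain ⟨_, ⟨b₁, hb₁, rfl⟩, _, ⟨b₂, hb₂, rfl⟩, h1⟩ := DoubleCoset.mem_doubleCoset.mp h1
  obtain ⟨_, ⟨b₃, hb₃, rfl⟩, _, ⟨b₄, hb₄, rfl⟩, h2⟩ := DoubleCoset.mem_doubleCoset.mp h2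
  replace h1 : g = cls (b₁ * longLift m 2 * b₂) := by
    rw [h1, ← cls_longLift_two]; rfl
  replace h2 : g = cls (b₃ * longLift m 1 * b₄) := by
    rw [h2, ← cls_longLift_one]; rfl
  obtain ⟨u₁, hu₁, t₁, ht₁, rfl⟩ := upperSp_factorization hb₁
  have hw : ∀ k, k < 2 * m → ∃ c l, l < 2 * m ∧ Acts (longLift m 2) k c l := by
    intro k hk
    by_cases h : k + 1 < 2 ∨ 2 * m < k + 2
    · exact ⟨_, _, hk, acts_longLift_fix (by omega) (by omega) k h⟩
    · exact ⟨_, _, by omega, acts_longLift (a := 2) (by omega) (by omega) (by omega) k (by omega)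
        (by omega)⟩
  have ht₂ := ((isTorus_diagLift hq).inv.mul ht₁).conj hw
  set t₂ := (longLift m 2)⁻¹ * ((diagLift m hq)⁻¹ * t₁) * longLift m 2 with ht₂def
  have hb₅ : t₂ * (b₂ * b₄⁻¹) ∈ lowerSp m :=
    (lowerSp m).mul_mem ht₂.lower ((lowerSp m).mul_mem hb₂ ((lowerSp m).inv_mem hb₄))
  obtain ⟨u₂, hu₂, t₃, ht₃, h3⟩ := lowerSp_factorization hb₅
  have hz1 : cls (u₁ * cLift m hq * u₂) = g * cls (b₄⁻¹ * t₃⁻¹) := by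
    rw [h1, ← cls_mul]
    congr 1
    rw [show u₂ = t₂ * (b₂ * b₄⁻¹) * t₃⁻¹ by rw [h3]; group, ht₂def, cLift]
    group
  have hw1 : ∀ k, k < 2 * m → ∃ c l, l < 2 * m ∧ Acts (longLift m 1)⁻¹ k c l := by
    intro k hk
    have := acts_longLift (m := m) (a := 1) (by omega) (by omega) (by omega) (2 * m - 1 - k)
      (by omega) (by omega)
    exact ⟨_, _, by omega, (this.congr rfl (by omega : _ = k)).inv (by omega) |>.2⟩
  have ht₄ := ht₃.inv.conj hw1
  have hz2 : cls (u₁ * cLift m hq * u₂) =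
      cls (b₃ * ((longLift m 1)⁻¹⁻¹ * t₃⁻¹ * (longLift m 1)⁻¹)) * w0 m := by
    rw [hz1, h2, ← cls_longLift_one, ← cls_mul, ← cls_mul]
    congr 1
    group
  refine ⟨cls (u₁ * cLift m hq * u₂), ⟨⟨_, ⟨_, (lowerSp m).mul_mem hb₃ ht₄.lower, rfl⟩, hz2⟩,
    u₁, hu₁, u₂, hu₂, (cls_factorization hq _ _).symm⟩, ?_⟩
  rw [hz1]
  exact QuotientGroup.mk_mul_of_mem g ⟨_, (lowerSp m).mul_mem ((lowerSp m).inv_mem hb₄)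
    ((lowerSp m).inv_mem ht₃.lower), rfl⟩

end Z

/-! ### Values of the superpotentials -/

section Values

variable (hm : 2 ≤ m) {q : ℂ} (hq : q ≠ 0)

theorem plucker_zElt {P : ℕ → ℂ} (h0 : P 0 = 1) {U : Sp m} (hU : U ∈ Uplus m) (s : ℂ) :
    (fun k : Fin (2 * m) => s ^ k.val * plucker (zElt hm hq h0 U) k) =
      q⁻¹ • toVec m fun k => s ^ k * P k := by
  funext k
  have h : plucker (zElt hm hq h0 U) k = q⁻¹ * P k := bottom_zElt hm hq h0 hU k.2
  rw [h, Pi.smul_apply, smul_eq_mul, toVec]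
  ring

include hm in
-- Only the difference is independent of the factorization; the rank-one condition supplies the
-- value of `sumF u₂` that converts it into the sum.
theorem sumE_add_sumF_eq {u₁ u₂ : Sp m} (h₁ : u₁ ∈ Uplus m) (h₂ : u₂ ∈ Uminus m)
    (h : cls u₂ ∈ DoubleCoset.doubleCoset (wUpP m)⁻¹ (Bplus m) (Bplus m))
    (hz : AntiTri (mat (u₁ * cLift m hq * u₂))) :
    sumE u₁ + sumF u₂ = Wvec q (plucker (u₁ * cLift m hq * u₂)) := by
  obtain ⟨U, hU, he, hs⟩ := factorization_eq_zElt hm hq h₁ h₂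
  rw [he] at hz ⊢
  have hpl := plucker_zElt hm hq (bottom_zero hm h₂) hU 1
  simp only [one_pow, one_mul] at hpl
  change plucker _ = q⁻¹ • toVec m (bottom u₂) at hpl
  rw [hpl, Wvec_smul q _ (inv_ne_zero hq), Wvec_toVec hm q _ (bottom_zero hm h₂)]
  have hE := sumE_eq hm hq (bottom_zero hm h₂) hU hz
  have hF := sumF_of_rankOne hm h₂ (rankOne_of_mem_doubleCoset (by omega) h)
    fun k hk hk' => quad_ne_zero hm hq (bottom_zero hm h₂) hU hz hk hk'
  -- `sumE + sumF = (sumE - sumF) + 2 sumF`, which flips the signs of `P_1` and of the middle sum.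
  linear_combination hs + hE + 2 * hF

include hm in
theorem sumE_add_sumF_inv_eq {u₁ u₂ : Sp m} (h₁ : u₁ ∈ Uplus m) (h₂ : u₂ ∈ Uminus m)
    (hz : AntiTri (mat (u₁ * cLift m hq * u₂⁻¹))) :
    sumE u₁ + sumF u₂ = Wvec q fun k => (-1) ^ k.val * plucker (u₁ * cLift m hq * u₂⁻¹) k := by
  obtain ⟨U, hU, he, hs⟩ := factorization_eq_zElt hm hq h₁ (Uminus_inv h₂)
  rw [he] at hz ⊢
  rw [plucker_zElt hm hq (bottom_zero hm (Uminus_inv h₂)) hU, Wvec_smul q _ (inv_ne_zero hq),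
    Wvec_toVec_sign hm q _ (bottom_zero hm (Uminus_inv h₂))]
  have hE := sumE_eq hm hq (bottom_zero hm (Uminus_inv h₂)) hU hz
  have hF := sumF_inv h₂
  linear_combination hs + hE + hF

include hm in
theorem IsValue.exists_eq {ξ : Flag m} {t : ℂ} (h : IsValue (cls (diagLift m hq)) ξ t) :
    ∃ g : Sp m, cls g ∈ Z m (cls (diagLift m hq)) ∧ (QuotientGroup.mk (cls g) : Flag m) = ξ ∧
      t = Wvec q (plucker g) := by
  obtain ⟨u₁, h₁, u₂, h₂, hd, hz, hξ, rfl⟩ := h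
  rw [cls_factorization] at hz hξ
  exact ⟨_, hz, hξ, sumE_add_sumF_eq hm hq h₁ h₂ hd
    ((cls_mem_Bminus_mul_w0 (by omega) _).mp hz.1)⟩

include hm in
theorem IsValueInv.exists_eq {ξ : Flag m} {t : ℂ} (h : IsValueInv (cls (diagLift m hq)) ξ t) :
    ∃ g : Sp m, cls g ∈ Z m (cls (diagLift m hq)) ∧ (QuotientGroup.mk (cls g) : Flag m) = ξ ∧
      t = Wvec q fun k => (-1) ^ k.val * plucker g k := by
  obtain ⟨u₁, h₁, u₂, h₂, hz, hξ, rfl⟩ := h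
  rw [← cls_inv, cls_factorization] at hz hξ
  exact ⟨_, hz, hξ, sumE_add_sumF_inv_eq hm hq h₁ h₂
    ((cls_mem_Bminus_mul_w0 (by omega) _).mp hz.1)⟩

include hm in
theorem exists_isValue {z : PSp m} (hz : z ∈ Z m (cls (diagLift m hq))) :
    ∃ t, IsValue (cls (diagLift m hq)) (QuotientGroup.mk z) t := by
  obtain ⟨P, h0, U, hU, ha, rfl⟩ := exists_zElt hm hq hz
  obtain ⟨u₁, h₁, u₂, h₂, hr, he⟩ := exists_rankOne_factorization hm hq h0 hU ha
  have he' : cls u₁ * cls (diagLift m hq) * wP m * cls u₂ = cls (zElt hm hq h0 U) := by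
    rw [cls_factorization, he]
  exact ⟨_, u₁, h₁, u₂, h₂, mem_doubleCoset_of_rankOne hm h₂ hr, he'.symm ▸ hz, by rw [he'], rfl⟩

theorem exists_isValueInv {z : PSp m} (hz : z ∈ Z m (cls (diagLift m hq))) :
    ∃ t, IsValueInv (cls (diagLift m hq)) (QuotientGroup.mk z) t := by
  obtain ⟨hb, u₁, h₁, u₂, h₂, he⟩ := id hz
  have he' : cls u₁ * cls (diagLift m hq) * wP m * (cls u₂⁻¹)⁻¹ = z := by
    rw [he, cls_inv, inv_inv]
  exact ⟨_, u₁, h₁, u₂⁻¹, Uminus_inv h₂, he'.symm ▸ hz, by rw [he'], rfl⟩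

end Values

/-! ### The element of `Z_d` with given coordinates -/

theorem heisMat_congr {P Q : ℕ → ℂ} (h : ∀ k, k < 2 * m → P k = Q k) :
    heisMat m P = heisMat m Q := by
  refine ent_ext fun a b ha hb => ?_
  rw [ent_heisMat _ ha hb, ent_heisMat _ ha hb, h a ha, h (2 * m - 1 - b) (by omega)]

section zOf

variable (hm : 2 ≤ m) {q : ℂ} (hq : q ≠ 0)

theorem zElt_congr {P Q : ℕ → ℂ} (hP : P 0 = 1) (hQ : Q 0 = 1)
    (h : ∀ k, k < 2 * m → P k = Q k) (U : Sp m) : zElt hm hq hP U = zElt hm hq hQ U := by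
  apply mat_injective
  rw [mat_zElt, mat_zElt, heisMat_congr h]

open Classical in
/-- The element of `Sp` over the point of `Z_d` with coordinates `P`, where this makes sense. -/
def zOf (P : ℕ → ℂ) : Sp m :=
  if h : P 0 = 1 ∧ ∀ k, 1 ≤ k → k < 2 * m → quad m P k ≠ 0
  then zElt hm hq h.1 (uLift hm hq h.1 h.2) else 1

theorem zOf_def {P : ℕ → ℂ} (h0 : P 0 = 1) (hP : ∀ k, 1 ≤ k → k < 2 * m → quad m P k ≠ 0) :
    zOf hm hq P = zElt hm hq h0 (uLift hm hq h0 hP) :=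
  dif_pos ⟨h0, hP⟩

theorem mat_zOf {P : ℕ → ℂ} (h0 : P 0 = 1) (hP : ∀ k, 1 ≤ k → k < 2 * m → quad m P k ≠ 0) :
    mat (zOf hm hq P) = uMat m q P * mat (cLift m hq) * heisMat m P := by
  rw [zOf_def hm hq h0 hP]
  rfl

/-- By `zElt_unique` the explicit solution is the given element; agreement of coordinates is asked
only for indices below `2m`, since formulas such as `pInv` say nothing beyond. -/
theorem zOf_eq {P Q : ℕ → ℂ} (h0 : P 0 = 1) {U : Sp m} (hU : U ∈ Uplus m)
    (hz : AntiTri (mat (zElt hm hq h0 U))) (hQ : ∀ k, k < 2 * m → Q k = P k) :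
    zOf hm hq Q = zElt hm hq h0 U := by
  have hQ0 : Q 0 = 1 := by rw [hQ 0 (by omega), h0]
  have hqQ : ∀ k, 1 ≤ k → k < 2 * m → quad m Q k ≠ 0 := fun k hk hk' => by
    rw [quad_congr hQ (by omega)]
    exact quad_ne_zero hm hq h0 hU hz hk hk'
  rw [zOf_def hm hq hQ0 hqQ]
  have h1 := antiTri_uLift hm hq hQ0 hqQ
  rw [zElt_congr hm hq hQ0 h0 hQ] at h1 ⊢
  rw [zElt_unique hm hq h0 hU hz (uLift_mem hm hq hQ0 hqQ) h1]

theorem cls_zOf_mem {P : ℕ → ℂ} (h0 : P 0 = 1)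
    (hP : ∀ k, 1 ≤ k → k < 2 * m → quad m P k ≠ 0) :
    cls (zOf hm hq P) ∈ Z m (cls (diagLift m hq)) := by
  rw [zOf_def hm hq h0 hP]
  exact cls_zElt_mem hm hq h0 (uLift_mem hm hq h0 hP) (antiTri_uLift hm hq h0 hP)

end zOf

/-! ### Rationality -/

section Rational

variable {X ι : Type*} {j : X → ι → ℂ} {O : Set X} {P : X → ℕ → ℂ}

theorem isRat_quad (hP : ∀ k, k < 2 * m → FunSpace.IsRat j O fun x => P x k) {k : ℕ}
    (hk : k ≤ 2 * m) : FunSpace.IsRat j O fun x => quad m (P x) k := by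
  unfold quad
  refine FunSpace.isRat_sum _ fun i hi => ?_
  rw [Finset.mem_range] at hi
  exact (FunSpace.isRat_const _).mul ((hP _ (by omega)).mul (hP _ (by omega)))

theorem isRat_uEntry (q : ℂ) (hP : ∀ k, k < 2 * m → FunSpace.IsRat j O fun x => P x k)
    (hO : ∀ x ∈ O, ∀ k, 1 ≤ k → k < 2 * m → quad m (P x) k ≠ 0) {a b : ℕ} (ha : a < 2 * m)
    (hb : b < 2 * m) : FunSpace.IsRat j O fun x => uEntry m q (P x) a b := by
  have hlast : ∀ x ∈ O, P x (2 * m - 1) ≠ 0 := fun x hx => by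
    have := hO x hx 1 le_rfl (by omega)
    rw [quad_one] at this
    exact right_ne_zero_of_mul this
  have hL := hP (2 * m - 1) (by omega)
  have hR := hP (2 * m - 1 - a) (by omega)
  have hS := isRat_quad hP (k := 2 * m - 1 - a) (by omega)
  unfold uEntry
  split_ifs with h1 h2 h3 h4 h4
  · exact FunSpace.isRat_const _
  · exact FunSpace.isRat_const _
  · exact (FunSpace.isRat_const _).div hL hlast
  · exact (FunSpace.isRat_const _).mul (((FunSpace.isRat_const _).mul (hP b hb)).div hL hlast)
  · exact ((FunSpace.isRat_const _).mul hR).div hS fun x hx => hO x hx _ (by omega) (by omega)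
  · exact (FunSpace.isRat_const _).mul
      ((hR.mul (hP b hb)).div hS fun x hx => hO x hx _ (by omega) (by omega))

theorem isRat_pInv (q : ℂ) (hP : ∀ k, k < 2 * m → FunSpace.IsRat j O fun x => P x k)
    (hO : ∀ x ∈ O, ∀ k, 1 ≤ k → k < 2 * m → quad m (P x) k ≠ 0) {k : ℕ} (hk : k < 2 * m) :
    FunSpace.IsRat j O fun x => pInv m q (P x) k := by
  have hL := hP (2 * m - 1) (by omega)
  unfold pInv
  split_ifs with h1 h2
  · exact FunSpace.isRat_const _
  · refine ((FunSpace.isRat_const _).mul hL).div (hP 0 (by omega)) fun x hx => ?_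
    have := hO x hx 1 le_rfl (by omega)
    rw [quad_one] at this
    exact left_ne_zero_of_mul this
  · exact ((FunSpace.isRat_const _).mul ((hP _ (by omega)).mul hL)).div
      (isRat_quad hP (by omega)) fun x hx => hO x hx _ (by omega) hk

theorem isRat_heisMat (hP : ∀ k, k < 2 * m → FunSpace.IsRat j O fun x => P x k) {a b : ℕ}
    (ha : a < 2 * m) (hb : b < 2 * m) :
    FunSpace.IsRat j O fun x => ent (heisMat m (P x)) a b := by
  simp only [ent_heisMat _ ha hb]
  split_ifs
  · exact FunSpace.isRat_const _
  · exact (FunSpace.isRat_const _).mul (hP a ha)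
  · exact hP _ (by omega)
  · exact FunSpace.isRat_const _

theorem isRat_ent_mul {M N : X → Matrix (Fin (2 * m)) (Fin (2 * m)) ℂ}
    (hM : ∀ a b, a < 2 * m → b < 2 * m → FunSpace.IsRat j O fun x => ent (M x) a b)
    (hN : ∀ a b, a < 2 * m → b < 2 * m → FunSpace.IsRat j O fun x => ent (N x) a b) (a b : ℕ)
    (ha : a < 2 * m) (hb : b < 2 * m) : FunSpace.IsRat j O fun x => ent (M x * N x) a b := by
  simp only [ent_mul]
  refine FunSpace.isRat_sum _ fun k hk => ?_
  rw [Finset.mem_range] at hk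
  exact (hM a k ha hk).mul (hN k b hk hb)

/-- Common source of the regularity of both inverse maps: the entries of `zOf` are rational in `P`,
with denominators among the `S_k` and `P_{2m-1}`. -/
theorem morphismOn_zOf (hm : 2 ≤ m) {q : ℂ} (hq : q ≠ 0)
    (hopen : ((FunSpace.affine ι).induced j).top.IsOpen O)
    (hP : ∀ k, k < 2 * m → FunSpace.IsRat j O fun x => P x k) (h0 : ∀ x, P x 0 = 1)
    (hO : ∀ x ∈ O, ∀ k, 1 ≤ k → k < 2 * m → quad m (P x) k ≠ 0) :
    FunSpace.MorphismOn ((FunSpace.affine ι).induced j) (varPSp m) O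
      fun x => cls (zOf hm hq (P x)) := by
  refine FunSpace.MorphismOn.comp (FunSpace.isMorphism_quotient _ _) ?_
  refine FunSpace.morphismOn_of_isRat hopen fun ab => ?_
  refine FunSpace.IsRat.congr (f := fun x => ent (uMat m q (P x) * mat (cLift m hq) *
    heisMat m (P x)) ab.1 ab.2) (isRat_ent_mul (isRat_ent_mul (fun a b ha hb => ?_)
      fun _ _ _ _ => FunSpace.isRat_const _) (fun a b ha hb => isRat_heisMat hP ha hb) _ _ ab.1.2
      ab.2.2) fun x hx => ?_
  · simp only [ent_uMat _ _ ha hb]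
    exact isRat_uEntry q hP hO ha hb
  · rw [← mat_zOf hm hq (h0 x) (hO x hx), ent_coe]

end Rational

/-! ### The map from `Z_d` to the mirror projective space -/

section alpha

variable (hm : 2 ≤ m) {s : ℂ} (hs : s * s = 1)

include hm in
theorem plucker_ne_zero (g : Sp m) : plucker g ≠ 0 := by
  intro h
  have h1 : ent (mat g * mat g⁻¹) (2 * m - 1) (2 * m - 1) = 1 := by
    rw [mat_mul_mat_inv, ent_one (by omega), if_pos rfl]
  rw [ent_mul, Finset.sum_eq_zero] at h1
  · exact zero_ne_one h1
  · intro k hk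
    rw [Finset.mem_range] at hk
    have h2 : ent (mat g) (2 * m - 1) (2 * m - 1 - (2 * m - 1 - k)) = 0 :=
      congrFun h ⟨2 * m - 1 - k, by omega⟩
    rw [show 2 * m - 1 - (2 * m - 1 - k) = k by omega] at h2
    rw [h2, zero_mul]

include hs in
theorem pow_mul_pow_eq_one (k : ℕ) : s ^ k * s ^ k = 1 := by
  rw [← mul_pow, hs, one_pow]

include hs in
theorem pow_ne_zero_of_mul_self (k : ℕ) : s ^ k ≠ 0 :=
  left_ne_zero_of_mul_eq_one (pow_mul_pow_eq_one hs k)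

include hm hs in
theorem signed_plucker_ne_zero (g : Sp m) :
    (fun k : Fin (2 * m) => s ^ k.val * plucker g k) ≠ 0 := by
  intro h
  refine plucker_ne_zero hm g (funext fun k => ?_)
  exact (mul_eq_zero.mp (congrFun h k)).resolve_left (pow_ne_zero_of_mul_self hs _)

/-- The bottom row of an element of `PSp`, read from right to left and with the signs `s ^ k`, as
a point of projective space. -/
def rowPoint (z : PSp m) : Xch m :=
  Quotient.liftOn' z (fun g => Projectivization.mk ℂ _ (signed_plucker_ne_zero hm hs g)) (by
    intro a b hab
    obtain ⟨c, hc, h⟩ := cls_eq_iff.mp (Quotient.sound' hab : cls a = cls b)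
    refine ((Projectivization.mk_eq_mk_iff' ℂ _ _ _ _).mpr ⟨c, ?_⟩).symm
    funext k
    change c * (s ^ k.val * ent (mat a) _ _) = s ^ k.val * ent (mat b) _ _
    rw [h, ent_smul]
    ring)

theorem rowPoint_cls (g : Sp m) : rowPoint hm hs (cls g) =
    Projectivization.mk ℂ _ (signed_plucker_ne_zero hm hs g) := rfl

theorem isRat_ent_mat {O : Set (Sp m)} (a b : ℕ) :
    FunSpace.IsRat (fun (g : Sp m) (ij : Fin (2 * m) × Fin (2 * m)) => mat g ij.1 ij.2) O
      fun g => ent (mat g) a b := by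
  unfold ent
  split_ifs with h
  · exact FunSpace.isRat_coord (j := fun (g : Sp m) (ij : Fin (2 * m) × Fin (2 * m)) =>
      mat g ij.1 ij.2) (⟨a, h.1⟩, ⟨b, h.2⟩)
  · exact FunSpace.isRat_const _

/-- Projective space as a quotient of the space of nonzero vectors. -/
def varXch (m : ℕ) : FunSpace (Xch m) :=
  ((FunSpace.affine (Fin (2 * m))).induced
    (fun v : {v : Fin (2 * m) → ℂ // v ≠ 0} => v.1)).quotient
      (fun v => (Projectivization.mk ℂ v.1 v.2 : Xch m))

theorem morphismOn_rowPoint :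
    FunSpace.MorphismOn (varPSp m) (varXch m) Set.univ (rowPoint hm hs) := by
  refine FunSpace.MorphismOn.of_quotient ?_
  refine FunSpace.MorphismOn.comp (F := fun g : Sp m =>
    (⟨_, signed_plucker_ne_zero hm hs g⟩ : {v : Fin (2 * m) → ℂ // v ≠ 0}))
    (FunSpace.isMorphism_quotient _ _) (FunSpace.morphismOn_of_isRat ?_ fun k => ?_)
  · exact @isOpen_univ _ (_ : TopologicalSpace _)
  · exact (FunSpace.isRat_const _).mul (isRat_ent_mat _ _)

variable {q : ℂ} (hq : q ≠ 0)

theorem rowPoint_zElt {P : ℕ → ℂ} (h0 : P 0 = 1) {U : Sp m} (hU : U ∈ Uplus m) :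
    ∃ h : (toVec m fun k => s ^ k * P k) ≠ 0,
      rowPoint hm hs (cls (zElt hm hq h0 U)) = Projectivization.mk ℂ _ h := by
  have h1 := plucker_zElt hm hq h0 hU s
  have h2 : (toVec m fun k => s ^ k * P k) ≠ 0 := by
    intro h
    have := signed_plucker_ne_zero hm hs (zElt hm hq h0 U)
    rw [h1, h, smul_zero] at this
    exact this rfl
  exact ⟨h2, (Projectivization.mk_eq_mk_iff' ℂ _ _ _ _).mpr ⟨q⁻¹, h1.symm⟩⟩

include hs in
theorem quad_toVec_sign_ne_zero {P : ℕ → ℂ} {k : ℕ} (hk' : k ≤ 2 * m) (h : quad m P k ≠ 0) :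
    quad m (pv (toVec m fun k => s ^ k * P k)) k ≠ 0 := by
  rw [quad_congr (fun i hi => pv_toVec _ hi) hk', quad_sign _ _ hk']
  exact mul_ne_zero (pow_ne_zero_of_mul_self hs _) h

theorem rowPoint_mem {z : PSp m} (hz : z ∈ Z m (cls (diagLift m hq))) :
    rowPoint hm hs z ∈ Xo m := by
  obtain ⟨P, h0, U, hU, ha, rfl⟩ := exists_zElt hm hq hz
  obtain ⟨h, he⟩ := rowPoint_zElt hm hs hq h0 hU
  rw [he, mk_mem_Xo_iff hm]
  exact fun k hk hk' => quad_toVec_sign_ne_zero hs hk'.le (quad_ne_zero hm hq h0 hU ha hk hk')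

/-- The coordinates `P` with `P_0 = 1` of the point with homogeneous coordinates `s ^ k * P_k`. -/
def affineCoords (s : ℂ) (v : Fin (2 * m) → ℂ) (k : ℕ) : ℂ :=
  -- Set to 1 outright so that the normalization `P 0 = 1` holds also where `p_0` vanishes.
  if k = 0 then 1 else s ^ k * (pv v k / pv v 0)

theorem affineCoords_smul (s : ℂ) {c : ℂ} (hc : c ≠ 0) (v : Fin (2 * m) → ℂ) :
    affineCoords s (c • v) = affineCoords s v := by
  funext k
  unfold affineCoords
  rw [pv_smul, pv_smul, mul_div_mul_left _ _ hc]

theorem affineCoords_eq (s : ℂ) {v : Fin (2 * m) → ℂ} (hv : pv v 0 ≠ 0) :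
    affineCoords s v = fun k => s ^ k * ((pv v 0)⁻¹ * pv v k) := by
  funext k
  unfold affineCoords
  split_ifs with h
  · rw [h, pow_zero, one_mul, inv_mul_cancel₀ hv]
  · rw [div_eq_inv_mul]

include hm in
theorem pv_zero_ne_zero {v : Fin (2 * m) → ℂ}
    (hv : ∀ k, 1 ≤ k → k < 2 * m → quad m (pv v) k ≠ 0) : pv v 0 ≠ 0 := by
  have := hv 1 le_rfl (by omega)
  rw [quad_one] at this
  exact left_ne_zero_of_mul this

include hm hs in
theorem quad_affineCoords_ne_zero {v : Fin (2 * m) → ℂ}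
    (hv : ∀ k, 1 ≤ k → k < 2 * m → quad m (pv v) k ≠ 0) (k : ℕ) (hk : 1 ≤ k)
    (hk' : k < 2 * m) : quad m (affineCoords s v) k ≠ 0 := by
  have h0 := pv_zero_ne_zero hm hv
  rw [affineCoords_eq s h0, quad_sign _ _ hk'.le, quad_smul]
  exact mul_ne_zero (pow_ne_zero_of_mul_self hs _)
    (mul_ne_zero (mul_ne_zero (inv_ne_zero h0) (inv_ne_zero h0)) (hv k hk hk'))

/-- The rational inverse of `rowPoint` on `Z_d`. -/
def rowInv (s : ℂ) (ξ : Xch m) : PSp m :=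
  Projectivization.lift (fun v : {v : Fin (2 * m) → ℂ // v ≠ 0} =>
    cls (zOf hm hq (affineCoords s v.1))) (by
    intro a b c h
    have hc : c ≠ 0 := by
      rintro rfl
      exact a.2 (by rw [h, zero_smul])
    rw [h, affineCoords_smul s hc]) ξ

theorem rowInv_mk (s : ℂ) {v : Fin (2 * m) → ℂ} (hv : v ≠ 0) :
    rowInv hm hq s (Projectivization.mk ℂ v hv) = cls (zOf hm hq (affineCoords s v)) := rfl

theorem affineCoords_zero (s : ℂ) (v : Fin (2 * m) → ℂ) : affineCoords s v 0 = 1 := if_pos rfl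

include hs in
theorem morphismOn_rowInv :
    FunSpace.MorphismOn (varXch m) (varPSp m) (Xo m) (rowInv hm hq s) := by
  refine FunSpace.MorphismOn.of_quotient ?_
  have hset : (fun v : {v : Fin (2 * m) → ℂ // v ≠ 0} =>
      (Projectivization.mk ℂ v.1 v.2 : Xch m)) ⁻¹' Xo m =
      {v | MvPolynomial.eval v.1 (Dsum m) ≠ 0} := by
    ext v
    exact (mk_mem_Xo_iff hm v.1 v.2).trans (eval_Dsum_ne_zero_iff hm v.1).symm
  rw [hset]
  have hquad : ∀ v ∈ {v : {v : Fin (2 * m) → ℂ // v ≠ 0} | MvPolynomial.eval v.1 (Dsum m) ≠ 0},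
      ∀ k, 1 ≤ k → k < 2 * m → quad m (pv v.1) k ≠ 0 :=
    fun v hv => (eval_Dsum_ne_zero_iff hm v.1).mp hv
  have hpv : ∀ k, FunSpace.IsRat (fun v : {v : Fin (2 * m) → ℂ // v ≠ 0} => v.1)
      {v | MvPolynomial.eval v.1 (Dsum m) ≠ 0} fun v => pv v.1 k := by
    intro k
    unfold pv
    split_ifs with h
    · exact FunSpace.isRat_coord (j := fun v : {v : Fin (2 * m) → ℂ // v ≠ 0} => v.1) ⟨k, h⟩
    · exact FunSpace.isRat_const _
  refine morphismOn_zOf hm hq (FunSpace.isOpen_eval_ne _) (fun k _ => ?_)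
    (fun v => affineCoords_zero s v.1) fun v hv => quad_affineCoords_ne_zero hm hs (hquad v hv)
  unfold affineCoords
  split_ifs
  · exact FunSpace.isRat_const _
  · exact (FunSpace.isRat_const _).mul
      ((hpv k).div (hpv 0) fun v hv => pv_zero_ne_zero hm (hquad v hv))

include hs in
theorem rowInv_mem {ξ : Xch m} (hξ : ξ ∈ Xo m) :
    rowInv hm hq s ξ ∈ Z m (cls (diagLift m hq)) := by
  induction ξ using Projectivization.ind with
  | h v hv =>
    rw [mk_mem_Xo_iff hm] at hξ
    exact cls_zOf_mem hm hq (affineCoords_zero s v) (quad_affineCoords_ne_zero hm hs hξ)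

theorem rowInv_rowPoint {z : PSp m} (hz : z ∈ Z m (cls (diagLift m hq))) :
    rowInv hm hq s (rowPoint hm hs z) = z := by
  obtain ⟨P, h0, U, hU, ha, rfl⟩ := exists_zElt hm hq hz
  obtain ⟨h, he⟩ := rowPoint_zElt hm hs hq h0 hU
  rw [he, rowInv_mk, zOf_eq hm hq h0 hU ha]
  intro k hk
  have h1 : pv (toVec m fun k => s ^ k * P k) 0 = 1 := by
    rw [pv_toVec _ (by omega), h0, pow_zero, mul_one]
  rw [affineCoords_eq s (by rw [h1]; exact one_ne_zero)]
  dsimp only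
  rw [h1, pv_toVec _ hk, inv_one, one_mul, ← mul_assoc, pow_mul_pow_eq_one hs, one_mul]

theorem rowPoint_rowInv {ξ : Xch m} (hξ : ξ ∈ Xo m) :
    rowPoint hm hs (rowInv hm hq s ξ) = ξ := by
  induction ξ using Projectivization.ind with
  | h v hv =>
    rw [mk_mem_Xo_iff hm] at hξ
    have hq' := quad_affineCoords_ne_zero hm hs hξ
    have h0 := affineCoords_zero s v
    obtain ⟨h, he⟩ := rowPoint_zElt hm hs hq h0 (uLift_mem hm hq h0 hq')
    rw [rowInv_mk, zOf_def hm hq h0 hq', he]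
    refine (Projectivization.mk_eq_mk_iff' ℂ _ _ _ _).mpr ⟨(pv v 0)⁻¹, ?_⟩
    funext k
    rw [affineCoords_eq s (pv_zero_ne_zero hm hξ), Pi.smul_apply, smul_eq_mul, toVec, ← mul_assoc,
      pow_mul_pow_eq_one hs, one_mul, pv_coe]

/-- `rowPoint` as a map `Z_d → X̌°`. -/
def piL (z : Z m (cls (diagLift m hq))) : Xo m := ⟨rowPoint hm hs z.1, rowPoint_mem hm hs hq z.2⟩

theorem isIso_piL : FunSpace.IsIso (varZ m (cls (diagLift m hq))) (varXo m) (piL hm hs hq) := by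
  refine ⟨(morphismOn_rowPoint hm hs).induced _ _ _ (fun _ => Set.mem_univ _) fun _ => rfl,
    fun ξ => ⟨rowInv hm hq s ξ.1, rowInv_mem hm hs hq ξ.2⟩,
    (morphismOn_rowInv hm hs hq).induced _ _ _ (fun ξ => ξ.2) fun _ => rfl,
    fun z => Subtype.ext (rowInv_rowPoint hm hs hq z.2),
    fun ξ => Subtype.ext (rowPoint_rowInv hm hs hq ξ.2)⟩

end alpha

/-! ### The map from `Z_d` to the open Richardson variety -/

section rho

variable (hm : 2 ≤ m) {q : ℂ} (hq : q ≠ 0)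

/-- The last column of a matrix. -/
def lastCol (g : Sp m) (i : ℕ) : ℂ := ent (mat g) i (2 * m - 1)

/-- The class of a symplectic matrix in the flag variety. -/
def flagCls (g : Sp m) : Flag m := QuotientGroup.mk (cls g)

theorem flagCls_surjective : Function.Surjective (flagCls : Sp m → Flag m) :=
  QuotientGroup.mk_surjective.comp cls_surjective

include hm in
-- Right multiplication by a lower triangular matrix rescales the last column, so this column is a
-- point of projective space attached to the flag.
theorem lastCol_of_flagCls_eq {g h : Sp m} (H : flagCls g = flagCls h) :
    ∃ c : ℂ, c ≠ 0 ∧ lastCol h = fun i => c * lastCol g i := by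
  obtain ⟨b, hb, hb'⟩ := QuotientGroup.eq.mp H
  have h1 : cls (g * b) = cls h := by
    rw [cls_mul]
    exact eq_inv_mul_iff_mul_eq.mp hb'
  obtain ⟨c, hc, h2⟩ := cls_eq_iff.mp h1
  have hb2 := tr_mem_upperSp hb
  have h3 := upperSp_diag_ne_zero hb2 (a := 2 * m - 1) (by omega)
  rw [mat_tr, ent_transpose] at h3
  refine ⟨c * ent (mat b) (2 * m - 1) (2 * m - 1), mul_ne_zero hc h3, funext fun i => ?_⟩
  unfold lastCol
  rw [h2, ent_smul, mat_mul, ent_mul, Finset.sum_eq_single (2 * m - 1)]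
  · ring
  · intro k hk hk'
    rw [Finset.mem_range] at hk
    rw [mem_lowerSp_iff.mp hb _ _ (by omega), mul_zero]
  · intro h
    exact absurd (Finset.mem_range.mpr (by omega)) h

/-- The rational section of `PSp → PSp / B_-` with values in `Z_d`. -/
def flagSection (ξ : Flag m) : PSp m :=
  cls (zOf hm hq (pInv m q (lastCol (Function.surjInv flagCls_surjective ξ))))

theorem flagSection_flagCls (g : Sp m) :
    flagSection hm hq (flagCls g) = cls (zOf hm hq (pInv m q (lastCol g))) := by
  obtain ⟨c, hc, h⟩ := lastCol_of_flagCls_eq hm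
    (Function.surjInv_eq flagCls_surjective (flagCls g)).symm
  unfold flagSection
  rw [h, funext (pInv_smul (m := m) q hc (lastCol g))]

/-- The condition on the last column under which the section is regular. -/
def IsRegularCol (m : ℕ) (q : ℂ) (B : ℕ → ℂ) : Prop :=
  (∀ k, 1 ≤ k → k < 2 * m → quad m B k ≠ 0) ∧
    ∀ k, 1 ≤ k → k < 2 * m → quad m (pInv m q B) k ≠ 0

theorem IsRegularCol.smul {B : ℕ → ℂ} (h : IsRegularCol m q B) {c : ℂ} (hc : c ≠ 0) :
    IsRegularCol m q fun i => c * B i := by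
  refine ⟨fun k hk hk' => ?_, fun k hk hk' => ?_⟩
  · rw [quad_smul]
    exact mul_ne_zero (mul_ne_zero hc hc) (h.1 k hk hk')
  · rw [funext (pInv_smul (m := m) q hc B)]
    exact h.2 k hk hk'

/-- The locus in the flag variety on which the section is regular. -/
def regularFlags (m : ℕ) (q : ℂ) : Set (Flag m) := flagCls '' {g | IsRegularCol m q (lastCol g)}

include hm in
theorem flagCls_mem_regularFlags (g : Sp m) :
    flagCls g ∈ regularFlags m q ↔ IsRegularCol m q (lastCol g) := by
  constructor
  · rintro ⟨h, hh, he⟩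
    obtain ⟨c, hc, h1⟩ := lastCol_of_flagCls_eq hm he
    rw [h1]
    exact IsRegularCol.smul hh hc
  · exact fun h => ⟨g, h, rfl⟩

theorem morphismOn_flagSection :
    FunSpace.MorphismOn ((varPSp m).quotient (fun g => (QuotientGroup.mk g : Flag m))) (varPSp m)
      (regularFlags m q) (flagSection hm hq) := by
  refine FunSpace.MorphismOn.of_quotient (FunSpace.MorphismOn.of_quotient ?_)
  set j := fun (g : Sp m) (ij : Fin (2 * m) × Fin (2 * m)) => mat g ij.1 ij.2 with hj
  have hfun : (flagSection hm hq ∘ fun g : PSp m => (QuotientGroup.mk g : Flag m)) ∘ cls =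
      fun g : Sp m => cls (zOf hm hq (pInv m q (lastCol g))) :=
    funext fun g => flagSection_flagCls hm hq g
  -- Openness takes two stages: `pInv` has no poles only on `O₁`, where the forms of the last column
  -- are nonzero, and `O₂` is cut out of `O₁` by a condition on `pInv`.
  set O₁ : Set (Sp m) := {g | g ∈ Set.univ ∧ MvPolynomial.eval (toVec m (lastCol g)) (Dsum m) ≠ 0}
  set O₂ : Set (Sp m) :=
    {g | g ∈ O₁ ∧ MvPolynomial.eval (toVec m (pInv m q (lastCol g))) (Dsum m) ≠ 0}
  have hD : ∀ P : ℕ → ℂ, MvPolynomial.eval (toVec m P) (Dsum m) ≠ 0 ↔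
      ∀ k, 1 ≤ k → k < 2 * m → quad m P k ≠ 0 := by
    intro P
    rw [eval_Dsum_ne_zero_iff hm]
    refine forall_congr' fun k => imp_congr_right fun _ => imp_congr_right fun hk => ?_
    rw [quad_congr (fun i hi => pv_toVec P hi) hk.le]
  have hset : cls ⁻¹' ((fun g : PSp m => (QuotientGroup.mk g : Flag m)) ⁻¹' regularFlags m q) =
      O₂ := by
    ext g
    refine (flagCls_mem_regularFlags hm g).trans ?_
    simp only [O₂, O₁, Set.mem_ofPred_eq, Set.mem_univ, true_and, hD]
    exact Iff.rfl
  have hO₁ : ((FunSpace.affine _).induced j).top.IsOpen O₁ :=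
    (FunSpace.isRat_eval (fun i => isRat_ent_mat _ _) _).isOpen_ne
      (@isOpen_univ _ (_ : TopologicalSpace _))
  have hB : ∀ (O : Set (Sp m)) (k : ℕ), FunSpace.IsRat j O fun g => lastCol g k :=
    fun O k => isRat_ent_mat _ _
  have hO₂ : ((FunSpace.affine _).induced j).top.IsOpen O₂ :=
    (FunSpace.isRat_eval (fun i => isRat_pInv q (fun k _ => hB O₁ k)
      (fun g hg => (hD _).mp hg.2) i.2) _).isOpen_ne hO₁
  rw [hset, hfun]
  exact morphismOn_zOf hm hq hO₂
    (fun k hk => isRat_pInv q (fun k _ => hB O₂ k) (fun g hg => (hD _).mp hg.1.2) hk)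
    (fun g => if_pos rfl) fun g hg => (hD _).mp hg.2

theorem flagSection_mk {z : PSp m} (hz : z ∈ Z m (cls (diagLift m hq))) :
    flagSection hm hq (QuotientGroup.mk z) = z := by
  obtain ⟨P, h0, U, hU, ha, rfl⟩ := exists_zElt hm hq hz
  refine (flagSection_flagCls hm hq _).trans ?_
  rw [zOf_eq hm hq h0 hU ha]
  exact fun k hk => pInv_zElt hm hq h0 hU ha hk

include hm in
-- Both conditions hold on the image of `Z_d`: the forms of the last column are nonzero because
-- their products with the `S_k(P)` are `-1`, and `pInv` returns `P` itself.
theorem mk_mem_regularFlags {z : PSp m} (hz : z ∈ Z m (cls (diagLift m hq))) :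
    (QuotientGroup.mk z : Flag m) ∈ regularFlags m q := by
  obtain ⟨P, h0, U, hU, ha, rfl⟩ := exists_zElt hm hq hz
  refine (flagCls_mem_regularFlags hm _).mpr ⟨fun k hk hk' h => ?_, fun k hk hk' => ?_⟩
  · have h1 := quad_last_mul_quad hm hq h0 hU ha hk hk'
    unfold lastCol at h
    rw [h, zero_mul] at h1
    exact neg_ne_zero.mpr one_ne_zero h1.symm
  · unfold lastCol
    rw [quad_congr (Q := P) (fun i hi => pInv_zElt hm hq h0 hU ha hi) hk'.le]
    exact quad_ne_zero hm hq h0 hU ha hk hk'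

/-- The projection `Z_d → R`. -/
def piR (z : Z m (cls (diagLift m hq))) : R m := ⟨QuotientGroup.mk z.1, mk_mem_R hq z.2⟩

include hm in
theorem exists_piR_eq (ξ : R m) : ∃ z, piR hq z = ξ := by
  obtain ⟨z, hz, h⟩ := exists_mk_eq hm hq ξ.2
  exact ⟨⟨z, hz⟩, Subtype.ext h⟩

include hm in
theorem flagSection_mem (ξ : R m) : flagSection hm hq ξ.1 ∈ Z m (cls (diagLift m hq)) := by
  obtain ⟨z, rfl⟩ := exists_piR_eq hm hq ξ
  change flagSection hm hq (QuotientGroup.mk z.1) ∈ _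
  rw [flagSection_mk hm hq z.2]
  exact z.2

/-- The inverse of `piR`. -/
def piRInv (ξ : R m) : Z m (cls (diagLift m hq)) := ⟨_, flagSection_mem hm hq ξ⟩

theorem piRInv_piR (z : Z m (cls (diagLift m hq))) : piRInv hm hq (piR hq z) = z :=
  Subtype.ext (flagSection_mk hm hq z.2)

theorem piR_piRInv (ξ : R m) : piR hq (piRInv hm hq ξ) = ξ := by
  obtain ⟨z, rfl⟩ := exists_piR_eq hm hq ξ
  rw [piRInv_piR]

theorem isMorphism_piR :
    FunSpace.IsMorphism (varZ m (cls (diagLift m hq))) (varR m) (piR hq) :=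
  (FunSpace.isMorphism_quotient (varPSp m)
    (fun g => (QuotientGroup.mk g : Flag m))).morphismOn.induced _ _ _
      (fun _ => Set.mem_univ _) fun _ => rfl

theorem isMorphism_piRInv :
    FunSpace.IsMorphism (varR m) (varZ m (cls (diagLift m hq))) (piRInv hm hq) := by
  refine (morphismOn_flagSection hm hq).induced _ _ _ (fun ξ => ?_) fun _ => rfl
  obtain ⟨z, rfl⟩ := exists_piR_eq hm hq ξ
  exact mk_mem_regularFlags hm hq z.2

include hm in
theorem isIso_piR : FunSpace.IsIso (varZ m (cls (diagLift m hq))) (varR m) (piR hq) :=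
  ⟨isMorphism_piR hq, piRInv hm hq, isMorphism_piRInv hm hq, piRInv_piR hm hq, piR_piRInv hm hq⟩

theorem isIso_piRInv :
    FunSpace.IsIso (varR m) (varZ m (cls (diagLift m hq))) (piRInv hm hq) :=
  ⟨isMorphism_piRInv hm hq, piR hq, isMorphism_piR hq, piR_piRInv hm hq, piRInv_piR hm hq⟩

end rho

/-- The isomorphism `R → X̌°`, with coordinates multiplied by `s ^ k`, and the values of a
superpotential `V` that agrees with `W_q` on `Z_d`. -/
theorem exists_mirror_iso (hm : 2 ≤ m) {q s : ℂ} (hq : q ≠ 0) (hs : s * s = 1)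
    (V : Flag m → ℂ → Prop)
    (hV : ∀ ξ t, V ξ t → ∃ g : Sp m, cls g ∈ Z m (cls (diagLift m hq)) ∧
      (QuotientGroup.mk (cls g) : Flag m) = ξ ∧
        t = Wvec q fun k => s ^ k.val * plucker g k)
    (hV' : ∀ z ∈ Z m (cls (diagLift m hq)), ∃ t, V (QuotientGroup.mk z) t) :
    ∃ φ : R m → Xo m,
      (∀ z, ∀ g : Sp m, cls g = z.1 →
        HasCoords (φ (piR hq z)).1 fun k => s ^ k.val * plucker g k) ∧
      FunSpace.IsIso (varR m) (varXo m) φ ∧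
      ∀ (ξ : R m) (t : ℂ), V ξ.1 t ↔ t = W q (φ ξ).1 := by
  have hcoords : ∀ z, ∀ g : Sp m, cls g = z.1 →
      HasCoords ((piL hm hs hq ∘ piRInv hm hq) (piR hq z)).1
        fun k => s ^ k.val * plucker g k := by
    intro z g hg
    rw [Function.comp_apply, piRInv_piR]
    refine ⟨signed_plucker_ne_zero hm hs g, ?_⟩
    change rowPoint hm hs z.1 = _
    rw [← hg, rowPoint_cls]
  have hval : ∀ (ξ : R m) (t : ℂ), V ξ.1 t → t = W q ((piL hm hs hq ∘ piRInv hm hq) ξ).1 := by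
    intro ξ t ht
    obtain ⟨g, hg, he, rfl⟩ := hV _ _ ht
    obtain rfl : piR hq ⟨cls g, hg⟩ = ξ := Subtype.ext he
    rw [W_of_hasCoords q (hcoords _ g rfl)]
  refine ⟨piL hm hs hq ∘ piRInv hm hq, hcoords, (isIso_piL hm hs hq).comp (isIso_piRInv hm hq),
    fun ξ t => ⟨hval ξ t, fun h => ?_⟩⟩
  obtain ⟨z, rfl⟩ := exists_piR_eq hm hq ξ
  obtain ⟨t', ht'⟩ := hV' z.1 z.2
  rw [h, ← hval (piR hq z) t' ht']
  exact ht'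

end QuadricLG

end

/-! ### The mirror isomorphisms for both normalizations -/

theorem theoremt (m : ℕ) (hm : 2 ≤ m) (q : ℂ) (hq : q ≠ 0) :
    -- `D = D_0 + ⋯ + D_m` is an anticanonical divisor
    QuadricLG.IsAnticanonicalEq m (QuadricLG.Dsum m) ∧
    -- there is exactly one `d ∈ T^{W_P}` with `α_1(d) = q`, and for it:
    (∃! d : QuadricLG.PSp m, d ∈ QuadricLG.TWP m ∧ QuadricLG.alpha1 d = q) ∧
    ∀ d : QuadricLG.PSp m, d ∈ QuadricLG.TWP m → QuadricLG.alpha1 d = q →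
      ∃ πR : QuadricLG.Z m d → QuadricLG.R m,
        -- `π_R : z ↦ z B_-` is an isomorphism `Z_d → R`
        (∀ z, (πR z).1 = QuotientGroup.mk z.1) ∧
        FunSpace.IsIso (QuadricLG.varZ m d) (QuadricLG.varR m) πR ∧
        -- `φ = π_L ∘ π_R⁻¹` is an isomorphism `R → X̌°` that identifies `F_q` with `W_q`
        (∃ φ : QuadricLG.R m → QuadricLG.Xo m,
          (∀ z, ∀ g : QuadricLG.Sp m, QuadricLG.cls g = z.1 →
            QuadricLG.HasCoords (φ (πR z)).1 (QuadricLG.plucker g)) ∧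
          FunSpace.IsIso (QuadricLG.varR m) (QuadricLG.varXo m) φ ∧
          ∀ (ξ : QuadricLG.R m) (t : ℂ),
            QuadricLG.IsValue d ξ.1 t ↔ t = QuadricLG.W q (φ ξ).1) ∧
        -- the same for the normalization of `F_q` through `z = u₁ d ẇ_P ū₂⁻¹`, with the
        -- coordinates `(-1)^k p_k` in place of `p_k`
        (∃ ψ : QuadricLG.R m → QuadricLG.Xo m,
          (∀ z, ∀ g : QuadricLG.Sp m, QuadricLG.cls g = z.1 →
            QuadricLG.HasCoords (ψ (πR z)).1 (fun k => (-1) ^ k.val * QuadricLG.plucker g k)) ∧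
          FunSpace.IsIso (QuadricLG.varR m) (QuadricLG.varXo m) ψ ∧
          ∀ (ξ : QuadricLG.R m) (t : ℂ),
            QuadricLG.IsValueInv d ξ.1 t ↔ t = QuadricLG.W q (ψ ξ).1) := by
  refine ⟨QuadricLG.isAnticanonicalEq_Dsum hm,
    ⟨_, ⟨QuadricLG.cls_diagLift_mem hq, QuadricLG.alpha1_diagLift hm hq⟩,
      fun d hd => QuadricLG.eq_diagLift hm hq hd.1 hd.2⟩, fun d hd hα => ?_⟩
  obtain rfl := QuadricLG.eq_diagLift hm hq hd hα
  refine ⟨QuadricLG.piR hq, fun _ => rfl, QuadricLG.isIso_piR hm hq, ?_, ?_⟩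
  · have := QuadricLG.exists_mirror_iso (s := 1) hm hq (by norm_num)
      (QuadricLG.IsValue (QuadricLG.cls (QuadricLG.diagLift m hq)))
      (fun ξ t h => by simpa only [one_pow, one_mul] using h.exists_eq hm hq)
      fun z hz => QuadricLG.exists_isValue hm hq hz
    simpa only [one_pow, one_mul] using this
  · exact QuadricLG.exists_mirror_iso (s := -1) hm hq (by norm_num)
      (QuadricLG.IsValueInv (QuadricLG.cls (QuadricLG.diagLift m hq)))
      (fun ξ t h => h.exists_eq hm hq) fun z hz => QuadricLG.exists_isValueInv hq hz
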